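/- Let $C=(C_{i,j})_{1\le i,j\le 2}$ be a generalized Cartan matrix of size $2$ ($C_{i,j}\in\mathbb{Z}$, $C_{i,i}=2$, $C_{i,j}\le 0$ for $i\ne j$, $C_{1,2}=0\Leftrightarrow C_{2,1}=0$), and let $r_1,r_2\ge 1$ be integers such that $B=DC$ is symmetric, where $D=\mathrm{diag}(r_1,r_2)$. Write $[l]_x=\frac{x^l-x^{-l}}{x-x^{-1}}$. Let $C(z)$ be the matrix with $C_{i,i}(z)=z^{r_i}+z^{-r_i}$ and $C_{i,j}(z)=[C_{i,j}]_z$ for $i\neq j$, and assume $\det C(z)\neq 0$. Put $Q=C(z)$ if the matrix $([r_i]_zC_{i,j}(z))_{i,j}$ is symmetric, and $Q=([C_{i,j}]_{z^{r_i}})_{i,j}$ otherwise; write $Q_{i,j}=\sum_k Q_{i,j}^{(k)}z^k$. *Monomials.* For a formal monomial $m=\prod_{i,l} Y_{i,l}^{y_{i,l}}A_{i,l}^{-v_{i,l}}$ ($i\in\{1,2\}$, $l\in\mathbb{Z}$, almost all exponents $0$, $y_{i,l},v_{i,l}\ge 0$) let $u_{i,l}(m)=y_{i,l}-\sum_{j,k}Q_{i,j}^{(k)}v_{j,l+k}$.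 It is dominant (resp. antidominant, $i$-dominant) if all $u_{j,l}(m)\ge 0$ (resp. all $u_{j,l}(m)\le 0$, all $u_{i,l}(m)\geq 0$ for this $i$). In $\mathcal{Y}=\mathbb{Z}[Y_{i,l}^{\pm1}]$ put $A_{i,l}^{-1}=\prod_{j,k}Y_{j,k}^{u_{j,k}(A_{i,l}^{-1})}$; let $u_{i,l}(m)$ be the exponent of $Y_{i,l}$ in a Laurent monomial $m$ of $\mathcal{Y}$, and let $B$ (as a set of monomials) denote the set of dominant Laurent monomials. *Classical objects.* Let $\mathcal{Y}_i$ be the quotient of $\bigoplus_l\mathcal{Y}S_{i,l}$ by the submodule generated by the $S_{i,l-r_i}-A_{i,l}^{-1}S_{i,l+r_i}$, let $S_i:\mathcal{Y}\to\mathcal{Y}_i$ be the additive map with $S_i(m)=m\sum_l u_{i,l}(m)S_{i,l}$ for Laurent monomials $m$, and $\mathfrak{K}=\ker S_1\cap\ker S_2$. For $i$-dominant $m$ put $E_i(m)=m\prod_l(1+A_{i,l+r_i}^{-1})^{u_{i,l}(m)}$. For $m\in B$ the classical algorithm beginning with $m$ computes integers $s(m')$, $s_i(m')$ for the monomials $m'\le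 m$, i.e. $m'=mA_{i_1,l_1}^{-1}\cdots A_{i_N,l_N}^{-1}$: $s(m)=1$, $s_i(m)=0$; $s_i(m')=\sum_{m''}(s(m'')-s_i(m''))[E_i(m'')]_{m'}$, summed over the $i$-dominant $m''$ with $m'<m''\le m$, where $[\,\cdot\,]_{m'}$ is the coefficient of $m'$; and for $m'\neq m$, $s(m')=0$ if $m'$ is dominant, while $s(m')=s_i(m')$ for every $i$ such that $m'$ is not $i$-dominant. It is well defined if these requirements on $s$ are never contradictory, and then $F(m)=\sum_{m'\le m}s(m')m'$ (possibly an infinite sum). *Deformed objects.* Let $\hat{\mathcal{Y}}_t$ be the $\mathbb{Z}[t^{\pm1}]$-algebra whose basis $\overline{A}$ is the set of the formal monomials $m=\prod Y_{i,l}^{y_{i,l}}A_{i,l}^{-v_{i,l}}$, with product $m_1*m_2=t^{d_1(m_1,m_2)+d_2(m_1,m_2)}m_1m_2$, where $$d_1(m_1,m_2)=\sum_{i,l}\big(v_{i,l+r_i}(m_1)u_{i,l}(m_2)+y_{i,l+r_i}(m_1)v_{i,l}(m_2)\big),$$ $$d_2(m_1,m_2)=\sum_{i,l}\big(u_{i,l+r_i}(m_1)v_{i,l}(m_2)+v_{i,l+r_i}(m_1)y_{i,l}(m_2)\big).$$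 Let $\tilde{Y}_{i,l}$ be the basis element $Y_{i,l}$ and $\tilde{A}_{i,l}^{-1}=t^{-1}A_{i,l}^{-1}$. Let $\hat{\mathcal{Y}}_{i,t}$ be the $\hat{\mathcal{Y}}_t$-bimodule which as a left module is the quotient of $\bigoplus_l\hat{\mathcal{Y}}_t\tilde{S}_{i,l}$ by the submodule generated by the $\tilde{S}_{i,l-r_i}-t^{-1}\tilde{A}_{i,l}^{-1}\tilde{S}_{i,l+r_i}$, with $\tilde{S}_{i,l}m=t^{2u_{i,l}(m)}m\tilde{S}_{i,l}$ for monomials $m$; let $S_{i,t}:\hat{\mathcal{Y}}_t\to\hat{\mathcal{Y}}_{i,t}$ be the $\mathbb{Z}[t^{\pm1}]$-linear map with $S_{i,t}(m)=\sum_l\frac{t^{2u_{i,l}(m)}-1}{t^2-1}\,m\tilde{S}_{i,l}$ for monomials $m$, and $\hat{\mathfrak{K}}_t=\ker S_{1,t}\cap\ker S_{2,t}$. Let $\hat{\mathcal{Y}}_t^\infty\supset\hat{\mathcal{Y}}_t$ be the completion for the grading $\deg m=\sum v_{i,l}(m)$. Finally let $C(\tilde{Y}_{i,0})=C(Y_{i,0})\subset\overline{A}$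 be the set of monomials $Y_{i,0}A_{i_1,l_1}^{-1}\cdots A_{i_N,l_N}^{-1}$ with $N\ge 0$ and all $l_k\ge 0$, and $\tilde{C}(\tilde{Y}_{i,0})$ the set of elements of $\hat{\mathcal{Y}}_t^\infty$ all of whose monomials lie in $C(\tilde{Y}_{i,0})$. **Proposition.** The following properties are equivalent: (i) for every $m\in B$, the classical algorithm beginning with $m$ is well defined and $F(m)\in\mathfrak{K}$ (in particular $F(m)$ is a finite sum); (ii) $C$ is finite, i.e. all its principal minors are positive; (iii) $C_{1,2}C_{2,1}\le 3$; (iv) $\hat{\mathfrak{K}}_t\cap\tilde{C}(\tilde{Y}_{i,0})\neq\{0\}$ for at least one $i\in\{1,2\}$; (v) $C(Y_{i,0})$ contains an antidominant monomial for at least one $i\in\{1,2\}$. -/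

import Mathlib

open scoped LaurentPolynomial

noncomputable section

namespace QTChar

/-! ### Cartan matrices and their deformations -/

/-- Generalized Cartan matrices. -/
structure IsGCM {n : ℕ} (C : Matrix (Fin n) (Fin n) ℤ) : Prop where
  diag : ∀ i, C i i = 2
  nonpos : ∀ i j, i ≠ j → C i j ≤ 0
  zero_iff : ∀ i j, C i j = 0 ↔ C j i = 0

/-- `C` is finite: all its principal minors are positive. -/
def IsFiniteType {n : ℕ} (C : Matrix (Fin n) (Fin n) ℤ) : Prop :=
  ∀ J : Finset (Fin n), 0 < (C.submatrix (fun i : J => (i : Fin n)) (fun i : J => (i : Fin n))).det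

/-- `B = DC` is symmetric, where `D = diag(r_1, …, r_n)`. -/
def IsSymmetrizedBy {n : ℕ} (C : Matrix (Fin n) (Fin n) ℤ) (r : Fin n → ℕ) : Prop :=
  (Matrix.diagonal (fun i => (r i : ℤ)) * C).IsSymm

/-- The quantum integer `[l]_x = (x ^ l - x ^ (-l)) / (x - x⁻¹)` for `x = z ^ a`, written as
`± (x ^ (-|l| + 1) + x ^ (-|l| + 3) + ⋯ + x ^ (|l| - 1))`, with the sign of `l`. -/
def quantumInt (a : ℕ) (l : ℤ) : ℤ[T;T⁻¹] :=
  l.sign • ∑ k ∈ Finset.range l.natAbs, LaurentPolynomial.T ((a : ℤ) * (2 * (k : ℤ) + 1 - |l|))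

/-- The matrix `C(z)`: `C_{ii}(z) = z ^ r_i + z ^ (-r_i)`, `C_{ij}(z) = [C_{ij}]_z` for `i ≠ j`. -/
def cartanZ {n : ℕ} (C : Matrix (Fin n) (Fin n) ℤ) (r : Fin n → ℕ) :
    Matrix (Fin n) (Fin n) ℤ[T;T⁻¹] :=
  Matrix.of fun i j =>
    if i = j then LaurentPolynomial.T (r i : ℤ) + LaurentPolynomial.T (-(r i : ℤ))
    else quantumInt 1 (C i j)

/-- The matrix `C'(z)`: `C'_{ij}(z) = [C_{ij}]_{z_i}` with `z_i = z ^ r_i`. -/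
def cartanZ' {n : ℕ} (C : Matrix (Fin n) (Fin n) ℤ) (r : Fin n → ℕ) :
    Matrix (Fin n) (Fin n) ℤ[T;T⁻¹] :=
  Matrix.of fun i j => quantumInt (r i) (C i j)

/-- The matrix `B(z) = D(z) C(z)` with `D(z) = diag([r_1]_z, …, [r_n]_z)`. -/
def symCartanZ {n : ℕ} (C : Matrix (Fin n) (Fin n) ℤ) (r : Fin n → ℕ) :
    Matrix (Fin n) (Fin n) ℤ[T;T⁻¹] :=
  Matrix.diagonal (fun i => quantumInt 1 (r i : ℤ)) * cartanZ C r

open scoped Classical in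
/-- The deformed Cartan matrix from which the exponents `u_{i,l}` and the deformed product are
built: `C(z)` when `B(z)` is symmetric, and `C'(z)` otherwise. -/
def defCartan {n : ℕ} (C : Matrix (Fin n) (Fin n) ℤ) (r : Fin n → ℕ) :
    Matrix (Fin n) (Fin n) ℤ[T;T⁻¹] :=
  if (symCartanZ C r).IsSymm then cartanZ C r else cartanZ' C r

/-! ### Monomials (generic case, `l ∈ ℤ`)

In what follows `Q` is a deformed Cartan matrix. -/

/-- Exponents of `∏ Y_{i,l} ^ {y_{i,l}} A_{i,l} ^ {-v_{i,l}}`, as the pair `(y, v)`. These index the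
`ℤ[t^±]`-basis `Ā` of `Ŷ_t` (exactly one representative of each monomial up to a power of `t`). -/
abbrev Mon (n : ℕ) : Type := (Fin n × ℤ →₀ ℕ) × (Fin n × ℤ →₀ ℕ)

/-- Exponents of a Laurent monomial `∏ Y_{i,l} ^ {u_{i,l}}` of `𝒴 = ℤ[Y_{i,l}^±]`. -/
abbrev YMon (n : ℕ) : Type := Fin n × ℤ →₀ ℤ

/-- The exponent vector of `A_{j,k}` in `𝒴`: the exponent of `Y_{i,l}` in `A_{j,k}` is the
coefficient of `z ^ (k - l)` in `Q i j`. -/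
def aVec {n : ℕ} (Q : Matrix (Fin n) (Fin n) ℤ[T;T⁻¹]) (p : Fin n × ℤ) : YMon n :=
  ∑ i, (Q i p.1).coeff.sum fun e c => Finsupp.single (i, p.2 - e) c

/-- The exponent vector of `∏ A_{j,k} ^ {v_{j,k}}` in `𝒴`. -/
def aSum {n : ℕ} (Q : Matrix (Fin n) (Fin n) ℤ[T;T⁻¹]) (v : Fin n × ℤ →₀ ℕ) : YMon n :=
  v.sum fun p c => c • aVec Q p

/-- The exponents `u_{i,l}(m) = y_{i,l}(m) - ∑_j (Q_{ij}(z))_op v_{j,l}(m)`, that is, the Laurent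
monomial `Π̂(m)`. -/
def uExp {n : ℕ} (Q : Matrix (Fin n) (Fin n) ℤ[T;T⁻¹]) (m : Mon n) : YMon n :=
  m.1.mapRange (fun c : ℕ => (c : ℤ)) rfl - aSum Q m.2

/-- `m` is dominant. -/
def Dominant {n : ℕ} (u : YMon n) : Prop := ∀ p, 0 ≤ u p

/-- `m` is antidominant. -/
def Antidominant {n : ℕ} (u : YMon n) : Prop := ∀ p, u p ≤ 0

/-- `m` is `i`-dominant. -/
def IDominant {n : ℕ} (i : Fin n) (u : YMon n) : Prop := ∀ l : ℤ, 0 ≤ u (i, l)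

/-- The monomial `Ỹ_{i,l}`. -/
def monY {n : ℕ} (i : Fin n) (l : ℤ) : Mon n := (Finsupp.single (i, l) 1, 0)

/-- The monomial of `Ā` proportional to `Ã_{i,l}⁻¹` (it is `t Ã_{i,l}⁻¹`). -/
def monV {n : ℕ} (i : Fin n) (l : ℤ) : Mon n := (0, Finsupp.single (i, l) 1)

/-- The degree: `Ã_{i,l}⁻¹` has degree `1` and `Ỹ_{i,l}` has degree `0`. -/
def monDeg {n : ℕ} (m : Mon n) : ℕ := m.2.sum fun _ c => c

/-- `C(m)`: the monomials `m Ã_{i_1,l_1}⁻¹ ⋯ Ã_{i_N,l_N}⁻¹` with `N ≥ 0` and all `l_k ≥ u(m)`,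
where `u(m) = max {l | ∀ k < l, ∀ i, u_{i,k}(m) = 0}`. -/
def coneC {n : ℕ} (Q : Matrix (Fin n) (Fin n) ℤ[T;T⁻¹]) (m : Mon n) : Set (Mon n) :=
  {m' | ∃ L : ℤ, IsGreatest {l : ℤ | ∀ k < l, ∀ i, uExp Q m (i, k) = 0} L ∧
    ∃ w : Fin n × ℤ →₀ ℕ, (∀ p ∈ w.support, L ≤ p.2) ∧ m' = m + (0, w)}

/-! ### Classical screening operators -/

/-- The ring `𝒴 = ℤ[Y_{i,l}^±]`. -/
abbrev Y0 (n : ℕ) : Type := AddMonoidAlgebra ℤ (YMon n)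

/-- The submodule `∑_l 𝒴 (S_{i,l-r_i} - A_{i,l}⁻¹ S_{i,l+r_i})` of `⨁_l 𝒴 S_{i,l}`. -/
def clRel {n : ℕ} (Q : Matrix (Fin n) (Fin n) ℤ[T;T⁻¹]) (r : Fin n → ℕ) (i : Fin n) :
    Submodule (Y0 n) (ℤ →₀ Y0 n) :=
  Submodule.span (Y0 n) (Set.range fun l : ℤ =>
    (Finsupp.single (l - r i) (1 : Y0 n) -
      Finsupp.single (l + r i) (AddMonoidAlgebra.single (-aVec Q (i, l)) (1 : ℤ) : Y0 n)))

/-- The element `m ∑_l u_{i,l}(m) S_{i,l}` of `⨁_l 𝒴 S_{i,l}`, for a Laurent monomial `m`. -/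
def clScreenMon {n : ℕ} (i : Fin n) (m : YMon n) : ℤ →₀ Y0 n :=
  m.sum fun p c =>
    if p.1 = i then Finsupp.single p.2 (AddMonoidAlgebra.single m c : Y0 n) else 0

/-- The classical screening operator `S_i : 𝒴 → 𝒴_i`. -/
def clScreen {n : ℕ} (Q : Matrix (Fin n) (Fin n) ℤ[T;T⁻¹]) (r : Fin n → ℕ) (i : Fin n) :
    Y0 n →+ ((ℤ →₀ Y0 n) ⧸ clRel Q r i) :=
  (Finsupp.linearCombination ℤ fun m : YMon n =>
      (clRel Q r i).mkQ (clScreenMon i m)).toAddMonoidHom.comp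
    (AddMonoidAlgebra.coeffAddEquiv : Y0 n ≃+ (YMon n →₀ ℤ)).toAddMonoidHom

/-- `𝔎 = ⋂_i Ker(S_i)`. -/
def clKer {n : ℕ} (Q : Matrix (Fin n) (Fin n) ℤ[T;T⁻¹]) (r : Fin n → ℕ) : AddSubgroup (Y0 n) :=
  ⨅ i, (clScreen Q r i).ker

/-! ### The classical algorithm -/

open scoped Classical in
/-- For a Laurent monomial `m`, the coefficient of `m ∏ A_{j,l} ^ {-δ_{j,l}}` in
`E_i(m) = m ∏_l (1 + A_{i,l+r_i}⁻¹) ^ {u_{i,l}(m)}` if `m` is `i`-dominant, and `0` otherwise. The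
`A_{j,l}⁻¹` are treated as independent variables. -/
def eCoeff {n : ℕ} (r : Fin n → ℕ) (i : Fin n) (m : YMon n) (δ : Fin n × ℤ →₀ ℕ) : ℤ :=
  if IDominant i m then
    MvPolynomial.coeff δ (m.prod fun p c =>
      if p.1 = i then
        (1 + MvPolynomial.X (p.1, p.2 + (r p.1 : ℤ)) : MvPolynomial (Fin n × ℤ) ℤ) ^ c.toNat
      else 1)
  else 0

/-- The Laurent monomial `m ∏ A_{j,k} ^ {-w_{j,k}}`. -/
def below {n : ℕ} (Q : Matrix (Fin n) (Fin n) ℤ[T;T⁻¹]) (m : YMon n) (w : Fin n × ℤ →₀ ℕ) :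
    YMon n := m - aSum Q w

/-- The classical algorithm beginning with `m`. The monomial `m_w = m ∏ A_{j,k} ^ {-w_{j,k}}` gets
the colored coefficients `σ i w` and the coefficient `s w`. Starting from `s = 1`, `σ i = 0` at `m`,
at each lower monomial `σ i w` is what the `E_i`-expansions begun at higher monomials contribute;
`s w` must be equal to `σ i w` for *every* `i` such that `m_w` is not `i`-dominant, and is `0` if
`m_w` is dominant. The values are determined recursively, and they exist exactly when the algorithm
beginning with `m` is well defined. -/
structure IsClassicalRun {n : ℕ} (Q : Matrix (Fin n) (Fin n) ℤ[T;T⁻¹]) (r : Fin n → ℕ) (m : YMon n)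
    (s : (Fin n × ℤ →₀ ℕ) → ℤ) (σ : Fin n → (Fin n × ℤ →₀ ℕ) → ℤ) : Prop where
  start : s 0 = 1
  colored : ∀ i w, σ i w =
    ∑ w' ∈ Finset.Ico 0 w, (s w' - σ i w') * eCoeff r i (below Q m w') (w - w')
  not_dominant : ∀ w, w ≠ 0 → ∀ i, ¬ IDominant i (below Q m w) → s w = σ i w
  dominant : ∀ w, w ≠ 0 → Dominant (below Q m w) → s w = 0

/-- The classical algorithm beginning with `m` is well defined, and its result
`F(m) = ∑_w s(w) m ∏ A ^ {-w}` is a finite sum that belongs to `𝔎`. -/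
def ClassicalFMem {n : ℕ} (Q : Matrix (Fin n) (Fin n) ℤ[T;T⁻¹]) (r : Fin n → ℕ) (m : YMon n) :
    Prop :=
  ∃ (s : (Fin n × ℤ →₀ ℕ) →₀ ℤ) (σ : Fin n → (Fin n × ℤ →₀ ℕ) → ℤ),
    IsClassicalRun Q r m s σ ∧
      (s.sum fun w c => (AddMonoidAlgebra.single (below Q m w) c : Y0 n)) ∈ clKer Q r

/-! ### The deformed algebra `Ŷ_t` -/

/-- `d_1(m_1, m_2) = ∑ v_{i,l+r_i}(m_1) u_{i,l}(m_2) + y_{i,l+r_i}(m_1) v_{i,l}(m_2)`. -/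
def d1 {n : ℕ} (Q : Matrix (Fin n) (Fin n) ℤ[T;T⁻¹]) (r : Fin n → ℕ) (m₁ m₂ : Mon n) : ℤ :=
  (m₁.2.sum fun p c => (c : ℤ) * uExp Q m₂ (p.1, p.2 - (r p.1 : ℤ))) +
    m₁.1.sum fun p c => (c : ℤ) * (m₂.2 (p.1, p.2 - (r p.1 : ℤ)) : ℤ)

/-- `d_2(m_1, m_2) = ∑ u_{i,l+r_i}(m_1) v_{i,l}(m_2) + v_{i,l+r_i}(m_1) y_{i,l}(m_2)`. -/
def d2 {n : ℕ} (Q : Matrix (Fin n) (Fin n) ℤ[T;T⁻¹]) (r : Fin n → ℕ) (m₁ m₂ : Mon n) : ℤ :=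
  (m₂.2.sum fun p c => (c : ℤ) * uExp Q m₁ (p.1, p.2 + (r p.1 : ℤ))) +
    m₂.1.sum fun p c => (c : ℤ) * (m₁.2 (p.1, p.2 + (r p.1 : ℤ)) : ℤ)

/-- The exponent of `t` in the product of two elements of `Ā`. -/
def dExp {n : ℕ} (Q : Matrix (Fin n) (Fin n) ℤ[T;T⁻¹]) (r : Fin n → ℕ) (m₁ m₂ : Mon n) : ℤ :=
  d1 Q r m₁ m₂ + d2 Q r m₁ m₂

/-- The underlying `ℤ[t^±]`-module of `Ŷ_t`: it is free on `Ā`. (The parameters `Q` and `r` enter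
the product.) -/
def Yt {n : ℕ} (_Q : Matrix (Fin n) (Fin n) ℤ[T;T⁻¹]) (_r : Fin n → ℕ) : Type := Mon n →₀ ℤ[T;T⁻¹]

section Algebra

variable {n : ℕ} (Q : Matrix (Fin n) (Fin n) ℤ[T;T⁻¹]) (r : Fin n → ℕ)

instance : AddCommGroup (Yt Q r) := inferInstanceAs (AddCommGroup (Mon n →₀ ℤ[T;T⁻¹]))

instance : Module ℤ[T;T⁻¹] (Yt Q r) := inferInstanceAs (Module ℤ[T;T⁻¹] (Mon n →₀ ℤ[T;T⁻¹]))

/-- The basis element of `Ŷ_t` given by a monomial of `Ā`. -/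
def Yt.mon (m : Mon n) : Yt Q r := (Finsupp.single m 1 : Mon n →₀ ℤ[T;T⁻¹])

/-- The coefficient of a monomial of `Ā` in an element of `Ŷ_t`. -/
def Yt.coeff : Yt Q r →ₗ[ℤ[T;T⁻¹]] (Mon n → ℤ[T;T⁻¹]) := Finsupp.lcoeFun

/-- The linear map on `Ŷ_t` with given values on `Ā`. -/
def Yt.lift {M : Type*} [AddCommGroup M] [Module ℤ[T;T⁻¹] M] (f : Mon n → M) :
    Yt Q r →ₗ[ℤ[T;T⁻¹]] M := Finsupp.linearCombination ℤ[T;T⁻¹] f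

/-- The product of `Ŷ_t`: `m_1 m_2 = t ^ {d_1(m_1,m_2) + d_2(m_1,m_2)} m_1.m_2` on `Ā`. -/
def Yt.mulHom : Yt Q r →ₗ[ℤ[T;T⁻¹]] Yt Q r →ₗ[ℤ[T;T⁻¹]] Yt Q r :=
  Yt.lift Q r fun m₁ => Yt.lift Q r fun m₂ =>
    (LaurentPolynomial.T (dExp Q r m₁ m₂) : ℤ[T;T⁻¹]) • Yt.mon Q r (m₁ + m₂)

variable {Q r}

theorem Yt.lift_mon {M : Type*} [AddCommGroup M] [Module ℤ[T;T⁻¹] M] (f : Mon n → M) (m : Mon n) :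
    Yt.lift Q r f (Yt.mon Q r m) = f m := by
  refine (Finsupp.linearCombination_single _ _ _).trans ?_
  simp

theorem Yt.hom_ext {M : Type*} [AddCommGroup M] [Module ℤ[T;T⁻¹] M]
    {f g : Yt Q r →ₗ[ℤ[T;T⁻¹]] M} (h : ∀ m, f (Yt.mon Q r m) = g (Yt.mon Q r m)) : f = g :=
  Finsupp.lhom_ext' fun m => LinearMap.ext_ring (h m)

theorem Yt.mulHom_mon (m₁ m₂ : Mon n) :
    Yt.mulHom Q r (Yt.mon Q r m₁) (Yt.mon Q r m₂) =
      (LaurentPolynomial.T (dExp Q r m₁ m₂) : ℤ[T;T⁻¹]) • Yt.mon Q r (m₁ + m₂) := by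
  rw [Yt.mulHom, Yt.lift_mon, Yt.lift_mon]

theorem aSum_add (v w : Fin n × ℤ →₀ ℕ) : aSum Q (v + w) = aSum Q v + aSum Q w :=
  Finsupp.sum_add_index' (fun _ => zero_smul _ _) fun _ _ _ => add_smul _ _ _

theorem aSum_zero : aSum Q (0 : Fin n × ℤ →₀ ℕ) = 0 := Finsupp.sum_zero_index

theorem uExp_zero : uExp Q (0 : Mon n) = 0 := by
  ext p
  simp [uExp, aSum_zero]

theorem uExp_add (m m' : Mon n) : uExp Q (m + m') = uExp Q m + uExp Q m' := by
  ext p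
  simp [uExp, aSum_add]
  ring

theorem dExp_add_left (a b c : Mon n) : dExp Q r (a + b) c = dExp Q r a c + dExp Q r b c := by
  have h1 : d1 Q r (a + b) c = d1 Q r a c + d1 Q r b c := by
    unfold d1
    rw [Prod.fst_add, Prod.snd_add, Finsupp.sum_add_index' (by simp) (by intros; push_cast; ring),
      Finsupp.sum_add_index' (by simp) (by intros; push_cast; ring)]
    ring
  have h2 : d2 Q r (a + b) c = d2 Q r a c + d2 Q r b c := by
    unfold d2
    simp only [uExp_add, Prod.snd_add, Finsupp.add_apply, Nat.cast_add, mul_add, Finsupp.sum_add]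
    ring
  rw [dExp, dExp, dExp, h1, h2]
  ring

theorem dExp_add_right (a b c : Mon n) : dExp Q r a (b + c) = dExp Q r a b + dExp Q r a c := by
  have h1 : d1 Q r a (b + c) = d1 Q r a b + d1 Q r a c := by
    unfold d1
    simp only [uExp_add, Prod.snd_add, Finsupp.add_apply, Nat.cast_add, mul_add, Finsupp.sum_add]
    ring
  have h2 : d2 Q r a (b + c) = d2 Q r a b + d2 Q r a c := by
    unfold d2
    rw [Prod.fst_add, Prod.snd_add, Finsupp.sum_add_index' (by simp) (by intros; push_cast; ring),
      Finsupp.sum_add_index' (by simp) (by intros; push_cast; ring)]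
    ring
  rw [dExp, dExp, dExp, h1, h2]
  ring

theorem dExp_zero_left (a : Mon n) : dExp Q r 0 a = 0 := by
  simpa using dExp_add_left (Q := Q) (r := r) 0 0 a

theorem dExp_zero_right (a : Mon n) : dExp Q r a 0 = 0 := by
  simpa using dExp_add_right (Q := Q) (r := r) a 0 0

theorem Yt.one_mulHom (a : Yt Q r) : Yt.mulHom Q r (Yt.mon Q r 0) a = a := by
  have h : Yt.mulHom Q r (Yt.mon Q r 0) = LinearMap.id :=
    Yt.hom_ext fun m => by
      rw [Yt.mulHom_mon, dExp_zero_left, LaurentPolynomial.T_zero, one_smul, zero_add,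
        LinearMap.id_apply]
  rw [h, LinearMap.id_apply]

theorem Yt.mulHom_one (a : Yt Q r) : Yt.mulHom Q r a (Yt.mon Q r 0) = a := by
  have h : (Yt.mulHom Q r).flip (Yt.mon Q r 0) = LinearMap.id :=
    Yt.hom_ext fun m => by
      rw [LinearMap.flip_apply, Yt.mulHom_mon, dExp_zero_right, LaurentPolynomial.T_zero, one_smul,
        add_zero, LinearMap.id_apply]
  rw [← LinearMap.flip_apply, h, LinearMap.id_apply]

theorem Yt.mulHom_assoc (a b c : Yt Q r) :
    Yt.mulHom Q r (Yt.mulHom Q r a b) c = Yt.mulHom Q r a (Yt.mulHom Q r b c) := by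
  have h : (LinearMap.llcomp ℤ[T;T⁻¹] _ _ _ (Yt.mulHom Q r)).comp (Yt.mulHom Q r) =
      ((LinearMap.llcomp ℤ[T;T⁻¹] _ _ _).flip (Yt.mulHom Q r)).comp
        ((LinearMap.llcomp ℤ[T;T⁻¹] (Yt Q r) (Yt Q r) (Yt Q r)).comp (Yt.mulHom Q r)) := by
    refine Yt.hom_ext fun x => Yt.hom_ext fun y => Yt.hom_ext fun z => ?_
    simp only [LinearMap.comp_apply, LinearMap.llcomp_apply, LinearMap.flip_apply, Yt.mulHom_mon,
      map_smul, LinearMap.smul_apply, smul_smul, ← LaurentPolynomial.T_add, dExp_add_left,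
      dExp_add_right, add_assoc]
    congr 2
    ring
  exact LinearMap.congr_fun (LinearMap.congr_fun (LinearMap.congr_fun h a) b) c

instance : Ring (Yt Q r) :=
  { (inferInstance : AddCommGroup (Yt Q r)) with
    mul := fun a b => Yt.mulHom Q r a b
    one := Yt.mon Q r 0
    left_distrib := fun a b c => map_add (Yt.mulHom Q r a) b c
    right_distrib := fun a b c => LinearMap.map_add₂ (Yt.mulHom Q r) a b c
    zero_mul := fun a => LinearMap.map_zero₂ (Yt.mulHom Q r) a
    mul_zero := fun a => map_zero (Yt.mulHom Q r a)
    mul_assoc := Yt.mulHom_assoc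
    one_mul := Yt.one_mulHom
    mul_one := Yt.mulHom_one }

instance : Algebra ℤ[T;T⁻¹] (Yt Q r) :=
  Algebra.ofModule (fun c a b => LinearMap.map_smul₂ (Yt.mulHom Q r) c a b)
    (fun c a b => map_smul (Yt.mulHom Q r a) c b)

end Algebra

/-! ### Deformed screening operators -/

/-- `(t ^ {2u} - 1) / (t ^ 2 - 1) = t ^ {u - 1} [u]_t` as a Laurent polynomial in `t`. -/
def screenInt (u : ℤ) : ℤ[T;T⁻¹] := LaurentPolynomial.T (u - 1) * quantumInt 1 u

/-- The element `Ã_{i,l}⁻¹` of `Ŷ_t`; the monomial `t Ã_{i,l}⁻¹` is the one in `Ā`. -/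
def Yt.aInv {n : ℕ} (Q : Matrix (Fin n) (Fin n) ℤ[T;T⁻¹]) (r : Fin n → ℕ) (i : Fin n) (l : ℤ) :
    Yt Q r :=
  (LaurentPolynomial.T (-1) : ℤ[T;T⁻¹]) • Yt.mon Q r (monV i l)

/-- The `Ŷ_t`-submodule of `⨁_l Ŷ_t S̃_{i,l}` generated by `S̃_{i,l-r_i} - t⁻¹ Ã_{i,l}⁻¹ S̃_{i,l+r_i}`.
The quotient is `Ŷ_{i,t}` as a left module; its right structure is given by
`S̃_{i,l} m = t ^ {2 u_{i,l}(m)} m S̃_{i,l}` for monomials `m`. -/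
def tRel {n : ℕ} (Q : Matrix (Fin n) (Fin n) ℤ[T;T⁻¹]) (r : Fin n → ℕ) (i : Fin n) :
    Submodule (Yt Q r) (ℤ →₀ Yt Q r) :=
  Submodule.span (Yt Q r) (Set.range fun l : ℤ =>
    (Finsupp.single (l - r i) (1 : Yt Q r) -
      Finsupp.single (l + r i) ((LaurentPolynomial.T (-1) : ℤ[T;T⁻¹]) • Yt.aInv Q r i l)))

/-- For a monomial `m`, the element
`(t ^ 2 - 1)⁻¹ ∑_l [S̃_{i,l}, m] = ∑_l t ^ {u_{i,l}(m) - 1} [u_{i,l}(m)]_t m S̃_{i,l}`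
of `⨁_l Ŷ_t S̃_{i,l}`. -/
def tScreenMon {n : ℕ} (Q : Matrix (Fin n) (Fin n) ℤ[T;T⁻¹]) (r : Fin n → ℕ) (i : Fin n)
    (m : Mon n) : ℤ →₀ Yt Q r :=
  (uExp Q m).sum fun p c =>
    if p.1 = i then Finsupp.single p.2 (screenInt c • Yt.mon Q r m) else 0

/-- The deformed screening operator `S_{i,t} : Ŷ_t → Ŷ_{i,t}`. -/
def tScreen {n : ℕ} (Q : Matrix (Fin n) (Fin n) ℤ[T;T⁻¹]) (r : Fin n → ℕ) (i : Fin n) :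
    Yt Q r →ₗ[ℤ[T;T⁻¹]] ((ℤ →₀ Yt Q r) ⧸ tRel Q r i) :=
  Yt.lift Q r fun m => (tRel Q r i).mkQ (tScreenMon Q r i m)

/-- `𝔎̂_t = ⋂_i Ker(S_{i,t})`. -/
def tKer {n : ℕ} (Q : Matrix (Fin n) (Fin n) ℤ[T;T⁻¹]) (r : Fin n → ℕ) :
    Submodule ℤ[T;T⁻¹] (Yt Q r) :=
  ⨅ i, LinearMap.ker (tScreen Q r i)

/-! ### The completion -/

/-- The completion `Ŷ_t^∞`: families of coefficients `λ_m(t)` (`m ∈ Ā`) with only finitely many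
nonzero ones in each degree, that is, sums `∑_k λ_k` with `λ_k ∈ Ŷ_t` homogeneous of degree `k`. -/
def YtInf (n : ℕ) : Submodule ℤ[T;T⁻¹] (Mon n → ℤ[T;T⁻¹]) where
  carrier := {f | ∀ k : ℕ, {m | monDeg m = k ∧ f m ≠ 0}.Finite}
  zero_mem' := fun k => by simp
  add_mem' := fun {f g} hf hg k => ((hf k).union (hg k)).subset fun m hm => by
    by_contra h
    simp only [Set.mem_union, Set.mem_ofPred_eq, not_or, not_and, not_not] at h
    exact hm.2 (by rw [Pi.add_apply, h.1 hm.1, h.2 hm.1, add_zero])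
  smul_mem' := fun c f hf k => (hf k).subset fun m hm =>
    ⟨hm.1, fun h => hm.2 (by rw [Pi.smul_apply, h, smul_zero])⟩

/-- `C̃(m)`: the elements of `Ŷ_t^∞` all of whose monomials lie in `C(m)`. -/
def tildeC {n : ℕ} (Q : Matrix (Fin n) (Fin n) ℤ[T;T⁻¹]) (m : Mon n) :
    Submodule ℤ[T;T⁻¹] (Mon n → ℤ[T;T⁻¹]) where
  carrier := {f | f ∈ YtInf n ∧ ∀ m', f m' ≠ 0 → m' ∈ coneC Q m}
  zero_mem' := ⟨zero_mem _, fun _ h => absurd rfl h⟩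
  add_mem' := fun {f g} hf hg => ⟨add_mem hf.1 hg.1, fun m' h => by
    by_cases h0 : f m' = 0
    · exact hg.2 m' fun h1 => h (by rw [Pi.add_apply, h0, h1, add_zero])
    · exact hf.2 m' h0⟩
  smul_mem' := fun c f hf => ⟨Submodule.smul_mem _ c hf.1, fun m' h =>
    hf.2 m' fun h0 => h (by rw [Pi.smul_apply, h0, smul_zero])⟩

/-- `𝔎̂_t` as a submodule of `Ŷ_t^∞ ⊃ Ŷ_t`. -/
def tKerInInf {n : ℕ} (Q : Matrix (Fin n) (Fin n) ℤ[T;T⁻¹]) (r : Fin n → ℕ) :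
    Submodule ℤ[T;T⁻¹] (Mon n → ℤ[T;T⁻¹]) :=
  (tKer Q r).map (Yt.coeff Q r)

end QTChar

end

/-!
Write `Q` for the deformed Cartan matrix. Conditions (ii) and (iii) are equivalent because the only
principal minor of `C` that is not automatically positive is `4 - C₀₁ C₁₀`.

*Each of (i), (iv), (v) implies (iii).* At `z = 1` the matrix `Q` becomes `C`, so that an
antidominant monomial `Y_{i,l} ∏ A^{-w}` gives a vector `x ≥ 0` of natural numbers with `C x ≥ e_i`,
which forces `C₀₁ C₁₀ ≤ 3` (`offDiag_mul_le_three_of_antidominant`). This settles (v). For (i) and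
(iv) it remains to find an antidominant monomial in a nonzero element `F` of a kernel of screening
operators. Order the monomials `m ∏ A^{-v}` lexicographically, the variables with large second
index first, and take the largest one in `F`. Its image under the `i`-th screening operator is a
finite combination of the relations `S_{i,l-r_i} - A_{i,l}⁻¹ S_{i,l+r_i}`, and following the
coefficients of this combination upwards and downwards from a positive exponent of colour `i`
shows that it would have to be infinite (`nonpos_of_extreme`, which covers the classical and the
deformed operators at once). In the classical case the exponents `v` can be read off from a monomial
of `𝒴` only if the `A_{j,l}` are independent, that is, if `det Q ≠ 0`; when `C₀₁ C₁₀ ≥ 4`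
this holds, by `det_defCartan_ne_zero`.

*Condition (iii) implies the others.* For (i), treat the `A_{j,l}⁻¹` as independent variables and
call the span of the `m ∏ A^{-w} ∏_l (1 + A_{i,l+r_i}⁻¹)^{u_{i,l}}` the formal kernel of colour `i`.
Substitution of the true `A_{j,l}⁻¹` sends it to `Ker(S_i)`, since `S_i` is a derivation that kills
`Y_{i,l} (1 + A_{i,l+r_i}⁻¹)`. An element of the intersection of the formal kernels with leading
term `m` and no other dominant monomial is the result of the classical algorithm
(`classicalFMem_of_formalKer`). In the types `A_1 × A_1`, `A_2`, `B_2`, `G_2` there are explicit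
elements of the intersection with leading terms `Y_{i,l}`. Multiplying them gives all dominant
leading terms, and the superfluous dominant monomials are removed recursively; the recursion stops
because all `A_{j,l}` have positive height for a suitable linear height function that is nonnegative
on dominant monomials (`exists_unique_dominant`).

For (iv) and (v), start at `Y_{j,0}` with `j` a short node (any node in type `A_1 × A_1`): the chain
of monomials of its fundamental representation ends at an antidominant one, and the sum of the
chain, each term being the product of the preceding one with an element `t Ã_{c,l}⁻¹`, lies in
`𝔎̂_t`, because for each colour the chain splits into strings of length one, two or three that are
killed by the screening operator.
-/

open scoped LaurentPolynomial

noncomputable section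

namespace QTChar

open LaurentPolynomial (T)

/-! ### Monomials and specialization at `z = 1` -/

section

variable {n : ℕ}

theorem aVec_apply (Q : Matrix (Fin n) (Fin n) ℤ[T;T⁻¹]) (p q : Fin n × ℤ) :
    aVec Q p q = (Q q.1 p.1).coeff (p.2 - q.2) := by
  classical
  obtain ⟨i, l⟩ := q
  rw [aVec, Finsupp.finsetSum_apply, Finset.sum_eq_single i]
  · rw [Finsupp.sum, Finsupp.finsetSum_apply, Finset.sum_eq_single (p.2 - l)]
    · simp
    · intro e _ he
      rw [Finsupp.single_apply, if_neg]
      intro h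
      exact he (by have := congrArg Prod.snd h; simp at this; omega)
    · intro h
      simpa using h
  · intro i' _ hi'
    rw [Finsupp.sum, Finsupp.finsetSum_apply, Finset.sum_eq_zero]
    intro e _
    rw [Finsupp.single_apply, if_neg]
    intro h
    exact hi' (congrArg Prod.fst h)
  · simp

/-- The value at `z = 1` of a Laurent polynomial. -/
def evalOne : ℤ[T;T⁻¹] →+* ℤ := LaurentPolynomial.eval₂ (RingHom.id ℤ) 1

@[simp]
theorem evalOne_T (k : ℤ) : evalOne (T k) = 1 := by
  simp [evalOne, LaurentPolynomial.eval₂_T]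

theorem evalOne_eq_sum (x : ℤ[T;T⁻¹]) : evalOne x = x.coeff.sum fun _ c => c := by
  induction x using AddMonoidAlgebra.induction_linear with
  | zero => simp
  | add x y hx hy =>
    rw [map_add, hx, hy, AddMonoidAlgebra.coeff_add, Finsupp.sum_add_index' (by simp) (by simp)]
  | single k c =>
    rw [AddMonoidAlgebra.coeff_single, Finsupp.sum_single_index rfl,
      LaurentPolynomial.single_eq_C_mul_T, map_mul, evalOne_T, mul_one]
    simp [evalOne]

/-- The total exponent `∑_l u_{i,l}` of the variables of colour `i`. -/
def wt (i : Fin n) : YMon n →+ ℤ :=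
  Finsupp.liftAddHom fun p => if p.1 = i then AddMonoidHom.id ℤ else 0

theorem wt_single (i : Fin n) (p : Fin n × ℤ) (c : ℤ) :
    wt i (Finsupp.single p c) = if p.1 = i then c else 0 := by
  rw [wt, Finsupp.liftAddHom_apply_single]
  split <;> rfl

theorem wt_eq_sum (i : Fin n) (u : YMon n) :
    wt i u = ∑ p ∈ u.support, if p.1 = i then u p else 0 := by
  rw [wt, Finsupp.liftAddHom_apply, Finsupp.sum]
  refine Finset.sum_congr rfl fun p _ => ?_
  split <;> rfl

theorem wt_nonneg {i : Fin n} {u : YMon n} (h : IDominant i u) : 0 ≤ wt i u := by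
  rw [wt_eq_sum]
  refine Finset.sum_nonneg fun p _ => ?_
  split
  · next hp => subst hp; exact h p.2
  · exact le_rfl

theorem wt_nonpos {u : YMon n} (h : Antidominant u) (i : Fin n) : wt i u ≤ 0 := by
  rw [wt_eq_sum]
  refine Finset.sum_nonpos fun p _ => ?_
  split
  · exact h p
  · exact le_rfl

theorem wt_aVec (Q : Matrix (Fin n) (Fin n) ℤ[T;T⁻¹]) (i : Fin n) (p : Fin n × ℤ) :
    wt i (aVec Q p) = evalOne (Q i p.1) := by
  rw [aVec, map_sum, Finset.sum_eq_single i]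
  · rw [evalOne_eq_sum, Finsupp.sum, map_sum]
    exact Finset.sum_congr rfl fun e _ => by rw [wt_single, if_pos rfl]
  · intro j _ hj
    rw [Finsupp.sum, map_sum]
    exact Finset.sum_eq_zero fun e _ => by rw [wt_single, if_neg hj]
  · simp

/-- The number of variables of colour `j`, counted with multiplicity. -/
def colCount (j : Fin n) : (Fin n × ℤ →₀ ℕ) →+ ℕ :=
  Finsupp.liftAddHom fun p => if p.1 = j then AddMonoidHom.id ℕ else 0

theorem colCount_single (j : Fin n) (p : Fin n × ℤ) (c : ℕ) :
    colCount j (Finsupp.single p c) = if p.1 = j then c else 0 := by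
  rw [colCount, Finsupp.liftAddHom_apply_single]
  split <;> rfl

@[simp]
theorem aSum_single (Q : Matrix (Fin n) (Fin n) ℤ[T;T⁻¹]) (p : Fin n × ℤ) (c : ℕ) :
    aSum Q (Finsupp.single p c) = c • aVec Q p :=
  Finsupp.sum_single_index (zero_smul _ _)

/-- The deformed Cartan matrix `Q` specializes to `C` at `z = 1`. -/
def Specializes (Q : Matrix (Fin n) (Fin n) ℤ[T;T⁻¹]) (C : Matrix (Fin n) (Fin n) ℤ) : Prop :=
  ∀ i j, evalOne (Q i j) = C i j

theorem wt_aSum {Q : Matrix (Fin n) (Fin n) ℤ[T;T⁻¹]} {C : Matrix (Fin n) (Fin n) ℤ}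
    (hQ : Specializes Q C) (i : Fin n) (v : Fin n × ℤ →₀ ℕ) :
    wt i (aSum Q v) = ∑ j, C i j * colCount j v := by
  induction v using Finsupp.induction_linear with
  | zero => simp [aSum_zero]
  | add v w hv hw =>
    rw [aSum_add, map_add, hv, hw, ← Finset.sum_add_distrib]
    exact Finset.sum_congr rfl fun j _ => by rw [map_add]; push_cast; ring
  | single p c =>
    rw [aSum_single, map_nsmul, wt_aVec, hQ, Finset.sum_eq_single p.1]
    · rw [colCount_single, if_pos rfl, nsmul_eq_mul, mul_comm]
    · intro j _ hj
      rw [colCount_single, if_neg hj.symm]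
      simp
    · simp

theorem evalOne_quantumInt (a : ℕ) (l : ℤ) : evalOne (quantumInt a l) = l := by
  rw [quantumInt, map_zsmul, map_sum]
  simp [Int.sign_mul_abs]

theorem quantumInt_two (a : ℕ) : quantumInt a 2 = T (a : ℤ) + T (-(a : ℤ)) := by
  have h : (2 : ℤ).natAbs = 2 := rfl
  have h' : (2 : ℤ).sign = 1 := rfl
  rw [quantumInt, h, h', Finset.sum_range_succ, Finset.sum_range_one]
  norm_num
  rw [add_comm]

theorem defCartan_diag {C : Matrix (Fin n) (Fin n) ℤ} (hC : IsGCM C) (r : Fin n → ℕ) (i : Fin n) :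
    defCartan C r i i = T (r i : ℤ) + T (-(r i : ℤ)) := by
  rw [defCartan]
  split
  · simp [cartanZ]
  · simp [cartanZ', hC.diag, quantumInt_two]

theorem specializes_defCartan {C : Matrix (Fin n) (Fin n) ℤ} (hC : IsGCM C) (r : Fin n → ℕ) :
    Specializes (defCartan C r) C := by
  intro i j
  rw [defCartan]
  split
  · by_cases h : i = j
    · subst h; simp [cartanZ, hC.diag]
    · simp [cartanZ, h, evalOne_quantumInt]
  · simp [cartanZ', evalOne_quantumInt]

/-- In colour `i` the monomial `A_{i,k}` is `Y_{i,k-r_i} Y_{i,k+r_i}`. -/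
theorem aVec_diag {Q : Matrix (Fin n) (Fin n) ℤ[T;T⁻¹]} {i : Fin n} {ρ : ℕ}
    (hQ : Q i i = T (ρ : ℤ) + T (-(ρ : ℤ))) (k l : ℤ) :
    aVec Q (i, k) (i, l) = (if k = l + ρ then 1 else 0) + (if k = l - ρ then 1 else 0) := by
  rw [aVec_apply]
  simp only [hQ, AddMonoidAlgebra.coeff_add, Finsupp.add_apply, LaurentPolynomial.T_apply]
  congr 1 <;> exact if_congr (by omega) rfl rfl

/-! ### Antidominant monomials and the type of `C` -/

/-- If `C x ≥ e_i` with `x ≥ 0`, then `C₀₁ C₁₀ ≤ 3`. -/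
theorem offDiag_mul_le_three {C : Matrix (Fin 2) (Fin 2) ℤ} (hC : IsGCM C) {x : Fin 2 → ℕ}
    {i : Fin 2} (h : ∀ k, (if k = i then 1 else 0) ≤ ∑ j, C k j * x j) : C 0 1 * C 1 0 ≤ 3 := by
  have h0 := h 0
  have h1 := h 1
  simp only [Fin.sum_univ_two, hC.diag] at h0 h1
  have hx0 : (0 : ℤ) ≤ x 0 := Int.natCast_nonneg _
  have hx1 : (0 : ℤ) ≤ x 1 := Int.natCast_nonneg _
  have n01 := hC.nonpos 0 1 (by decide)
  have n10 := hC.nonpos 1 0 (by decide)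
  generalize (x 0 : ℤ) = a at *
  generalize (x 1 : ℤ) = b at *
  generalize C 0 1 = p at *
  generalize C 1 0 = q at *
  by_contra hlt
  push Not at hlt
  -- eliminate one unknown at a time; the coefficient `4 - p q` of the other one is not positive
  have key : ∀ s t : ℤ, 0 ≤ s → 0 ≤ t → s ≤ 2 * a + p * b → t ≤ q * a + 2 * b →
      2 * s - p * t ≤ 0 ∧ 2 * t - q * s ≤ 0 := fun s t hs ht h0 h1 => by
    constructor <;> nlinarith
  fin_cases i
  · have := (key 1 0 (by norm_num) le_rfl (by simpa using h0) (by simpa using h1)).1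
    omega
  · have := (key 0 1 le_rfl (by norm_num) (by simpa using h0) (by simpa using h1)).2
    omega

theorem isFiniteType_iff {C : Matrix (Fin 2) (Fin 2) ℤ} (hC : IsGCM C) :
    IsFiniteType C ↔ C 0 1 * C 1 0 ≤ 3 := by
  have h4 : 0 < C.det ↔ C 0 1 * C 1 0 ≤ 3 := by
    rw [Matrix.det_fin_two, hC.diag, hC.diag]; omega
  rw [← h4]
  have huniv : (C.submatrix (fun i : (Finset.univ : Finset (Fin 2)) => (i : Fin 2))
      (fun i : (Finset.univ : Finset (Fin 2)) => (i : Fin 2))).det = C.det :=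
    Matrix.det_submatrix_equiv_self (Equiv.subtypeUnivEquiv fun x => Finset.mem_univ x) C
  constructor
  · intro h
    rw [← huniv]
    exact h Finset.univ
  · intro h J
    rcases Nat.lt_or_ge J.card 2 with hJ | hJ
    · rcases Nat.lt_or_ge J.card 1 with h0 | h1
      · have hJ0 : J = ∅ := Finset.card_eq_zero.mp (by omega)
        subst hJ0
        simp
      · obtain ⟨i, rfl⟩ := Finset.card_eq_one.mp (le_antisymm (by omega) h1)
        rw [Matrix.det_unique]
        have hi : ((default : ({i} : Finset (Fin 2))) : Fin 2) = i :=
          Finset.mem_singleton.mp (default : ({i} : Finset (Fin 2))).2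
        simp [hi, hC.diag]
    · have hJu : J = Finset.univ := Finset.eq_univ_of_card J
        (le_antisymm (Finset.card_le_univ J) (by simpa using hJ))
      subst hJu
      rw [huniv]
      exact h

theorem uExp_monY_add (Q : Matrix (Fin n) (Fin n) ℤ[T;T⁻¹]) (i : Fin n) (l : ℤ)
    (w : Fin n × ℤ →₀ ℕ) :
    uExp Q (monY i l + (0, w)) = below Q (Finsupp.single (i, l) 1) w := by
  simp [uExp, below, monY]

/-- An antidominant monomial `Y_{i,0} ∏ A^{-w}` gives a vector `x ≥ 0` with `C x ≥ e_i`. -/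
theorem offDiag_mul_le_three_of_antidominant {C : Matrix (Fin 2) (Fin 2) ℤ} (hC : IsGCM C)
    {Q : Matrix (Fin 2) (Fin 2) ℤ[T;T⁻¹]} (hQ : Specializes Q C) {i : Fin 2} {l : ℤ}
    {w : Fin 2 × ℤ →₀ ℕ} (h : Antidominant (below Q (Finsupp.single (i, l) 1) w)) :
    C 0 1 * C 1 0 ≤ 3 := by
  refine offDiag_mul_le_three hC (x := fun j => colCount j w) (i := i) fun k => ?_
  have := wt_nonpos h k
  rw [below, map_sub, wt_single, wt_aSum hQ] at this
  have e : (if k = i then (1 : ℤ) else 0) = if i = k then 1 else 0 := if_congr eq_comm rfl rfl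
  rw [e]
  exact sub_nonpos.mp this

end

/-! ### Extreme terms -/

section

variable {n : ℕ}

/-- Reindexing of exponent vectors so that the lexicographic order compares first the exponents
with the largest second index. -/
def topKey (v : Fin n × ℤ →₀ ℤ) : Lex ((ℤᵒᵈ ×ₗ Fin n) →₀ ℤ) :=
  toLex (Finsupp.equivMapDomain
    ⟨fun p => toLex (OrderDual.toDual p.2, p.1), fun q => ((ofLex q).2,
        OrderDual.ofDual (ofLex q).1),
      fun _ => rfl, fun _ => rfl⟩ v)

theorem topKey_lt {v w : Fin n × ℤ →₀ ℤ} (p : Fin n × ℤ)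
    (heq : ∀ q : Fin n × ℤ, p.2 < q.2 ∨ (p.2 = q.2 ∧ q.1 ≠ p.1) → v q = w q) (hlt : v p < w p) :
    topKey v < topKey w := by
  rw [Finsupp.Lex.lt_iff]
  refine ⟨toLex (OrderDual.toDual p.2, p.1), fun q hq => ?_, hlt⟩
  refine heq ((ofLex q).2, OrderDual.ofDual (ofLex q).1) ?_
  rcases Prod.Lex.lt_iff.mp hq with h | ⟨h, h'⟩
  · exact Or.inl h
  · exact Or.inr ⟨h.symm, ne_of_lt h'⟩

/-- The equations `c(v) κ(u_l(v)) = a_{l+ρ}(v) - ε a_{l-ρ}(v - δ_{i,l-ρ})` say that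
`∑_v c(v) κ(u_l(v)) v S_l` is the combination `∑_l a_l (S_{l-ρ} - ε A_{i,l}⁻¹ S_{l+ρ})` of the
relations of a screening module. They force the extreme term of `c` to be `i`-antidominant.

If `u_l(m) > 0`, choose among the terms of `c` which agree with the extreme term `m` outside of
colour `i` and above `l - ρ` one with the smallest exponent at `l - ρ`. Its product with `S_l` is
then connected by the relations to no other term, so that the finiteness of `a` makes its
coefficient vanish. -/
theorem nonpos_of_extreme {R : Type*} [CommRing R] [NoZeroDivisors R] {i : Fin n} {ρ : ℤ}
    (hρ : 0 < ρ) {c : (Fin n × ℤ →₀ ℤ) → R} {m : Fin n × ℤ →₀ ℤ} (hcm : c m ≠ 0)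
    (hfin : c.support.Finite) (hmax : ∀ v, c v ≠ 0 → topKey v ≤ topKey m)
    {u : (Fin n × ℤ →₀ ℤ) → ℤ → ℤ}
    (hu : ∀ v v', (∀ p : Fin n × ℤ, p.1 ≠ i → v p = v' p) → ∀ l,
      u v l - u v' l = (v' (i, l - ρ) + v' (i, l + ρ)) - (v (i, l - ρ) + v (i, l + ρ)))
    {κ : ℤ → R} (hκ : ∀ z, z ≠ 0 → κ z ≠ 0) {a : ℤ → (Fin n × ℤ →₀ ℤ) → R}
    (ha : {l | a l ≠ 0}.Finite) {ε : ℤ → (Fin n × ℤ →₀ ℤ) → R} (hε : ∀ l v, ε l v ≠ 0)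
    (hE : ∀ l v, c v * κ (u v l) =
      a (l + ρ) v - ε l v * a (l - ρ) (v - Finsupp.single (i, l - ρ) 1)) (l : ℤ) :
    u m l ≤ 0 := by
  classical
  by_contra hpos
  push Not at hpos
  obtain ⟨b, hb⟩ := ha.bddAbove
  obtain ⟨b', hb'⟩ := ha.bddBelow
  have hzero : ∀ k, b < k → a k = 0 := fun k hk => by
    by_contra h; exact absurd (hb h) (by omega)
  have hzero' : ∀ k, k < b' → a k = 0 := fun k hk => by
    by_contra h; exact absurd (hb' h) (by omega)
  -- terms that agree with `m` off colour `i` and above `l - ρ`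
  let P : (Fin n × ℤ →₀ ℤ) → Prop := fun v =>
    (∀ p : Fin n × ℤ, p.1 ≠ i → v p = m p) ∧ ∀ k, l - ρ < k → v (i, k) = m (i, k)
  obtain ⟨v, hv, hmin⟩ := Finset.exists_min_image (hfin.toFinset.filter P)
    (fun v => v (i, l - ρ)) ⟨m, by simp [P, hcm]⟩
  simp only [Finset.mem_filter, Set.Finite.mem_toFinset, Function.mem_support] at hv hmin
  obtain ⟨hcv, hvm, hvk⟩ := hv
  have huv : 0 < u v l := by
    have h1 := hu v m hvm l
    have h2 := hmin m ⟨hcm, fun _ _ => rfl, fun _ _ => rfl⟩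
    have h3 := hvk (l + ρ) (by omega)
    omega
  -- coefficients above `l - ρ` vanish: raising an exponent of `m` leaves the support of `c`, so the
  -- equations carry the vanishing down from large indices
  have hup : ∀ N : ℕ, ∀ k : ℤ, l - ρ < k → b < k + N * ρ → ∀ w : Fin n × ℤ →₀ ℤ,
      (∀ p : Fin n × ℤ, p.1 ≠ i → w p = m p) → (∀ k', k ≤ k' → w (i, k') = m (i, k')) →
      a k w = 0 := by
    intro N
    induction N with
    | zero => intro k _ hk w _ _; rw [hzero k (by simpa using hk)]; rfl
    | succ N ih =>
      intro k hlk hk w hw hwk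
      have hc : c (w + Finsupp.single (i, k) 1) = 0 := by
        by_contra h
        refine absurd (hmax _ h) (not_le.mpr (topKey_lt (i, k) (fun q hq => ?_) ?_))
        · have hne : (i, k) ≠ q := by
            rintro rfl; simp at hq
          rw [Finsupp.add_apply, Finsupp.single_eq_of_ne' hne, add_zero]
          by_cases hqi : q.1 = i
          · obtain ⟨q1, q2⟩ := q
            subst hqi
            refine (hwk q2 ?_).symm
            rcases hq with hq | hq
            · exact hq.le
            · exact absurd rfl hq.2
          · exact (hw q hqi).symm
        · simp [hwk k le_rfl]
      have h1 := hE (k + ρ) (w + Finsupp.single (i, k) 1)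
      rw [hc, zero_mul, add_sub_cancel_right, add_sub_cancel_right,
        ih (k + ρ + ρ) (by omega) (by push_cast at hk ⊢; nlinarith) _ ?_ ?_, zero_sub, eq_comm,
        neg_eq_zero] at h1
      · exact (mul_eq_zero.mp h1).resolve_left (hε _ _)
      · intro p hp
        have hne : (i, k) ≠ p := by rintro rfl; exact hp rfl
        rw [Finsupp.add_apply, Finsupp.single_eq_of_ne' hne, add_zero, hw p hp]
      · intro k' hk'
        have hne : (i, k) ≠ (i, k') := by simp; omega
        rw [Finsupp.add_apply, Finsupp.single_eq_of_ne' hne, add_zero, hwk k' (by omega)]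
  -- coefficients below vanish: a smaller exponent at `l - ρ` contradicts the choice of `v`, so the
  -- equations carry the vanishing up from small indices
  have hdown : ∀ N : ℕ, ∀ k : ℤ, k ≤ l - ρ → k - N * ρ < b' → ∀ w : Fin n × ℤ →₀ ℤ,
      (∀ p : Fin n × ℤ, p.1 ≠ i → w p = m p) → (∀ k', l - ρ < k' → w (i, k') = m (i, k')) →
      w (i, l - ρ) < v (i, l - ρ) → a k w = 0 := by
    intro N
    induction N with
    | zero => intro k _ hk w _ _ _; rw [hzero' k (by simpa using hk)]; rfl
    | succ N ih =>
      intro k hlk hk w hw hwk hwl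
      have hc : c w = 0 := by
        by_contra h
        exact absurd (hmin w ⟨h, hw, hwk⟩) (not_le.mpr hwl)
      have h1 := hE (k - ρ) w
      rw [hc, zero_mul, sub_add_cancel, ih (k - ρ - ρ) (by omega)
        (by push_cast at hk ⊢; nlinarith) _ ?_ ?_ ?_, mul_zero, sub_zero] at h1
      · exact h1.symm
      · intro p hp
        have hne : (i, k - ρ - ρ) ≠ p := by rintro rfl; exact hp rfl
        rw [Finsupp.sub_apply, Finsupp.single_eq_of_ne' hne, sub_zero, hw p hp]
      · intro k' hk'
        have hne : (i, k - ρ - ρ) ≠ (i, k') := by simp; omega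
        rw [Finsupp.sub_apply, Finsupp.single_eq_of_ne' hne, sub_zero, hwk k' (by omega)]
      · have hne : (i, k - ρ - ρ) ≠ (i, l - ρ) := by simp; omega
        rw [Finsupp.sub_apply, Finsupp.single_eq_of_ne' hne, sub_zero]
        exact hwl
  have h1 := hE l v
  rw [hup (b - l).toNat (l + ρ) (by omega)
      (by have := Int.self_le_toNat (b - l); nlinarith) v hvm (fun k hk => hvk k (by omega)),
    hdown (l - b').toNat (l - ρ) le_rfl
      (by have := Int.self_le_toNat (l - b'); nlinarith) _ ?_ ?_ ?_, mul_zero, sub_zero] at h1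
  · exact (mul_eq_zero.mp h1).elim hcv (hκ _ huv.ne')
  · intro p hp
    have hne : (i, l - ρ) ≠ p := by rintro rfl; exact hp rfl
    rw [Finsupp.sub_apply, Finsupp.single_eq_of_ne' hne, sub_zero, hvm p hp]
  · intro k' hk'
    have hne : (i, l - ρ) ≠ (i, k') := by simp; omega
    rw [Finsupp.sub_apply, Finsupp.single_eq_of_ne' hne, sub_zero, hvk k' hk']
  · simp

end

/-! ### Kernels of the screening operators, written out -/

section

variable {n : ℕ}

/-- The coefficient of `S_l` in `∑_k a_k (S_{k-ρ} - b_k S_{k+ρ})`. -/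
theorem relation_sum_apply {R : Type*} [Ring R] (ρ : ℤ) (b : ℤ → R) (a : ℤ →₀ R) (l : ℤ) :
    (a.sum fun k x => x • (Finsupp.single (k - ρ) (1 : R) - Finsupp.single (k + ρ) (b k))) l =
      a (l + ρ) - a (l - ρ) * b (l - ρ) := by
  induction a using Finsupp.induction_linear with
  | zero => simp
  | add a a' h h' =>
    rw [Finsupp.sum_add_index' (by simp) (fun _ _ _ => add_smul _ _ _), Finsupp.add_apply, h, h',
      Finsupp.add_apply, Finsupp.add_apply]
    noncomm_ring
  | single k x =>
    rw [Finsupp.sum_single_index (by simp)]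
    by_cases h1 : k = l + ρ <;> by_cases h2 : k = l - ρ
    · subst h1
      have h3 : l + ρ + ρ = l := by omega
      simp [← h2, h3, mul_sub]
    · subst h1
      have h3 : l + ρ + ρ ≠ l := by omega
      simp [h2, h3]
    · subst h2
      have h3 : l - ρ - ρ ≠ l := by omega
      simp [h1, h3]
    · have h3 : k - ρ ≠ l := by omega
      have h4 : k + ρ ≠ l := by omega
      simp [h1, h2, h3, h4]

theorem clScreenMon_apply (i : Fin n) (m : YMon n) (l : ℤ) :
    clScreenMon i m l = AddMonoidAlgebra.single m (m (i, l)) := by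
  rw [clScreenMon, Finsupp.sum, Finsupp.finsetSum_apply]
  rw [Finset.sum_eq_single (i, l)]
  · simp
  · rintro ⟨i', l'⟩ _ h
    by_cases hi : i' = i
    · subst hi
      have : l' ≠ l := by rintro rfl; exact h rfl
      simp [this]
    · simp [hi]
  · intro h
    simp [Finsupp.notMem_support_iff.mp h]

theorem clScreen_apply (Q : Matrix (Fin n) (Fin n) ℤ[T;T⁻¹]) (r : Fin n → ℕ) (i : Fin n)
    (F : Y0 n) : clScreen Q r i F =
      (clRel Q r i).mkQ (F.coeff.sum fun m c => c • clScreenMon i m) := by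
  rw [Finsupp.sum, map_sum]
  simp only [map_zsmul]
  rfl

/-- An element of `Ker(S_i)` written out: its image in `⨁_l 𝒴 S_{i,l}` is a combination of the
relations. -/
theorem exists_of_clScreen_eq_zero {Q : Matrix (Fin n) (Fin n) ℤ[T;T⁻¹]} {r : Fin n → ℕ} {i : Fin n}
    {F : Y0 n} (h : clScreen Q r i F = 0) : ∃ a : ℤ →₀ Y0 n, ∀ l u,
      F.coeff u * u (i, l) = (a (l + r i)).coeff u -
        (a (l - r i)).coeff (u + aVec Q (i, l - r i)) := by
  rw [clScreen_apply, Submodule.mkQ_apply, Submodule.Quotient.mk_eq_zero, clRel,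
    Finsupp.mem_span_range_iff_exists_finsupp] at h
  obtain ⟨a, ha⟩ := h
  refine ⟨a, fun l u => ?_⟩
  have h1 := congrArg (fun x : ℤ →₀ Y0 n => (x l).coeff u) ha
  simp only [relation_sum_apply, AddMonoidAlgebra.coeff_sub, Finsupp.sub_apply,
    AddMonoidAlgebra.coeff_mul_single_apply, mul_one] at h1
  rw [neg_neg] at h1
  rw [h1]
  rw [Finsupp.sum, Finsupp.finsetSum_apply, AddMonoidAlgebra.coeff_sum, Finsupp.finsetSum_apply,
    Finset.sum_eq_single u]
  · simp [clScreenMon_apply]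
  · intro m _ hm
    simp [clScreenMon_apply, hm]
  · intro hu
    simp [Finsupp.notMem_support_iff.mp hu]

/-! ### Coefficients in the deformed algebra -/

section

variable {Q : Matrix (Fin n) (Fin n) ℤ[T;T⁻¹]} {r : Fin n → ℕ}

theorem Yt.coeff_mon (m m' : Mon n) :
    Yt.coeff Q r (Yt.mon Q r m) m' = if m = m' then 1 else 0 :=
  Finsupp.single_apply

theorem Yt.mon_mul_mon (m₁ m₂ : Mon n) : Yt.mon Q r m₁ * Yt.mon Q r m₂ =
    (T (dExp Q r m₁ m₂) : ℤ[T;T⁻¹]) • Yt.mon Q r (m₁ + m₂) :=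
  Yt.mulHom_mon m₁ m₂

theorem Yt.coeff_injective : Function.Injective (Yt.coeff Q r) :=
  DFunLike.coe_injective (F := Mon n →₀ ℤ[T;T⁻¹])

theorem Yt.coeff_support_finite (x : Yt Q r) : (Function.support (Yt.coeff Q r x)).Finite :=
  Finsupp.hasFiniteSupport (show Mon n →₀ ℤ[T;T⁻¹] from x)

theorem Yt.coeff_mul_mon (x : Yt Q r) (m m' : Mon n) :
    Yt.coeff Q r (x * Yt.mon Q r m') (m + m') = T (dExp Q r m m') * Yt.coeff Q r x m := by
  have h : (LinearMap.proj (m + m')).comp ((Yt.coeff Q r).comp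
      (LinearMap.mulRight ℤ[T;T⁻¹] (Yt.mon Q r m'))) =
      (T (dExp Q r m m') : ℤ[T;T⁻¹]) • (LinearMap.proj m).comp (Yt.coeff Q r) := by
    refine Yt.hom_ext fun p => ?_
    simp only [LinearMap.comp_apply, LinearMap.mulRight_apply, Yt.mon_mul_mon, map_smul,
      LinearMap.proj_apply, LinearMap.smul_apply, Yt.coeff_mon, smul_eq_mul]
    by_cases hp : p = m
    · simp [hp]
    · rw [if_neg hp, if_neg (fun h => hp (add_right_cancel h))]
      simp
  exact LinearMap.congr_fun h x

theorem Yt.coeff_mul_mon_of_forall_ne (x : Yt Q r) {m m' : Mon n} (hm : ∀ p, p + m' ≠ m) :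
    Yt.coeff Q r (x * Yt.mon Q r m') m = 0 := by
  have h : (LinearMap.proj m).comp ((Yt.coeff Q r).comp
      (LinearMap.mulRight ℤ[T;T⁻¹] (Yt.mon Q r m'))) = 0 := by
    refine Yt.hom_ext fun p => ?_
    simp [LinearMap.comp_apply, Yt.mon_mul_mon, Yt.coeff_mon, hm p]
  exact LinearMap.congr_fun h x

@[simp]
theorem screenInt_zero : screenInt 0 = 0 := by simp [screenInt, quantumInt]

theorem screenInt_ne_zero {u : ℤ} (hu : u ≠ 0) : screenInt u ≠ 0 := by
  intro h
  have := congrArg evalOne h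
  rw [screenInt, map_mul, evalOne_T, evalOne_quantumInt, map_zero, one_mul] at this
  exact hu this

theorem tScreenMon_apply (i : Fin n) (m : Mon n) (l : ℤ) :
    tScreenMon Q r i m l = screenInt (uExp Q m (i, l)) • Yt.mon Q r m := by
  rw [tScreenMon, Finsupp.sum, Finsupp.finsetSum_apply, Finset.sum_eq_single (i, l)]
  · simp
  · rintro ⟨i', l'⟩ _ h
    by_cases hi : i' = i
    · subst hi
      have : l' ≠ l := by rintro rfl; exact h rfl
      simp [this]
    · simp [hi]
  · intro h
    simp [Finsupp.notMem_support_iff.mp h]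

theorem tScreen_apply (i : Fin n) (f : Yt Q r) : tScreen Q r i f =
    (tRel Q r i).mkQ (Yt.lift Q r (tScreenMon Q r i) f) := by
  have h : tScreen Q r i = ((tRel Q r i).mkQ.restrictScalars ℤ[T;T⁻¹]).comp
      (Yt.lift Q r (tScreenMon Q r i)) := by
    refine Yt.hom_ext fun m => ?_
    rw [LinearMap.comp_apply, tScreen, Yt.lift_mon, Yt.lift_mon]
    rfl
  rw [h]
  rfl

theorem coeff_lift_tScreenMon (i : Fin n) (f : Yt Q r) (l : ℤ) (m : Mon n) :
    Yt.coeff Q r (Yt.lift Q r (tScreenMon Q r i) f l) m =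
      Yt.coeff Q r f m * screenInt (uExp Q m (i, l)) := by
  have h : (LinearMap.proj m).comp ((Yt.coeff Q r).comp ((Finsupp.lapply l).comp
      (Yt.lift Q r (tScreenMon Q r i)))) =
      screenInt (uExp Q m (i, l)) • (LinearMap.proj m).comp (Yt.coeff Q r) := by
    refine Yt.hom_ext fun p => ?_
    simp only [LinearMap.comp_apply, Yt.lift_mon, Finsupp.lapply_apply, tScreenMon_apply, map_smul,
      LinearMap.proj_apply, LinearMap.smul_apply, Yt.coeff_mon, smul_eq_mul]
    by_cases hp : p = m
    · simp [hp]
    · simp [hp]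
  rw [mul_comm]
  exact LinearMap.congr_fun h f

/-- An element of `Ker(S_{i,t})` written out: its image in `⨁_l Ŷ_t S̃_{i,l}` is a combination of
the relations. -/
theorem exists_of_tScreen_eq_zero {i : Fin n} {f : Yt Q r} (h : tScreen Q r i f = 0) :
    ∃ a : ℤ →₀ Yt Q r, ∀ l m, Yt.coeff Q r f m * screenInt (uExp Q m (i, l)) =
      Yt.coeff Q r (a (l + r i)) m -
        T (-2) * Yt.coeff Q r (a (l - r i) * Yt.mon Q r (monV i (l - r i))) m := by
  rw [tScreen_apply, Submodule.mkQ_apply, Submodule.Quotient.mk_eq_zero, tRel,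
    Finsupp.mem_span_range_iff_exists_finsupp] at h
  obtain ⟨a, ha⟩ := h
  refine ⟨a, fun l m => ?_⟩
  have h1 := congrArg (fun x : ℤ →₀ Yt Q r => Yt.coeff Q r (x l) m) ha
  simp only [relation_sum_apply, coeff_lift_tScreenMon] at h1
  rw [← h1, map_sub, Pi.sub_apply, Yt.aInv, smul_smul, ← LaurentPolynomial.T_add, mul_smul_comm,
    map_smul, Pi.smul_apply, smul_eq_mul]
  norm_num

end

end

/-! ### Antidominant monomials in the kernels -/

section

variable {n : ℕ}

section

variable {Q : Matrix (Fin n) (Fin n) ℤ[T;T⁻¹]} {r : Fin n → ℕ}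

variable (Q) in
/-- The exponent vector of `∏ A_{j,k} ^ {v_{j,k}}` for integral exponents `v`. -/
def aLin : (Fin n × ℤ →₀ ℤ) →ₗ[ℤ] YMon n := Finsupp.linearCombination ℤ (aVec Q)

theorem aLin_single (p : Fin n × ℤ) (c : ℤ) : aLin Q (Finsupp.single p c) = c • aVec Q p :=
  Finsupp.linearCombination_single _ _ _

theorem aSum_eq_aLin (w : Fin n × ℤ →₀ ℕ) :
    aSum Q w = aLin Q (w.mapRange (fun c : ℕ => (c : ℤ)) rfl) := by
  rw [aLin, Finsupp.linearCombination_apply, Finsupp.sum_mapRange_index (by simp), aSum]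
  simp only [natCast_zsmul]

theorem aLin_apply_of_forall_eq_zero {i : Fin n} {ρ : ℕ} (hQ : Q i i = T (ρ : ℤ) + T (-(ρ : ℤ)))
    {w : Fin n × ℤ →₀ ℤ} (hw : ∀ p : Fin n × ℤ, p.1 ≠ i → w p = 0) (l : ℤ) :
    aLin Q w (i, l) = w (i, l - ρ) + w (i, l + ρ) := by
  have h : ∀ p ∈ w.support, (w p • aVec Q p) (i, l) =
      (if p = (i, l - (ρ : ℤ)) then w p else 0) + (if p = (i, l + (ρ : ℤ)) then w p else 0) := by
    rintro ⟨i', k⟩ hp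
    obtain rfl : i' = i := by
      by_contra h
      exact Finsupp.mem_support_iff.mp hp (hw _ h)
    rw [Finsupp.smul_apply, aVec_diag hQ, smul_eq_mul, mul_add, add_comm]
    simp
  rw [aLin, Finsupp.linearCombination_apply, Finsupp.sum, Finsupp.finsetSum_apply,
    Finset.sum_congr rfl h, Finset.sum_add_distrib, Finset.sum_ite_eq', Finset.sum_ite_eq']
  congr 1 <;> exact ite_eq_left_iff.mpr fun h => (Finsupp.notMem_support_iff.mp h).symm

theorem aLin_sub_apply {i : Fin n} {ρ : ℕ} (hQ : Q i i = T (ρ : ℤ) + T (-(ρ : ℤ))) (m : YMon n)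
    (v v' : Fin n × ℤ →₀ ℤ) (hv : ∀ p : Fin n × ℤ, p.1 ≠ i → v p = v' p) (l : ℤ) :
    (m - aLin Q v) (i, l) - (m - aLin Q v') (i, l) =
      (v' (i, l - ρ) + v' (i, l + ρ)) - (v (i, l - ρ) + v (i, l + ρ)) := by
  have h := aLin_apply_of_forall_eq_zero hQ (w := v' - v)
    (fun p hp => by rw [Finsupp.sub_apply, hv p hp, sub_self]) l
  rw [map_sub] at h
  simp only [Finsupp.sub_apply] at h ⊢
  linarith

/-- A nonzero function of finite support has an extreme term. -/
theorem exists_extreme {R : Type*} [Zero R] {c : (Fin n × ℤ →₀ ℤ) → R} (hc : c.support.Finite)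
    (hne : ∃ v, c v ≠ 0) : ∃ m, c m ≠ 0 ∧ ∀ v, c v ≠ 0 → topKey v ≤ topKey m := by
  obtain ⟨v, hv⟩ := hne
  obtain ⟨m, hm, h⟩ := Finset.exists_max_image hc.toFinset topKey ⟨v, by simpa using hv⟩
  exact ⟨m, by simpa using hm, fun v hv => h v (by simpa using hv)⟩

/-- If the `A_{j,k}` are independent, a nonzero element of `𝔎` has an antidominant monomial. -/
theorem exists_antidominant_of_mem_clKer (hQ : ∀ i, Q i i = T (r i : ℤ) + T (-(r i : ℤ)))
    (hr : ∀ i, 0 < r i) (hinj : Function.Injective (aLin Q)) {F : Y0 n} (hF : F ∈ clKer Q r)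
    {m : YMon n} (hm : F.coeff m ≠ 0) : ∃ u, F.coeff u ≠ 0 ∧ Antidominant u := by
  -- the part of `F` in the coset of `m` under the group of monomials in the `A_{j,k}`
  let c : (Fin n × ℤ →₀ ℤ) → ℤ := fun v => F.coeff (m - aLin Q v)
  have hfin : c.support.Finite := by
    refine Set.Finite.preimage (f := fun v => m - aLin Q v) (fun v _ v' _ h => ?_)
      F.coeff.hasFiniteSupport
    exact hinj (sub_right_injective h)
  obtain ⟨v, hv, hmax⟩ := exists_extreme hfin ⟨0, by simpa [c] using hm⟩
  refine ⟨_, hv, fun ⟨i, l⟩ => ?_⟩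
  have hFi : clScreen Q r i F = 0 := (AddSubgroup.mem_iInf.mp hF) i
  obtain ⟨a, ha⟩ := exists_of_clScreen_eq_zero hFi
  refine nonpos_of_extreme (i := i) (ρ := r i) (by exact_mod_cast hr i) hv hfin hmax
    (u := fun v l => (m - aLin Q v) (i, l)) (aLin_sub_apply (hQ i) m) (κ := fun z => z)
    (fun z hz => hz) (a := fun k v => (a k).coeff (m - aLin Q v)) ?_ (ε := fun _ _ => 1)
    (fun _ _ => one_ne_zero) (fun l v => ?_) l
  · refine a.support.finite_toSet.subset fun k hk => ?_
    by_contra h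
    rw [Finset.mem_coe, Finsupp.notMem_support_iff] at h
    exact hk (by rw [h]; rfl)
  · rw [ha, map_sub (aLin Q), aLin_single, one_smul, one_mul, sub_add]

/-- An element of `𝔎̂_t`, all of whose monomials have the same `Y`-part, has an antidominant
monomial. -/
theorem exists_antidominant_of_mem_tKer (hQ : ∀ i, Q i i = T (r i : ℤ) + T (-(r i : ℤ)))
    (hr : ∀ i, 0 < r i) {f : Yt Q r} (hf : f ∈ tKer Q r) {y : Fin n × ℤ →₀ ℕ}
    (hy : ∀ m, Yt.coeff Q r f m ≠ 0 → m.1 = y) (hne : f ≠ 0) :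
    ∃ m, Yt.coeff Q r f m ≠ 0 ∧ Antidominant (uExp Q m) := by
  classical
  -- exponents in `Ā` are natural numbers; the coefficients are extended by zero to integral ones
  let ν : (Fin n × ℤ →₀ ℤ) → (Fin n × ℤ →₀ ℕ) := fun v => v.mapRange Int.toNat rfl
  have hν : ∀ v, 0 ≤ v → (ν v).mapRange (fun c : ℕ => (c : ℤ)) rfl = v := fun v hv => by
    ext p
    simpa [ν] using hv p
  have hνu : ∀ v, 0 ≤ v →
      uExp Q (y, ν v) = y.mapRange (fun c : ℕ => (c : ℤ)) rfl - aLin Q v := fun v hv => by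
    rw [uExp, aSum_eq_aLin, hν v hv]
  let ext : (Mon n → ℤ[T;T⁻¹]) → (Fin n × ℤ →₀ ℤ) → ℤ[T;T⁻¹] :=
    fun g v => if 0 ≤ v then g (y, ν v) else 0
  have hfin : (ext (Yt.coeff Q r f)).support.Finite := by
    refine ((Yt.coeff_support_finite f).image
      fun m => m.2.mapRange (fun c : ℕ => (c : ℤ)) rfl).subset fun v hv => ?_
    have hv' : ext (Yt.coeff Q r f) v ≠ 0 := hv
    have h0 : 0 ≤ v := by
      by_contra h
      exact hv' (if_neg h)
    refine ⟨(y, ν v), ?_, hν v h0⟩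
    rw [Function.mem_support]
    simpa only [ext, if_pos h0] using hv'
  have hne' : ∃ v, ext (Yt.coeff Q r f) v ≠ 0 := by
    obtain ⟨m, hm⟩ : ∃ m, Yt.coeff Q r f m ≠ 0 := by
      by_contra! h
      exact hne (Yt.coeff_injective (by rw [map_zero]; exact funext h))
    refine ⟨m.2.mapRange (fun c : ℕ => (c : ℤ)) rfl, ?_⟩
    have h0 : (0 : Fin n × ℤ →₀ ℤ) ≤ m.2.mapRange (fun c : ℕ => (c : ℤ)) rfl := fun p => by simp
    have h1 : ν (m.2.mapRange (fun c : ℕ => (c : ℤ)) rfl) = m.2 := by ext p; simp [ν]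
    simp only [ext, if_pos h0, h1]
    rw [← hy m hm]
    exact hm
  obtain ⟨v, hv, hmax⟩ := exists_extreme hfin hne'
  have h0 : 0 ≤ v := by
    by_contra h
    exact hv (if_neg h)
  refine ⟨(y, ν v), by simpa only [ext, if_pos h0] using hv, fun ⟨i, l⟩ => ?_⟩
  rw [hνu v h0]
  have hfi : tScreen Q r i f = 0 := (Submodule.mem_iInf _).mp hf i
  obtain ⟨a, ha⟩ := exists_of_tScreen_eq_zero hfi
  refine nonpos_of_extreme (i := i) (ρ := r i) (by exact_mod_cast hr i) hv hfin hmax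
    (u := fun v l => (y.mapRange (fun c : ℕ => (c : ℤ)) rfl - aLin Q v) (i, l))
    (aLin_sub_apply (hQ i) _) (κ := screenInt)
    (fun z hz => screenInt_ne_zero hz) (a := fun k => ext (Yt.coeff Q r (a k))) ?_
    (ε := fun l v => T (-2) *
      T (dExp Q r (y, ν (v - Finsupp.single (i, l - r i) 1)) (monV i (l - r i))))
    (fun _ _ => mul_ne_zero (LaurentPolynomial.isUnit_T _).ne_zero
      (LaurentPolynomial.isUnit_T _).ne_zero) (fun l v => ?_) l
  · refine a.support.finite_toSet.subset fun k hk => ?_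
    by_contra h
    rw [Finset.mem_coe, Finsupp.notMem_support_iff] at h
    exact hk (by rw [h, map_zero]; funext v; simp [ext])
  · by_cases hv0 : 0 ≤ v
    · have h1 := ha l (y, ν v)
      rw [hνu v hv0] at h1
      simp only [ext, if_pos hv0]
      rw [h1]
      congr 1
      by_cases hv1 : 0 ≤ v - Finsupp.single (i, l - (r i : ℤ)) 1
      · rw [if_pos hv1, mul_assoc, ← Yt.coeff_mul_mon]
        refine congrArg (fun m => T (-2) * Yt.coeff Q r _ m) (Prod.ext (by simp [monV]) ?_)
        ext p
        have hp := hv1 p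
        simp only [ν, monV, Prod.mk_add_mk, Finsupp.add_apply, Finsupp.mapRange_apply,
          Finsupp.sub_apply, Finsupp.single_apply, Finsupp.zero_apply] at hp ⊢
        split_ifs at hp ⊢ <;> omega
      · rw [if_neg hv1, mul_zero, Yt.coeff_mul_mon_of_forall_ne, mul_zero]
        intro p hp
        refine hv1 fun q => ?_
        have h2 := DFunLike.congr_fun (congrArg Prod.snd hp) q
        have h3 := hv0 q
        simp only [ν, monV, Prod.snd_add, Finsupp.add_apply, Finsupp.mapRange_apply,
          Finsupp.sub_apply, Finsupp.single_apply, Finsupp.zero_apply] at h2 h3 ⊢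
        split_ifs at h2 ⊢ <;> omega
    · have hv1 : ¬ 0 ≤ v - Finsupp.single (i, l - (r i : ℤ)) 1 := fun h => hv0 fun p => by
        have hp := h p
        simp only [Finsupp.sub_apply, Finsupp.single_apply, Finsupp.zero_apply] at hp ⊢
        split_ifs at hp <;> omega
      have e0 : ∀ g, ext g v = 0 := fun g => if_neg hv0
      have e1 : ∀ g, ext g (v - Finsupp.single (i, l - (r i : ℤ)) 1) = 0 := fun g => if_neg hv1
      rw [e0, e0, e1, zero_mul, mul_zero, sub_zero]

end

/-! ### Independence of the `A_{j,k}` -/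

/-- The generating series `∑_l u_{i,l} z^{-l}` of the exponents of colour `i`. -/
def genSeries (i : Fin n) : YMon n →+ ℤ[T;T⁻¹] :=
  Finsupp.liftAddHom fun p => if p.1 = i then
    (LinearMap.toSpanSingleton ℤ ℤ[T;T⁻¹] (T (-p.2))).toAddMonoidHom else 0

theorem genSeries_single (i : Fin n) (p : Fin n × ℤ) (c : ℤ) :
    genSeries i (Finsupp.single p c) = if p.1 = i then c • T (-p.2) else 0 := by
  rw [genSeries, Finsupp.liftAddHom_apply_single]
  split <;> rfl

theorem coeff_genSeries (i : Fin n) (u : YMon n) (l : ℤ) :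
    (genSeries i u).coeff (-l) = u (i, l) := by
  classical
  induction u using Finsupp.induction_linear with
  | zero => simp
  | add u v hu hv => rw [map_add, AddMonoidAlgebra.coeff_add, Finsupp.add_apply, hu, hv]; rfl
  | single p c =>
    obtain ⟨i', l'⟩ := p
    rw [genSeries_single, Finsupp.single_apply]
    by_cases hi : i' = i <;> by_cases hl : l' = l <;>
      simp [hi, hl, -zsmul_eq_mul]

theorem genSeries_aVec (Q : Matrix (Fin n) (Fin n) ℤ[T;T⁻¹]) (i : Fin n) (p : Fin n × ℤ) :
    genSeries i (aVec Q p) = Q i p.1 * T (-p.2) := by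
  ext l
  have h := coeff_genSeries i (aVec Q p) (-l)
  rw [neg_neg] at h
  rw [h, aVec_apply, T, AddMonoidAlgebra.coeff_mul_single_apply]
  simp [add_comm]

theorem genSeries_aLin (Q : Matrix (Fin n) (Fin n) ℤ[T;T⁻¹]) (i : Fin n) (v : Fin n × ℤ →₀ ℤ) :
    genSeries i (aLin Q v) = ∑ j, Q i j * genSeries j v := by
  induction v using Finsupp.induction_linear with
  | zero => simp
  | add v w hv hw => simp only [map_add, hv, hw, mul_add, Finset.sum_add_distrib]
  | single p c =>
    rw [aLin_single, map_zsmul, genSeries_aVec, Finset.sum_eq_single p.1]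
    · rw [genSeries_single, if_pos rfl, mul_smul_comm]
    · intro j _ hj
      rw [genSeries_single, if_neg hj.symm, mul_zero]
    · simp

/-- `det Q ≠ 0` makes the `A_{j,k}` independent: in terms of generating series `aLin Q` is the
multiplication by `Q`. -/
theorem aLin_injective {Q : Matrix (Fin n) (Fin n) ℤ[T;T⁻¹]} (hQ : Q.det ≠ 0) :
    Function.Injective (aLin Q) := by
  rw [injective_iff_map_eq_zero]
  intro v hv
  have h : Q.mulVec (fun j => genSeries j v) = 0 := by
    funext i
    rw [Matrix.mulVec, dotProduct, ← genSeries_aLin, hv, map_zero]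
    rfl
  have h' := Matrix.eq_zero_of_mulVec_eq_zero hQ h
  ext ⟨i, l⟩
  rw [← coeff_genSeries, congrFun h' i]
  rfl

end

/-! ### Restrictions on the Cartan matrix -/

section

variable {n : ℕ}

theorem quantumInt_neg_one (a : ℕ) : quantumInt a (-1) = -1 := by
  have h : (-1 : ℤ).natAbs = 1 := rfl
  have h' : (-1 : ℤ).sign = -1 := rfl
  rw [quantumInt, h, h', Finset.sum_range_one]
  norm_num

theorem quantumInt_zero (a : ℕ) : quantumInt a 0 = 0 := by
  simp [quantumInt]

theorem quantumInt_neg_two (a : ℕ) : quantumInt a (-2) = -(T (a : ℤ) + T (-(a : ℤ))) := by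
  have h : (-2 : ℤ).natAbs = 2 := rfl
  have h' : (-2 : ℤ).sign = -1 := rfl
  rw [quantumInt, h, h', Finset.sum_range_succ, Finset.sum_range_one]
  norm_num

theorem quantumInt_neg_three (a : ℕ) :
    quantumInt a (-3) = -(T (2 * (a : ℤ)) + 1 + T (-(2 * (a : ℤ)))) := by
  have h : (-3 : ℤ).natAbs = 3 := rfl
  have h' : (-3 : ℤ).sign = -1 := rfl
  rw [quantumInt, h, h', Finset.sum_range_succ, Finset.sum_range_succ, Finset.sum_range_one]
  norm_num
  ring_nf

theorem quantumInt_neg_four (a : ℕ) : quantumInt a (-4) =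
    -(T (3 * (a : ℤ)) + T (a : ℤ) + T (-(a : ℤ)) + T (-(3 * (a : ℤ)))) := by
  have h : (-4 : ℤ).natAbs = 4 := rfl
  have h' : (-4 : ℤ).sign = -1 := rfl
  rw [quantumInt, h, h', Finset.sum_range_succ, Finset.sum_range_succ, Finset.sum_range_succ,
    Finset.sum_range_one]
  norm_num
  ring_nf

/-- In the case `A_2^{(2)}` with `C'(z)` the determinant vanishes at `z = 1`; its leading term is
`z ^ {5k}`. -/
theorem det_ne_zero_of_neg_four {k : ℕ} (hk : 0 < k) :
    (T (4 * (k : ℤ)) + T (-(4 * (k : ℤ)))) * (T (k : ℤ) + T (-(k : ℤ))) -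
      quantumInt k (-4) * -1 ≠ (0 : ℤ[T;T⁻¹]) := by
  intro h
  rw [quantumInt_neg_four] at h
  have h5 := congrArg (fun x : ℤ[T;T⁻¹] => x.coeff (5 * (k : ℤ))) h
  simp only [add_mul, mul_add, ← LaurentPolynomial.T_add, mul_neg, neg_neg, mul_one,
    AddMonoidAlgebra.coeff_sub, AddMonoidAlgebra.coeff_add, Finsupp.add_apply, Finsupp.sub_apply,
    LaurentPolynomial.T_apply, AddMonoidAlgebra.coeff_zero, Finsupp.zero_apply] at h5
  have hk' : (0 : ℤ) < k := by exact_mod_cast hk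
  split_ifs at h5 <;> omega

theorem symm_of_isSymmetrizedBy {C : Matrix (Fin 2) (Fin 2) ℤ} {r : Fin 2 → ℕ}
    (hB : IsSymmetrizedBy C r) (i j : Fin 2) : (r i : ℤ) * C i j = r j * C j i := by
  have := hB.apply j i
  simpa [Matrix.diagonal_mul] using this

/-- In infinite type the deformed Cartan matrix is nonsingular. For `C'(z)` this is seen at `z = 1`
unless `C₀₁ C₁₀ = 4`; then either `{C₀₁, C₁₀} = {-1, -4}`, or `C₀₁ = C₁₀ = -2`, in which case
`B(z)` is symmetric and `C'(z)` does not occur. -/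
theorem det_defCartan_ne_zero {C : Matrix (Fin 2) (Fin 2) ℤ} (hC : IsGCM C) {r : Fin 2 → ℕ}
    (hr : ∀ i, 0 < r i) (hB : IsSymmetrizedBy C r) (hdet : (cartanZ C r).det ≠ 0)
    (h4 : 4 ≤ C 0 1 * C 1 0) : (defCartan C r).det ≠ 0 := by
  have hS := symm_of_isSymmetrizedBy hB 0 1
  have n01 := hC.nonpos 0 1 (by decide)
  have n10 := hC.nonpos 1 0 (by decide)
  rw [defCartan]
  split
  · exact hdet
  · next hns =>
    by_cases h5 : C 0 1 * C 1 0 = 4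
    · obtain h | h | h : (C 0 1 = -1 ∧ C 1 0 = -4) ∨ (C 0 1 = -4 ∧ C 1 0 = -1) ∨
          (C 0 1 = -2 ∧ C 1 0 = -2) := by
        have h01 : C 0 1 ≤ -1 := by
          have : C 0 1 ≠ 0 := fun h => by rw [h] at h5; omega
          omega
        have h10 : C 1 0 ≤ -1 := by
          have : C 1 0 ≠ 0 := fun h => by rw [h] at h5; omega
          omega
        have hb1 : -4 ≤ C 0 1 := by nlinarith
        have hb2 : -4 ≤ C 1 0 := by nlinarith
        generalize C 0 1 = p at *
        generalize C 1 0 = q at *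
        interval_cases p <;> interval_cases q <;> simp_all
      · have h0 : r 0 = 4 * r 1 := by rw [h.1, h.2] at hS; omega
        rw [Matrix.det_fin_two]
        simp only [cartanZ', Matrix.of_apply, hC.diag, h.1, h.2, quantumInt_two,
          quantumInt_neg_one]
        rw [h0, mul_comm (-1 : ℤ[T;T⁻¹])]
        push_cast
        exact det_ne_zero_of_neg_four (hr 1)
      · have h0 : r 1 = 4 * r 0 := by rw [h.1, h.2] at hS; omega
        rw [Matrix.det_fin_two]
        simp only [cartanZ', Matrix.of_apply, hC.diag, h.1, h.2, quantumInt_two,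
          quantumInt_neg_one]
        rw [h0, mul_comm (T (r 0 : ℤ) + _)]
        push_cast
        exact det_ne_zero_of_neg_four (hr 0)
      · have h0 : r 0 = r 1 := by rw [h.1, h.2] at hS; omega
        refine absurd (Matrix.IsSymm.ext fun i j => ?_) hns
        simp only [symCartanZ, Matrix.diagonal_mul]
        fin_cases i <;> fin_cases j <;> simp [cartanZ, h0, h.1, h.2]
    · intro h
      have h1 := congrArg evalOne h
      rw [Matrix.det_fin_two] at h1
      simp only [cartanZ', Matrix.of_apply, map_sub, map_mul, evalOne_quantumInt, hC.diag,
        map_zero] at h1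
      omega

section

variable {C : Matrix (Fin 2) (Fin 2) ℤ} {Q : Matrix (Fin 2) (Fin 2) ℤ[T;T⁻¹]} {r : Fin 2 → ℕ}

/-- A finite result of the classical algorithm begun with `Y_{0,0}` is a nonzero element of `𝔎`,
because no monomial but the first of the run is dominant, and so it has an antidominant
monomial. -/
theorem offDiag_mul_le_three_of_classicalFMem (hC : IsGCM C) (hspec : Specializes Q C)
    (hQ : ∀ i, Q i i = T (r i : ℤ) + T (-(r i : ℤ))) (hr : ∀ i, 0 < r i) (hdet : Q.det ≠ 0)
    (h : ClassicalFMem Q r (Finsupp.single (0, 0) 1)) : C 0 1 * C 1 0 ≤ 3 := by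
  classical
  obtain ⟨s, σ, hrun, hF⟩ := h
  have hcoeff : ∀ u, (s.sum fun w c =>
      (AddMonoidAlgebra.single (below Q (Finsupp.single (0, 0) 1) w) c : Y0 2)).coeff u =
      ∑ w ∈ s.support, if below Q (Finsupp.single (0, 0) 1) w = u then s w else 0 := fun u => by
    rw [Finsupp.sum, AddMonoidAlgebra.coeff_sum, Finsupp.finsetSum_apply]
    exact Finset.sum_congr rfl fun w _ => by
      rw [AddMonoidAlgebra.coeff_single, Finsupp.single_apply]
  have hb0 : below Q (Finsupp.single (0, 0) 1) 0 = Finsupp.single (0, 0) 1 := by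
    rw [below, aSum_zero, sub_zero]
  obtain ⟨u, hu, hanti⟩ := exists_antidominant_of_mem_clKer hQ hr (aLin_injective hdet) hF
    (m := Finsupp.single (0, 0) 1) (by
      rw [hcoeff, Finset.sum_eq_single 0]
      · rw [if_pos hb0, hrun.start]
        exact one_ne_zero
      · intro w _ hw
        refine ite_eq_right_iff.mpr fun hw' => hrun.dominant w hw ?_
        rw [hw']
        intro p
        rw [Finsupp.single_apply]
        split <;> simp
      · intro h0
        rw [Finsupp.notMem_support_iff, hrun.start] at h0
        exact absurd h0 one_ne_zero)
  rw [hcoeff] at hu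
  obtain ⟨w, _, hw⟩ := Finset.exists_ne_zero_of_sum_ne_zero hu
  obtain ⟨hw, _⟩ := ite_ne_right_iff.mp hw
  rw [← hw] at hanti
  exact offDiag_mul_le_three_of_antidominant hC hspec hanti

theorem offDiag_mul_le_three_of_coneC (hC : IsGCM C) (hspec : Specializes Q C) {i : Fin 2}
    {m : Mon 2} (hm : m ∈ coneC Q (monY i 0)) (h : Antidominant (uExp Q m)) :
    C 0 1 * C 1 0 ≤ 3 := by
  obtain ⟨_, _, w, _, rfl⟩ := hm
  rw [uExp_monY_add] at h
  exact offDiag_mul_le_three_of_antidominant hC hspec h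

theorem offDiag_mul_le_three_of_tKer (hC : IsGCM C) (hspec : Specializes Q C)
    (hQ : ∀ i, Q i i = T (r i : ℤ) + T (-(r i : ℤ))) (hr : ∀ i, 0 < r i) {i : Fin 2}
    (h : tKerInInf Q r ⊓ tildeC Q (monY i 0) ≠ ⊥) : C 0 1 * C 1 0 ≤ 3 := by
  obtain ⟨g, ⟨⟨f, hf, rfl⟩, hg⟩, hne⟩ := Submodule.exists_mem_ne_zero_of_ne_bot h
  obtain ⟨m, hm, hanti⟩ := exists_antidominant_of_mem_tKer hQ hr hf
    (y := Finsupp.single (i, 0) 1) (fun m hm => by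
      obtain ⟨_, _, w, _, rfl⟩ := hg.2 m hm
      simp [monY]) (fun h => hne (by rw [h, map_zero]))
  exact offDiag_mul_le_three_of_coneC hC hspec (hg.2 m hm) hanti

end

end

/-! ### Formal kernels of the screening operators -/

section

variable {n : ℕ}

/-- The polynomial `∏_l (1 + A_{i,l+r_i}⁻¹) ^ {u_{i,l}}` in independent variables `A_{i,l}⁻¹`, so
that `E_i(u) = u · expFactor r i u` for an `i`-dominant Laurent monomial `u`. -/
def expFactor (r : Fin n → ℕ) (i : Fin n) (u : YMon n) : MvPolynomial (Fin n × ℤ) ℤ :=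
  u.prod fun p c => if p.1 = i then (1 + MvPolynomial.X (p.1, p.2 + (r p.1 : ℤ))) ^ c.toNat else 1

open scoped Classical in
theorem eCoeff_eq (r : Fin n → ℕ) (i : Fin n) (u : YMon n) (δ : Fin n × ℤ →₀ ℕ) :
    eCoeff r i u δ = if IDominant i u then MvPolynomial.coeff δ (expFactor r i u) else 0 := rfl

theorem expFactor_add (r : Fin n → ℕ) {i : Fin n} {u v : YMon n} (hu : IDominant i u)
    (hv : IDominant i v) : expFactor r i (u + v) = expFactor r i u * expFactor r i v := by
  classical
  have h1 : ∀ w : YMon n, ∀ s : Finset (Fin n × ℤ), w.support ⊆ s → expFactor r i w =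
      ∏ p ∈ s, if p.1 = i then
        (1 + MvPolynomial.X (p.1, p.2 + (r p.1 : ℤ)) : MvPolynomial (Fin n × ℤ) ℤ) ^ (w p).toNat
      else 1 := fun w s hs => Finsupp.prod_of_support_subset _ hs _ (by simp)
  rw [h1 (u + v) (u.support ∪ v.support) Finsupp.support_add,
    h1 u (u.support ∪ v.support) Finset.subset_union_left,
    h1 v (u.support ∪ v.support) Finset.subset_union_right, ← Finset.prod_mul_distrib]
  refine Finset.prod_congr rfl fun p _ => ?_
  split
  · next hp =>
    obtain ⟨i', l⟩ := p
    subst hp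
    rw [Finsupp.add_apply, Int.toNat_add (hu l) (hv l), pow_add]
  · rw [one_mul]

theorem expFactor_single_self (r : Fin n → ℕ) (i : Fin n) (l : ℤ) :
    expFactor r i (Finsupp.single (i, l) 1) = 1 + MvPolynomial.X (i, l + (r i : ℤ)) := by
  rw [expFactor, Finsupp.prod_single_index (by simp)]
  simp

theorem expFactor_eq_one (r : Fin n → ℕ) {i : Fin n} {u : YMon n} (hu : ∀ l, u (i, l) = 0) :
    expFactor r i u = 1 := by
  refine Finset.prod_eq_one fun p hp => ?_
  refine if_neg fun h => ?_
  obtain ⟨i', l⟩ := p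
  subst h
  exact Finsupp.mem_support_iff.mp hp (hu l)

theorem coeff_zero_expFactor (r : Fin n → ℕ) (i : Fin n) (u : YMon n) :
    MvPolynomial.coeff 0 (expFactor r i u) = 1 := by
  rw [← MvPolynomial.constantCoeff_eq, expFactor, Finsupp.prod, map_prod]
  refine Finset.prod_eq_one fun p _ => ?_
  split <;> simp

theorem IDominant.add {i : Fin n} {u v : YMon n} (hu : IDominant i u) (hv : IDominant i v) :
    IDominant i (u + v) := fun l => add_nonneg (hu l) (hv l)

theorem below_zero (Q : Matrix (Fin n) (Fin n) ℤ[T;T⁻¹]) (m : YMon n) : below Q m 0 = m := by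
  rw [below, aSum_zero, sub_zero]

theorem below_add (Q : Matrix (Fin n) (Fin n) ℤ[T;T⁻¹]) (m m' : YMon n) (w w' : Fin n × ℤ →₀ ℕ) :
    below Q (m + m') (w + w') = below Q m w + below Q m' w' := by
  rw [below, below, below, aSum_add]
  abel

theorem below_below (Q : Matrix (Fin n) (Fin n) ℤ[T;T⁻¹]) (m : YMon n) (w w' : Fin n × ℤ →₀ ℕ) :
    below Q (below Q m w) w' = below Q m (w + w') := by
  rw [below, below, below, aSum_add, sub_sub]

/-- The polynomials `f = ∑_w f_w A^{-w}` for which `m f` is a combination of the `E_i(m A^{-w})`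
with `m A^{-w}` `i`-dominant. This is the kernel of the `i`-th screening operator on `m ℤ[A^{-1}]`,
the variables `A_{j,k}⁻¹` being treated as independent. -/
def formalKer (Q : Matrix (Fin n) (Fin n) ℤ[T;T⁻¹]) (r : Fin n → ℕ) (i : Fin n) (m : YMon n) :
    Submodule ℤ (MvPolynomial (Fin n × ℤ) ℤ) :=
  Submodule.span ℤ {f | ∃ w, IDominant i (below Q m w) ∧
    f = MvPolynomial.monomial w 1 * expFactor r i (below Q m w)}

section

variable {Q : Matrix (Fin n) (Fin n) ℤ[T;T⁻¹]} {r : Fin n → ℕ} {i : Fin n}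

theorem formalKer_mul {m m' : YMon n} {f g : MvPolynomial (Fin n × ℤ) ℤ}
    (hf : f ∈ formalKer Q r i m) (hg : g ∈ formalKer Q r i m') :
    f * g ∈ formalKer Q r i (m + m') := by
  have h := Submodule.mul_mem_mul hf hg
  rw [formalKer, formalKer, Submodule.span_mul_span] at h
  refine Submodule.span_mono ?_ h
  rintro _ ⟨_, ⟨w, hw, rfl⟩, _, ⟨w', hw', rfl⟩, rfl⟩
  refine ⟨w + w', ?_, ?_⟩
  · rw [below_add]
    exact hw.add hw'
  · rw [below_add, expFactor_add r hw hw', ← one_mul (1 : ℤ), ← MvPolynomial.monomial_mul]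
    simp only [one_mul]
    ring

theorem formalKer_shift {m : YMon n} {w : Fin n × ℤ →₀ ℕ} {f : MvPolynomial (Fin n × ℤ) ℤ}
    (hf : f ∈ formalKer Q r i (below Q m w)) :
    MvPolynomial.monomial w 1 * f ∈ formalKer Q r i m := by
  rw [formalKer] at hf
  induction hf using Submodule.span_induction with
  | mem f hf =>
    obtain ⟨w', hw', rfl⟩ := hf
    rw [below_below] at hw' ⊢
    refine Submodule.subset_span ⟨w + w', hw', ?_⟩
    rw [← mul_assoc, MvPolynomial.monomial_mul, one_mul]
  | zero => rw [mul_zero]; exact zero_mem _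
  | add f g _ _ hf hg => rw [mul_add]; exact add_mem hf hg
  | smul c f _ hf => rw [mul_smul_comm]; exact Submodule.smul_mem _ c hf

theorem one_mem_formalKer : (1 : MvPolynomial (Fin n × ℤ) ℤ) ∈ formalKer Q r i 0 := by
  refine Submodule.subset_span ⟨0, ?_, ?_⟩
  · rw [below_zero]
    exact fun l => le_rfl
  · rw [below_zero, expFactor_eq_one r fun l => rfl, mul_one]
    rfl

/-- The coefficients of an element of a formal kernel, as a combination of `E_i`-expansions. -/
theorem formalKer_exists_coeff {m : YMon n} {f : MvPolynomial (Fin n × ℤ) ℤ}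
    (hf : f ∈ formalKer Q r i m) : ∃ c : (Fin n × ℤ →₀ ℕ) → ℤ, ∀ w, MvPolynomial.coeff w f =
      ∑ w' ∈ Finset.Iic w, c w' * eCoeff r i (below Q m w') (w - w') := by
  classical
  rw [formalKer] at hf
  induction hf using Submodule.span_induction with
  | mem f hf =>
    obtain ⟨w₀, h₀, rfl⟩ := hf
    refine ⟨fun w' => if w' = w₀ then 1 else 0, fun w => ?_⟩
    simp only [ite_mul, one_mul, zero_mul, Finset.sum_ite_eq', Finset.mem_Iic]
    rw [MvPolynomial.coeff_monomial_mul', one_mul, eCoeff_eq, if_pos h₀]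
  | zero => exact ⟨0, by simp⟩
  | add f g _ _ hf hg =>
    obtain ⟨c, hc⟩ := hf
    obtain ⟨d, hd⟩ := hg
    refine ⟨c + d, fun w => ?_⟩
    rw [MvPolynomial.coeff_add, hc, hd, ← Finset.sum_add_distrib]
    exact Finset.sum_congr rfl fun w' _ => (add_mul _ _ _).symm
  | smul a f _ hf =>
    obtain ⟨c, hc⟩ := hf
    refine ⟨a • c, fun w => ?_⟩
    rw [MvPolynomial.coeff_smul, hc, Finset.smul_sum]
    exact Finset.sum_congr rfl fun w' _ => (smul_mul_assoc _ _ _).symm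

/-- A polynomial in all the formal kernels, with constant term `1` and no other dominant monomial,
is the result of the classical algorithm. -/
theorem exists_isClassicalRun {m : YMon n} {f : MvPolynomial (Fin n × ℤ) ℤ}
    (hf : ∀ i, f ∈ formalKer Q r i m) (h0 : MvPolynomial.coeff 0 f = 1)
    (hdom : ∀ w, w ≠ 0 → Dominant (below Q m w) → MvPolynomial.coeff w f = 0) :
    ∃ σ, IsClassicalRun Q r m (fun w => MvPolynomial.coeff w f) σ := by
  classical
  choose c hc using fun i => formalKer_exists_coeff (hf i)
  -- `c i w` is the multiplicity `s - s_i` with which the `E_i`-expansion at `w` enters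
  refine ⟨fun i w => MvPolynomial.coeff w f - if IDominant i (below Q m w) then c i w else 0,
    h0, fun i w => ?_, fun w _ i hi => ?_, hdom⟩
  · have h1 : Finset.Ico 0 w = Finset.Iio w := by
      ext w'
      simp
    have h2 : ∀ w', (if IDominant i (below Q m w') then c i w' else 0) *
        eCoeff r i (below Q m w') (w - w') = c i w' * eCoeff r i (below Q m w') (w - w') := by
      intro w'
      by_cases h : IDominant i (below Q m w')
      · rw [if_pos h]
      · rw [eCoeff_eq, if_neg h, if_neg h]
        simp
    simp only [sub_sub_cancel, h2]
    rw [hc i w, h1, ← Finset.Iio_insert, Finset.sum_insert (by simp), eCoeff_eq, tsub_self,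
      coeff_zero_expFactor]
    split <;> simp
  · simp [hi]

/-! ### Comparison with the classical screening operators -/

theorem clScreenMon_add (i : Fin n) (m m' : YMon n) : clScreenMon i (m + m') =
    (AddMonoidAlgebra.single m 1 : Y0 n) • clScreenMon i m' +
      (AddMonoidAlgebra.single m' 1 : Y0 n) • clScreenMon i m := by
  refine Finsupp.ext fun l => ?_
  simp only [clScreenMon_apply, Finsupp.add_apply, Finsupp.smul_apply, smul_eq_mul,
    AddMonoidAlgebra.single_mul_single, one_mul]
  rw [add_comm m' m, ← AddMonoidAlgebra.single_add, add_comm (m' _)]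

theorem clScreen_single (m : YMon n) (c : ℤ) :
    clScreen Q r i (AddMonoidAlgebra.single m c) = c • (clRel Q r i).mkQ (clScreenMon i m) := by
  rw [clScreen_apply, AddMonoidAlgebra.coeff_single, Finsupp.sum_single_index (by simp),
    map_zsmul]

/-- The screening operator `S_i` is a derivation. -/
theorem clScreen_mul (F G : Y0 n) :
    clScreen Q r i (F * G) = F • clScreen Q r i G + G • clScreen Q r i F := by
  induction F using AddMonoidAlgebra.induction_linear with
  | zero => simp
  | add F F' hF hF' =>
    rw [add_mul, map_add, hF, hF', map_add, add_smul, smul_add]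
    abel
  | single m c =>
    induction G using AddMonoidAlgebra.induction_linear with
    | zero => simp
    | add G G' hG hG' =>
      rw [mul_add, map_add, hG, hG', map_add, add_smul, smul_add]
      abel
    | single m' c' =>
      have h : ∀ (p : YMon n) (d : ℤ), (AddMonoidAlgebra.single p d : Y0 n) =
          d • AddMonoidAlgebra.single p 1 := fun p d => by simp [AddMonoidAlgebra.smul_single]
      rw [AddMonoidAlgebra.single_mul_single, clScreen_single, clScreen_single, clScreen_single,
        clScreenMon_add, map_add, map_smul, map_smul, h m c, h m' c', smul_assoc, smul_assoc,
        smul_comm _ c', smul_comm _ c, smul_add, smul_smul c, smul_smul c', mul_comm c' c]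

variable (Q r i) in
/-- The kernel of `S_i` as a subring of `𝒴`. -/
def clKerSubring : Subring (Y0 n) where
  carrier := {F | clScreen Q r i F = 0}
  mul_mem' := fun {F G} hF hG => by
    rw [Set.mem_ofPred_eq] at *
    rw [clScreen_mul, hF, hG, smul_zero, smul_zero, add_zero]
  one_mem' := by
    have h : (1 : Y0 n) = AddMonoidAlgebra.single 0 1 := rfl
    rw [Set.mem_ofPred_eq, h, clScreen_single]
    have h' : clScreenMon i (0 : YMon n) = 0 := by rw [clScreenMon, Finsupp.sum_zero_index]
    rw [h', map_zero, smul_zero]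
  add_mem' := fun {F G} hF hG => by
    rw [Set.mem_ofPred_eq] at *
    rw [map_add, hF, hG, add_zero]
  zero_mem' := map_zero _
  neg_mem' := fun {F} hF => by
    rw [Set.mem_ofPred_eq] at *
    rw [map_neg, hF, neg_zero]

theorem mem_clKerSubring {F : Y0 n} : F ∈ clKerSubring Q r i ↔ clScreen Q r i F = 0 := Iff.rfl

/-- The element `Y_{i,l} (1 + A_{i,l+r_i}⁻¹)` is killed by `S_i`. -/
theorem fundamental_mem_clKerSubring (hQ : Q i i = T (r i : ℤ) + T (-(r i : ℤ))) (hr : 0 < r i)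
    (l : ℤ) : (AddMonoidAlgebra.single (Finsupp.single (i, l) 1) 1 : Y0 n) *
      (1 + AddMonoidAlgebra.single (-aVec Q (i, l + r i)) 1) ∈ clKerSubring Q r i := by
  have h1 : (1 : Y0 n) = AddMonoidAlgebra.single 0 1 := rfl
  rw [mem_clKerSubring, h1, mul_add, AddMonoidAlgebra.single_mul_single,
    AddMonoidAlgebra.single_mul_single, map_add, clScreen_single, clScreen_single, mul_one,
    one_smul, one_smul, ← map_add, Submodule.mkQ_apply, Submodule.Quotient.mk_eq_zero, clRel]
  have h := Submodule.smul_mem (Submodule.span (Y0 n) (Set.range fun l : ℤ =>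
    (Finsupp.single (l - r i) (1 : Y0 n) -
      Finsupp.single (l + r i) (AddMonoidAlgebra.single (-aVec Q (i, l)) (1 : ℤ) : Y0 n))))
    (AddMonoidAlgebra.single (Finsupp.single (i, l) 1) 1 : Y0 n)
    (Submodule.subset_span (Set.mem_range_self (l + r i)))
  convert! h using 1
  refine Finsupp.ext fun k => ?_
  have hr' : (0 : ℤ) < r i := by exact_mod_cast hr
  simp only [Finsupp.add_apply, Finsupp.smul_apply, Finsupp.sub_apply, clScreenMon_apply,
    smul_eq_mul, Finsupp.single_apply, Finsupp.neg_apply, aVec_diag hQ, add_zero, Prod.mk.injEq,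
    true_and]
  by_cases hk : l = k
  · subst hk
    have e1 : ¬ l + (r i : ℤ) = l - r i := by omega
    have e2 : ¬ l + (r i : ℤ) + r i = l := by omega
    simp [e1, e2]
  · by_cases hk2 : l + (r i : ℤ) + r i = k
    · have e1 : l + (r i : ℤ) = k - r i := by omega
      have e2 : ¬ k - (r i : ℤ) = k + r i := by omega
      have e3 : ¬ k - (r i : ℤ) - r i = k := by omega
      simp [hk, e1, e2, e3, AddMonoidAlgebra.single_mul_single, ← AddMonoidAlgebra.single_neg]
    · have e1 : ¬ l + (r i : ℤ) = k - r i := by omega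
      simp [hk, hk2, e1]

/-- The substitution of the monomials `A_{j,k}⁻¹` of `𝒴` for the formal variables. -/
def evalA (Q : Matrix (Fin n) (Fin n) ℤ[T;T⁻¹]) : MvPolynomial (Fin n × ℤ) ℤ →+* Y0 n :=
  MvPolynomial.eval₂Hom (Int.castRingHom _) fun p => AddMonoidAlgebra.single (-aVec Q p) 1

theorem evalA_X (p : Fin n × ℤ) :
    evalA Q (MvPolynomial.X p) = AddMonoidAlgebra.single (-aVec Q p) 1 :=
  MvPolynomial.eval₂Hom_X' _ _ _

theorem evalA_monomial (w : Fin n × ℤ →₀ ℕ) (c : ℤ) :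
    evalA Q (MvPolynomial.monomial w c) = AddMonoidAlgebra.single (-aSum Q w) c := by
  have h : ∀ w : Fin n × ℤ →₀ ℕ, (w.prod fun p k =>
      (AddMonoidAlgebra.single (-aVec Q p) 1 : Y0 n) ^ k) =
      AddMonoidAlgebra.single (-aSum Q w) 1 := fun w => by
    induction w using Finsupp.induction_linear with
    | zero => simp [aSum_zero, AddMonoidAlgebra.one_def]
    | add v w hv hw =>
      rw [Finsupp.prod_add_index' (by simp) (fun _ _ _ => pow_add _ _ _), hv, hw, aSum_add,
        AddMonoidAlgebra.single_mul_single, neg_add, one_mul]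
    | single p k =>
      rw [Finsupp.prod_single_index (by simp), aSum_single, AddMonoidAlgebra.single_pow,
        one_pow, smul_neg]
  rw [evalA, MvPolynomial.eval₂Hom_monomial, h]
  simp [← zsmul_eq_mul, AddMonoidAlgebra.smul_single]

theorem single_mul_evalA_expFactor_mem (hQ : Q i i = T (r i : ℤ) + T (-(r i : ℤ))) (hr : 0 < r i)
    {u : YMon n} (hu : IDominant i u) :
    AddMonoidAlgebra.single u 1 * evalA Q (expFactor r i u) ∈ clKerSubring Q r i := by
  have h1 : (AddMonoidAlgebra.single u 1 : Y0 n) =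
      ∏ p ∈ u.support, AddMonoidAlgebra.single (Finsupp.single p (u p)) 1 := by
    rw [AddMonoidAlgebra.prod_single, Finset.prod_const_one]
    exact congrArg (fun v => (AddMonoidAlgebra.single v 1 : Y0 n)) (Finsupp.sum_single u).symm
  rw [h1, expFactor, Finsupp.prod, map_prod, ← Finset.prod_mul_distrib]
  refine Subring.prod_mem _ fun p _ => ?_
  obtain ⟨j, l⟩ := p
  by_cases hj : j = i
  · subst hj
    obtain ⟨k, hk⟩ := Int.eq_ofNat_of_zero_le (hu l)
    rw [if_pos rfl, hk, map_pow, map_add, map_one, evalA_X, Int.toNat_natCast]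
    have h2 : (AddMonoidAlgebra.single (Finsupp.single (j, l) (k : ℤ)) 1 : Y0 n) =
        AddMonoidAlgebra.single (Finsupp.single (j, l) 1) 1 ^ k := by
      rw [AddMonoidAlgebra.single_pow, one_pow, Finsupp.smul_single, nsmul_one]
    rw [h2, ← mul_pow]
    exact pow_mem (fundamental_mem_clKerSubring hQ hr l) k
  · rw [if_neg hj, map_one, mul_one, mem_clKerSubring, clScreen_single, one_smul, clScreenMon,
      Finsupp.sum_single_index (by simp), if_neg hj, map_zero]

/-- Substitution of the `A_{j,k}⁻¹` maps the formal kernel to `Ker(S_i)`. -/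
theorem single_mul_evalA_mem (hQ : Q i i = T (r i : ℤ) + T (-(r i : ℤ))) (hr : 0 < r i)
    {m : YMon n} {f : MvPolynomial (Fin n × ℤ) ℤ} (hf : f ∈ formalKer Q r i m) :
    AddMonoidAlgebra.single m 1 * evalA Q f ∈ clKerSubring Q r i := by
  rw [formalKer] at hf
  induction hf using Submodule.span_induction with
  | mem f hf =>
    obtain ⟨w, hw, rfl⟩ := hf
    rw [map_mul, evalA_monomial, ← mul_assoc, AddMonoidAlgebra.single_mul_single, one_mul,
      ← sub_eq_add_neg]
    exact single_mul_evalA_expFactor_mem hQ hr hw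
  | zero => rw [map_zero, mul_zero]; exact zero_mem _
  | add f g _ _ hf hg => rw [map_add, mul_add]; exact add_mem hf hg
  | smul c f _ hf => rw [map_zsmul, mul_smul_comm]; exact zsmul_mem hf c

/-- An element of all the formal kernels with leading term `m` and no other dominant monomial shows
that the classical algorithm beginning with `m` ends with an element of `𝔎`. -/
theorem classicalFMem_of_formalKer (hQ : ∀ i, Q i i = T (r i : ℤ) + T (-(r i : ℤ)))
    (hr : ∀ i, 0 < r i) {m : YMon n} {f : MvPolynomial (Fin n × ℤ) ℤ}
    (hf : ∀ i, f ∈ formalKer Q r i m) (h0 : MvPolynomial.coeff 0 f = 1)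
    (hdom : ∀ w, w ≠ 0 → Dominant (below Q m w) → MvPolynomial.coeff w f = 0) :
    ClassicalFMem Q r m := by
  obtain ⟨σ, hσ⟩ := exists_isClassicalRun hf h0 hdom
  refine ⟨AddMonoidAlgebra.coeff f, σ, hσ, ?_⟩
  have h : ((AddMonoidAlgebra.coeff f).sum fun w c =>
      (AddMonoidAlgebra.single (below Q m w) c : Y0 n)) =
      AddMonoidAlgebra.single m 1 * evalA Q f := by
    conv_rhs => rw [MvPolynomial.as_sum f, map_sum, Finset.mul_sum]
    refine Finset.sum_congr rfl fun w _ => ?_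
    rw [evalA_monomial, AddMonoidAlgebra.single_mul_single, one_mul, ← sub_eq_add_neg]
    rfl
  rw [h]
  exact (AddSubgroup.mem_iInf).mpr fun i => single_mul_evalA_mem (hQ i) (hr i) (hf i)

end

/-! ### Existence of the elements `F(m)` -/

section

variable {Q : Matrix (Fin n) (Fin n) ℤ[T;T⁻¹]} {r : Fin n → ℕ}

variable (Q r) in
/-- The formal kernels of all the screening operators contain some `m (1 + ⋯)`, the dots standing
for lower terms. -/
def HasTop (m : YMon n) : Prop :=
  ∃ f, (∀ i, f ∈ formalKer Q r i m) ∧ MvPolynomial.coeff 0 f = 1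

theorem HasTop.add {m m' : YMon n} (h : HasTop Q r m) (h' : HasTop Q r m') :
    HasTop Q r (m + m') := by
  obtain ⟨f, hf, hf0⟩ := h
  obtain ⟨g, hg, hg0⟩ := h'
  refine ⟨f * g, fun i => formalKer_mul (hf i) (hg i), ?_⟩
  rw [← MvPolynomial.constantCoeff_eq] at *
  rw [map_mul, hf0, hg0, one_mul]

theorem hasTop_of_dominant (h : ∀ p, HasTop Q r (Finsupp.single p 1)) {m : YMon n}
    (hm : Dominant m) : HasTop Q r m := by
  have h0 : HasTop Q r 0 := ⟨1, fun i => one_mem_formalKer, by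
    rw [← MvPolynomial.constantCoeff_eq, map_one]⟩
  have key : ∀ y : Fin n × ℤ →₀ ℕ, HasTop Q r (y.mapRange (fun c : ℕ => (c : ℤ)) rfl) := by
    intro y
    induction y using Finsupp.induction_linear with
    | zero => rw [Finsupp.mapRange_zero]; exact h0
    | add y z hy hz =>
      rw [Finsupp.mapRange_add (by simp)]
      exact hy.add hz
    | single p c =>
      rw [Finsupp.mapRange_single]
      induction c with
      | zero => simpa using h0
      | succ c ih =>
        rw [Nat.cast_succ, Finsupp.single_add]
        exact ih.add (h p)
  have hm' : m = (m.mapRange Int.toNat rfl).mapRange (fun c : ℕ => (c : ℤ)) rfl := by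
    ext p
    simpa using hm p
  rw [hm']
  exact key _

/-- The products of the fundamental elements can be corrected, downwards along the height `ht`, to
elements with a single dominant monomial. -/
theorem exists_unique_dominant (h : ∀ p, HasTop Q r (Finsupp.single p 1)) (ht : YMon n →+ ℤ)
    (hnonneg : ∀ m, Dominant m → 0 ≤ ht m) (hpos : ∀ p, 0 < ht (aVec Q p)) {m : YMon n}
    (hm : Dominant m) : ∃ f, (∀ i, f ∈ formalKer Q r i m) ∧ MvPolynomial.coeff 0 f = 1 ∧
      ∀ w, w ≠ 0 → Dominant (below Q m w) → MvPolynomial.coeff w f = 0 := by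
  classical
  have hsum : ∀ w : Fin n × ℤ →₀ ℕ, w ≠ 0 → 0 < ht (aSum Q w) := fun w hw => by
    rw [aSum, Finsupp.sum, map_sum]
    refine Finset.sum_pos (fun p hp => ?_) (Finsupp.support_nonempty_iff.mpr hw)
    rw [map_nsmul]
    exact nsmul_pos (hpos p) (Finsupp.mem_support_iff.mp hp)
  induction hN : (ht m).toNat using Nat.strong_induction_on generalizing m with
  | _ N ih =>
    obtain ⟨f₀, hf₀, hf₀0⟩ := hasTop_of_dominant h hm
    have hex : ∀ w : {w : Fin n × ℤ →₀ ℕ // w ≠ 0 ∧ Dominant (below Q m w)},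
        ∃ f, (∀ i, f ∈ formalKer Q r i (below Q m w)) ∧ MvPolynomial.coeff 0 f = 1 ∧
          ∀ w', w' ≠ 0 → Dominant (below Q (below Q m w) w') → MvPolynomial.coeff w' f = 0 := by
      rintro ⟨w, hw, hd⟩
      refine ih _ ?_ hd rfl
      have h1 := hsum w hw
      have h2 := hnonneg _ hd
      simp only [below, map_sub] at h2 ⊢
      omega
    choose g hg hg0 hg' using hex
    -- the superfluous dominant terms of `f₀`
    let S := f₀.support.subtype fun w => w ≠ 0 ∧ Dominant (below Q m w)
    have hcoeff : ∀ w' : Fin n × ℤ →₀ ℕ, MvPolynomial.coeff w' (f₀ - ∑ w ∈ S,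
        MvPolynomial.coeff (w : Fin n × ℤ →₀ ℕ) f₀ • (MvPolynomial.monomial w.1 1 * g w)) =
        MvPolynomial.coeff w' f₀ - ∑ w ∈ S, MvPolynomial.coeff (w : Fin n × ℤ →₀ ℕ) f₀ *
          if w.1 ≤ w' then MvPolynomial.coeff (w' - w.1) (g w) else 0 := fun w' => by
      rw [MvPolynomial.coeff_sub, MvPolynomial.coeff_sum]
      simp only [MvPolynomial.coeff_smul, MvPolynomial.coeff_monomial_mul', smul_eq_mul, one_mul]
    refine ⟨f₀ - ∑ w ∈ S, MvPolynomial.coeff (w : Fin n × ℤ →₀ ℕ) f₀ •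
        (MvPolynomial.monomial w.1 1 * g w),
      fun i => sub_mem (hf₀ i) (Submodule.sum_mem _ fun w _ =>
        Submodule.smul_mem _ _ (formalKer_shift (hg w i))), ?_, fun w' hw' hd' => ?_⟩
    · rw [hcoeff, hf₀0, Finset.sum_eq_zero, sub_zero]
      rintro ⟨w, hw, hd⟩ _
      rw [if_neg (by simpa using hw), mul_zero]
    · rw [hcoeff, Finset.sum_eq_single ⟨w', hw', hd'⟩]
      · simp [hg0]
      · rintro ⟨w, hw, hd⟩ _ hne
        have hne' : w' ≠ w := by rintro rfl; exact hne rfl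
        by_cases hle : w ≤ w'
        · rw [if_pos hle, hg', mul_zero]
          · exact fun h => hne' (le_antisymm (tsub_eq_zero_iff_le.mp h) hle)
          · rw [below_below, add_tsub_cancel_of_le hle]
            exact hd'
        · rw [if_neg hle, mul_zero]
      · intro hn
        have : MvPolynomial.coeff w' f₀ = 0 := by
          rw [Finset.mem_subtype] at hn
          exact MvPolynomial.notMem_support_iff.mp hn
        rw [this, zero_mul]

end

end

/-! ### Fundamental elements in rank two -/

section

variable {Q : Matrix (Fin 2) (Fin 2) ℤ[T;T⁻¹]} {r : Fin 2 → ℕ} {m : YMon 2}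

variable (Q m) in
/-- `g` is a monomial in the variables `A_{j,k}⁻¹`, and `u` is the Laurent monomial `m g`. -/
def IsTerm (g : MvPolynomial (Fin 2 × ℤ) ℤ) (u : YMon 2) : Prop :=
  ∃ w, g = MvPolynomial.monomial w 1 ∧ u = below Q m w

theorem isTerm_one : IsTerm Q m 1 m := ⟨0, rfl, (below_zero Q m).symm⟩

theorem IsTerm.mul_X {g : MvPolynomial (Fin 2 × ℤ) ℤ} {u u' : YMon 2} (h : IsTerm Q m g u)
    (p : Fin 2 × ℤ) (hu : u = u' + aVec Q p) : IsTerm Q m (g * MvPolynomial.X p) u' := by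
  obtain ⟨w, rfl, hw⟩ := h
  refine ⟨w + Finsupp.single p 1, ?_, ?_⟩
  · rw [MvPolynomial.X, MvPolynomial.monomial_mul, one_mul]
  · rw [← below_below, ← hw, hu, below, aSum_single, one_smul, add_sub_cancel_right]

variable {c : Fin 2} {g : MvPolynomial (Fin 2 × ℤ) ℤ} {u : YMon 2}

/-- If `m g` has the exponents `∏_{l ∈ L} Y_{c,l}` in colour `c`, then its `E_c`-expansion is
`g ∏_{l ∈ L} (1 + A_{c,l+r_c}⁻¹)`. -/
theorem IsTerm.mem_of_list (h : IsTerm Q m g u) (L : List ℤ) {v : YMon 2}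
    (hv : ∀ l, v (c, l) = 0) (hu : u = v + (L.map fun l => Finsupp.single (c, l) (1 : ℤ)).sum) :
    g * (L.map fun l => 1 + MvPolynomial.X (c, l + (r c : ℤ))).prod ∈ formalKer Q r c m := by
  have hL : ∀ L : List ℤ, IDominant c (L.map fun l => Finsupp.single (c, l) (1 : ℤ)).sum ∧
      expFactor r c (L.map fun l => Finsupp.single (c, l) (1 : ℤ)).sum =
        (L.map fun l => 1 + MvPolynomial.X (c, l + (r c : ℤ))).prod := fun L => by
    induction L with
    | nil => exact ⟨fun l => le_rfl, expFactor_eq_one r fun l => rfl⟩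
    | cons l L ih =>
      have h1 : IDominant c (Finsupp.single (c, l) (1 : ℤ)) := fun l' => by
        rw [Finsupp.single_apply]
        split <;> simp
      rw [List.map_cons, List.sum_cons, List.map_cons, List.prod_cons]
      refine ⟨h1.add ih.1, ?_⟩
      rw [expFactor_add r h1 ih.1, expFactor_single_self, ih.2]
  have hv' : IDominant c v := fun l => (hv l).ge
  obtain ⟨w, rfl, hw⟩ := h
  rw [← (hL L).2, ← one_mul (expFactor r c _), ← expFactor_eq_one r hv,
    ← expFactor_add r hv' (hL L).1, ← hu, hw]
  exact Submodule.subset_span ⟨w, hw ▸ hu ▸ hv'.add (hL L).1, rfl⟩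

end

/-- The shape of the deformed Cartan matrix in the finite types `A_2`, `B_2`, `G_2` (`q = 1, 2, 3`):
the node `i` is long, the node `j` is short, `C_{ij} = -1`, `C_{ji} = -q`, `r_i = q k` and
`r_j = k`. -/
structure IsFiniteShape (Q : Matrix (Fin 2) (Fin 2) ℤ[T;T⁻¹]) (r : Fin 2 → ℕ) (i j : Fin 2)
    (q k : ℕ) : Prop where
  ne : i ≠ j
  pos : 0 < k
  long : r i = q * k
  short : r j = k
  diag : ∀ c, Q c c = T (r c : ℤ) + T (-(r c : ℤ))
  long_short : Q i j = -1
  short_long : Q j i = quantumInt k (-(q : ℤ))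

/-- The variable `Y_{c,p+nk}`. All monomials in the explicit elements have second indices in
`p + k ℤ`, where `k` is the `r` of the short node. -/
def yVar (p : ℤ) (k : ℕ) (c : Fin 2) (n : ℤ) : YMon 2 := Finsupp.single (c, p + n * k) 1

/-- The formal variable standing for `A_{c,p+nk}⁻¹`. -/
def aVar (p : ℤ) (k : ℕ) (c : Fin 2) (n : ℤ) : MvPolynomial (Fin 2 × ℤ) ℤ :=
  MvPolynomial.X (c, p + n * k)

theorem yVar_apply_of_ne {p : ℤ} {k : ℕ} {c d : Fin 2} (h : c ≠ d) (n l : ℤ) :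
    yVar p k c n (d, l) = 0 := by
  rw [yVar, Finsupp.single_apply, if_neg fun e => h (congrArg Prod.fst e)]

@[simp]
theorem constantCoeff_aVar (p : ℤ) (k : ℕ) (c : Fin 2) (n : ℤ) :
    MvPolynomial.constantCoeff (aVar p k c n) = 0 :=
  MvPolynomial.constantCoeff_X _ _

namespace IsFiniteShape

variable {Q : Matrix (Fin 2) (Fin 2) ℤ[T;T⁻¹]} {r : Fin 2 → ℕ} {i j : Fin 2} {q k : ℕ}

theorem eq_or_eq (h : IsFiniteShape Q r i j q k) (c : Fin 2) : c = i ∨ c = j := by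
  have := h.ne
  omega

theorem aVec_short (h : IsFiniteShape Q r i j q k) (p n : ℤ) :
    aVec Q (j, p + n * k) = yVar p k j (n - 1) + yVar p k j (n + 1) - yVar p k i n := by
  ext ⟨c, l⟩
  have hk : (0 : ℤ) < k := by exact_mod_cast h.pos
  have e1 : p + (n - 1) * k = p + n * k - k := by ring
  have e2 : p + (n + 1) * k = p + n * k + k := by ring
  simp only [yVar, e1, e2, Finsupp.add_apply, Finsupp.sub_apply, Finsupp.single_apply,
    Prod.mk.injEq]
  generalize p + n * (k : ℤ) = x
  rcases h.eq_or_eq c with rfl | rfl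
  · rw [aVec_apply, h.long_short]
    have h1 : (-1 : ℤ[T;T⁻¹]) = -T 0 := rfl
    simp only [h1, AddMonoidAlgebra.coeff_neg, Finsupp.neg_apply, LaurentPolynomial.T_apply,
      h.ne.symm, false_and, if_false, true_and]
    split_ifs <;> omega
  · rw [aVec_diag (h.diag _), h.short]
    simp only [h.ne, false_and, if_false, true_and]
    split_ifs <;> omega

theorem aVec_long_one (h : IsFiniteShape Q r i j 1 k) (p n : ℤ) :
    aVec Q (i, p + n * k) = yVar p k i (n - 1) + yVar p k i (n + 1) - yVar p k j n := by
  ext ⟨c, l⟩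
  have hk : (0 : ℤ) < k := by exact_mod_cast h.pos
  have e0 : p + (n - 1) * k = p + n * k - k := by ring
  have e1 : p + (n + 1) * k = p + n * k + k := by ring
  simp only [yVar, e0, e1, Finsupp.add_apply, Finsupp.sub_apply, Finsupp.single_apply,
    Prod.mk.injEq]
  generalize p + n * (k : ℤ) = x
  rcases h.eq_or_eq c with rfl | rfl
  · rw [aVec_diag (h.diag _), h.long]
    simp only [h.ne.symm, false_and, if_false, true_and]
    push_cast
    split_ifs <;> omega
  · rw [aVec_apply, h.short_long]
    simp only [Nat.cast_one, quantumInt_neg_one, ← LaurentPolynomial.T_zero,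
      AddMonoidAlgebra.coeff_neg, Finsupp.neg_apply,
      LaurentPolynomial.T_apply, h.ne, false_and, if_false, true_and]
    split_ifs <;> omega

theorem aVec_long_two (h : IsFiniteShape Q r i j 2 k) (p n : ℤ) :
    aVec Q (i, p + n * k) = yVar p k i (n - 2) + yVar p k i (n +
        2) - yVar p k j (n - 1) - yVar p k j (n + 1) := by
  ext ⟨c, l⟩
  have hk : (0 : ℤ) < k := by exact_mod_cast h.pos
  have e0 : p + (n - 2) * k = p + n * k - 2 * k := by ring
  have e1 : p + (n - 1) * k = p + n * k - k := by ring
  have e2 : p + (n + 1) * k = p + n * k + k := by ring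
  have e3 : p + (n + 2) * k = p + n * k + 2 * k := by ring
  simp only [yVar, e0, e1, e2, e3, Finsupp.add_apply, Finsupp.sub_apply, Finsupp.single_apply,
    Prod.mk.injEq]
  generalize p + n * (k : ℤ) = x
  rcases h.eq_or_eq c with rfl | rfl
  · rw [aVec_diag (h.diag _), h.long]
    simp only [h.ne.symm, false_and, if_false, true_and]
    push_cast
    split_ifs <;> omega
  · rw [aVec_apply, h.short_long]
    simp only [Nat.cast_ofNat, quantumInt_neg_two, AddMonoidAlgebra.coeff_neg,
      AddMonoidAlgebra.coeff_add, Finsupp.add_apply, Finsupp.neg_apply,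
      LaurentPolynomial.T_apply, h.ne, false_and, if_false, true_and]
    split_ifs <;> omega

theorem aVec_long_three (h : IsFiniteShape Q r i j 3 k) (p n : ℤ) :
    aVec Q (i, p + n * k) = yVar p k i (n - 3) + yVar p k i (n +
        3) - yVar p k j (n - 2) - yVar p k j n - yVar p k j (n + 2) := by
  ext ⟨c, l⟩
  have hk : (0 : ℤ) < k := by exact_mod_cast h.pos
  have e0 : p + (n - 3) * k = p + n * k - 3 * k := by ring
  have e1 : p + (n - 2) * k = p + n * k - 2 * k := by ring
  have e2 : p + (n + 2) * k = p + n * k + 2 * k := by ring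
  have e3 : p + (n + 3) * k = p + n * k + 3 * k := by ring
  simp only [yVar, e0, e1, e2, e3, Finsupp.add_apply, Finsupp.sub_apply, Finsupp.single_apply,
    Prod.mk.injEq]
  generalize p + n * (k : ℤ) = x
  rcases h.eq_or_eq c with rfl | rfl
  · rw [aVec_diag (h.diag _), h.long]
    simp only [h.ne.symm, false_and, if_false, true_and]
    push_cast
    split_ifs <;> omega
  · rw [aVec_apply, h.short_long]
    simp only [Nat.cast_ofNat, quantumInt_neg_three, ← LaurentPolynomial.T_zero,
        AddMonoidAlgebra.coeff_neg,
      AddMonoidAlgebra.coeff_add, Finsupp.add_apply, Finsupp.neg_apply,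
      LaurentPolynomial.T_apply, h.ne, false_and, if_false, true_and]
    split_ifs <;> omega

theorem long_cast (h : IsFiniteShape Q r i j q k) : (r i : ℤ) = q * k := by
  rw [h.long, Nat.cast_mul]

theorem short_cast (h : IsFiniteShape Q r i j q k) : (r j : ℤ) = (1 : ℕ) * k := by
  rw [h.short, Nat.cast_one, one_mul]

variable {p : ℤ} {m u u' : YMon 2} {g : MvPolynomial (Fin 2 × ℤ) ℤ}

theorem mul_short (h : IsFiniteShape Q r i j q k) (ht : IsTerm Q m g u) (n : ℤ)
    (hu : u = u' + (yVar p k j (n - 1) + yVar p k j (n + 1) - yVar p k i n)) :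
    IsTerm Q m (g * aVar p k j n) u' :=
  ht.mul_X _ (by rw [h.aVec_short, hu])

theorem mul_long_one (h : IsFiniteShape Q r i j 1 k) (ht : IsTerm Q m g u) (n : ℤ)
    (hu : u = u' + (yVar p k i (n - 1) + yVar p k i (n + 1) - yVar p k j n)) :
    IsTerm Q m (g * aVar p k i n) u' :=
  ht.mul_X _ (by rw [h.aVec_long_one, hu])

theorem mul_long_two (h : IsFiniteShape Q r i j 2 k) (ht : IsTerm Q m g u) (n : ℤ)
    (hu : u = u' + (yVar p k i (n - 2) + yVar p k i (n +
        2) - yVar p k j (n - 1) - yVar p k j (n + 1))) :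
    IsTerm Q m (g * aVar p k i n) u' :=
  ht.mul_X _ (by rw [h.aVec_long_two, hu])

theorem mul_long_three (h : IsFiniteShape Q r i j 3 k) (ht : IsTerm Q m g u) (n : ℤ)
    (hu : u = u' + (yVar p k i (n - 3) + yVar p k i (n +
        3) - yVar p k j (n - 2) - yVar p k j n - yVar p k j (n + 2))) :
    IsTerm Q m (g * aVar p k i n) u' :=
  ht.mul_X _ (by rw [h.aVec_long_three, hu])

end IsFiniteShape

section

variable {Q : Matrix (Fin 2) (Fin 2) ℤ[T;T⁻¹]} {r : Fin 2 → ℕ} {m : YMon 2} {c : Fin 2}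
  {g : MvPolynomial (Fin 2 × ℤ) ℤ} {u : YMon 2} {p : ℤ} {k ρ : ℕ}

theorem IsTerm.mem₀ (h : IsTerm Q m g u) (hu : ∀ l, u (c, l) = 0) : g ∈ formalKer Q r c m := by
  simpa using h.mem_of_list (r := r) [] hu (by simp)

theorem IsTerm.mem₁ (h : IsTerm Q m g u) (hc : (r c : ℤ) = ρ * k) (v : YMon 2) (a : ℤ)
    (hv : ∀ l, v (c, l) = 0) (hu : u = v + yVar p k c a) :
    g * (1 + aVar p k c (a + ρ)) ∈ formalKer Q r c m := by
  have := h.mem_of_list (r := r) [p + a * k] hv (by simpa [yVar] using hu)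
  simpa [aVar, add_mul, hc, add_assoc] using this

theorem IsTerm.mem₂ (h : IsTerm Q m g u) (hc : (r c : ℤ) = ρ * k) (v : YMon 2) (a b : ℤ)
    (hv : ∀ l, v (c, l) = 0) (hu : u = v + (yVar p k c a + yVar p k c b)) :
    g * ((1 + aVar p k c (a + ρ)) * (1 + aVar p k c (b + ρ))) ∈ formalKer Q r c m := by
  have := h.mem_of_list (r := r) [p + a * k, p + b * k] hv (by simpa [yVar] using hu)
  simpa [aVar, add_mul, hc, add_assoc] using this

theorem IsTerm.mem₃ (h : IsTerm Q m g u) (hc : (r c : ℤ) = ρ * k) (v : YMon 2) (a b d : ℤ)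
    (hv : ∀ l, v (c, l) = 0) (hu : u = v + (yVar p k c a + (yVar p k c b + yVar p k c d))) :
    g * ((1 + aVar p k c (a + ρ)) * ((1 + aVar p k c (b + ρ)) * (1 + aVar p k c (d + ρ)))) ∈
      formalKer Q r c m := by
  have := h.mem_of_list (r := r) [p + a * k, p + b * k, p + d * k] hv (by simpa [yVar] using hu)
  simpa [aVar, add_mul, hc, add_assoc] using this

end

section

variable {Q : Matrix (Fin 2) (Fin 2) ℤ[T;T⁻¹]} {r : Fin 2 → ℕ} {i j : Fin 2} {k : ℕ}

/-! In each of the following proofs the `tₙ` are monomials of the element exhibited, or monomials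
that cancel in a colour, together with their exponents, and for each colour the `sₙ` are the
expansions of those `tₙ` into which the element decomposes. -/

theorem mem_of_mem_of_eq {m : YMon 2} {c d : Fin 2} {f g : MvPolynomial (Fin 2 × ℤ) ℤ} (hc : c = d)
    (h : g ∈ formalKer Q r d m) (e : f = g) : f ∈ formalKer Q r c m := by
  subst hc e
  exact h

/-- Type `A_2`: an element with leading term `Y_{i,p}`. -/
theorem hasTop_long_one (h : IsFiniteShape Q r i j 1 k) (p : ℤ) :
    HasTop Q r (yVar p k i 0) := by
  have t0 : IsTerm Q (yVar p k i 0) 1 (yVar p k i 0) := isTerm_one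
  have t1 := h.mul_long_one t0 1 (u' := yVar p k j 1 - yVar p k i 2)
    (by norm_num; abel)
  have t2 := h.mul_short t1 2 (u' := -yVar p k j 3)
    (by norm_num; abel)
  refine ⟨1 + aVar p k i 1 + aVar p k i 1 * aVar p k j 2, fun c => ?_, ?_⟩
  · rcases h.eq_or_eq c with hc | hc
    · have s0 := t0.mem₁ h.long_cast 0 0 (by simp) (by abel)
      have s1 := t2.mem₀ (r := r) (c := i) (by simp [yVar_apply_of_ne h.ne.symm])
      refine mem_of_mem_of_eq hc (add_mem s0 s1) ?_
      simp only [Nat.cast_one, Int.reduceAdd]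
      ring
    · have s0 := t0.mem₀ (r := r) (c := j) (by simp [yVar_apply_of_ne h.ne])
      have s1 := t1.mem₁ h.short_cast (-yVar p k i 2) 1
        (by simp [yVar_apply_of_ne h.ne]) (by abel)
      refine mem_of_mem_of_eq hc (add_mem s0 s1) ?_
      simp only [Nat.cast_one, Int.reduceAdd]
      ring
  · simp [← MvPolynomial.constantCoeff_eq]

/-- Type `B_2`: an element with leading term `Y_{i,p}`, `i` the long node. -/
theorem hasTop_long_two (h : IsFiniteShape Q r i j 2 k) (p : ℤ) :
    HasTop Q r (yVar p k i 0) := by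
  have t0 : IsTerm Q (yVar p k i 0) 1 (yVar p k i 0) := isTerm_one
  have t1 := h.mul_long_two t0 2 (u' := yVar p k j 1 + yVar p k j 3 - yVar p k i 4)
    (by norm_num; abel)
  have t2 := h.mul_short t1 2 (u' := yVar p k i 2 - yVar p k i 4)
    (by norm_num; abel)
  have t3 := h.mul_short t1 4 (u' := yVar p k j 1 - yVar p k j 5)
    (by norm_num; abel)
  have t4 := h.mul_short t3 2 (u' := yVar p k i 2 - yVar p k j 3 - yVar p k j 5)
    (by norm_num; abel)
  have t5 := h.mul_long_two t4 4 (u' := -yVar p k i 6)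
    (by norm_num; abel)
  refine ⟨1 + aVar p k i 2 + aVar p k i 2 * aVar p k j 4 +
      aVar p k i 2 * aVar p k j 4 * aVar p k j 2 +
      aVar p k i 2 * aVar p k j 4 * aVar p k j 2 * aVar p k i 4, fun c => ?_, ?_⟩
  · rcases h.eq_or_eq c with hc | hc
    · have s0 := t0.mem₁ h.long_cast 0 0 (by simp) (by abel)
      have s1 := t3.mem₀ (r := r) (c := i) (by simp [yVar_apply_of_ne h.ne.symm])
      have s2 := t4.mem₁ h.long_cast (-yVar p k j 3 - yVar p k j 5) 2
        (by simp [yVar_apply_of_ne h.ne.symm]) (by abel)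
      refine mem_of_mem_of_eq hc (add_mem (add_mem s0 s1) s2) ?_
      simp only [Nat.cast_ofNat, Int.reduceAdd]
      ring
    · have s0 := t0.mem₀ (r := r) (c := j) (by simp [yVar_apply_of_ne h.ne])
      have s1 := t1.mem₂ h.short_cast (-yVar p k i 4) 1 3
        (by simp [yVar_apply_of_ne h.ne]) (by abel)
      have s2 := t2.mem₀ (r := r) (c := j) (by simp [yVar_apply_of_ne h.ne])
      have s3 := t5.mem₀ (r := r) (c := j) (by simp [yVar_apply_of_ne h.ne])
      refine mem_of_mem_of_eq hc (add_mem (sub_mem (add_mem s0 s1) s2) s3) ?_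
      simp only [Nat.cast_one, Int.reduceAdd]
      ring
  · simp [← MvPolynomial.constantCoeff_eq]

/-- Type `B_2`: an element with leading term `Y_{j,p}`, `j` the short node. -/
theorem hasTop_short_two (h : IsFiniteShape Q r i j 2 k) (p : ℤ) :
    HasTop Q r (yVar p k j 0) := by
  have t0 : IsTerm Q (yVar p k j 0) 1 (yVar p k j 0) := isTerm_one
  have t1 := h.mul_short t0 1 (u' := yVar p k i 1 - yVar p k j 2)
    (by norm_num; abel)
  have t2 := h.mul_long_two t1 3 (u' := yVar p k j 4 - yVar p k i 5)
    (by norm_num; abel)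
  have t3 := h.mul_short t2 5 (u' := -yVar p k j 6)
    (by norm_num; abel)
  refine ⟨1 + aVar p k j 1 + aVar p k j 1 * aVar p k i 3 +
      aVar p k j 1 * aVar p k i 3 * aVar p k j 5, fun c => ?_, ?_⟩
  · rcases h.eq_or_eq c with hc | hc
    · have s0 := t0.mem₀ (r := r) (c := i) (by simp [yVar_apply_of_ne h.ne.symm])
      have s1 := t1.mem₁ h.long_cast (-yVar p k j 2) 1
        (by simp [yVar_apply_of_ne h.ne.symm]) (by abel)
      have s2 := t3.mem₀ (r := r) (c := i) (by simp [yVar_apply_of_ne h.ne.symm])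
      refine mem_of_mem_of_eq hc (add_mem (add_mem s0 s1) s2) ?_
      simp only [Nat.cast_ofNat, Int.reduceAdd]
      ring
    · have s0 := t0.mem₁ h.short_cast 0 0 (by simp) (by abel)
      have s1 := t2.mem₁ h.short_cast (-yVar p k i 5) 4
        (by simp [yVar_apply_of_ne h.ne]) (by abel)
      refine mem_of_mem_of_eq hc (add_mem s0 s1) ?_
      simp only [Nat.cast_one, Int.reduceAdd]
      ring
  · simp [← MvPolynomial.constantCoeff_eq]

/-- Type `G_2`: an element with leading term `Y_{i,p}`, `i` the long node. -/
theorem hasTop_long_three (h : IsFiniteShape Q r i j 3 k) (p : ℤ) :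
    HasTop Q r (yVar p k i 0) := by
  have t0 : IsTerm Q (yVar p k i 0) 1 (yVar p k i 0) := isTerm_one
  have t1 := h.mul_long_three t0 3
    (u' := yVar p k j 1 + yVar p k j 3 + yVar p k j 5 - yVar p k i 6)
    (by norm_num; abel)
  have t2 := h.mul_short t1 4 (u' := yVar p k i 4 + yVar p k j 1 - yVar p k i 6)
    (by norm_num; abel)
  have t3 := h.mul_short t1 6 (u' := yVar p k j 1 + yVar p k j 3 - yVar p k j 7)
    (by norm_num; abel)
  have t4 := h.mul_short t1 2 (u' := yVar p k i 2 + yVar p k j 5 - yVar p k i 6)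
    (by norm_num; abel)
  have t5 := h.mul_short t3 4 (u' := yVar p k i 4 + yVar p k j 1 - yVar p k j 5 - yVar p k j 7)
    (by norm_num; abel)
  have t6 := h.mul_long_three t5 7 (u' := yVar p k j 1 + yVar p k j 9 - yVar p k i 10)
    (by norm_num; abel)
  have t7 := h.mul_short t5 2
    (u' := yVar p k i 2 + yVar p k i 4 - yVar p k j 3 - yVar p k j 5 - yVar p k j 7)
    (by norm_num; abel)
  have t8 := h.mul_long_three t7 5 (u' := yVar p k i 4 - yVar p k i 8)
    (by norm_num; abel)
  have t9 := h.mul_long_three t7 7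
    (u' := yVar p k i 2 + yVar p k j 9 - yVar p k i 10 - yVar p k j 3)
    (by norm_num; abel)
  have t10 := h.mul_short t6 10 (u' := yVar p k j 1 - yVar p k j 11)
    (by norm_num; abel)
  have t11 := h.mul_long_three t9 5
    (u' := yVar p k j 5 + yVar p k j 7 + yVar p k j 9 - yVar p k i 8 - yVar p k i 10)
    (by norm_num; abel)
  have t12 := h.mul_short t10 2 (u' := yVar p k i 2 - yVar p k j 3 - yVar p k j 11)
    (by norm_num; abel)
  have t13 := h.mul_short t11 8 (u' := yVar p k j 5 - yVar p k i 10)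
    (by norm_num; abel)
  have t14 := h.mul_long_three t12 5
    (u' := yVar p k j 5 + yVar p k j 7 - yVar p k i 8 - yVar p k j 11)
    (by norm_num; abel)
  have t15 := h.mul_short t11 6 (u' := yVar p k i 6 + yVar p k j 9 - yVar p k i 8 - yVar p k i 10)
    (by norm_num; abel)
  have t16 := h.mul_short t14 8 (u' := yVar p k j 5 - yVar p k j 9 - yVar p k j 11)
    (by norm_num; abel)
  have t17 := h.mul_short t16 6 (u' := yVar p k i 6 - yVar p k j 7 - yVar p k j 9 - yVar p k j 11)
    (by norm_num; abel)
  have t18 := h.mul_long_three t17 9 (u' := -yVar p k i 12)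
    (by norm_num; abel)
  refine ⟨1 + aVar p k i 3 + aVar p k i 3 * aVar p k j 6 +
      aVar p k i 3 * aVar p k j 6 * aVar p k j 4 +
      aVar p k i 3 * aVar p k j 6 * aVar p k j 4 * aVar p k i 7 +
      aVar p k i 3 * aVar p k j 6 * aVar p k j 4 * aVar p k j 2 +
      aVar p k i 3 * aVar p k j 6 * aVar p k j 4 * aVar p k j 2 * aVar p k i 5 +
      aVar p k i 3 * aVar p k j 6 * aVar p k j 4 * aVar p k j 2 * aVar p k i 7 +
      aVar p k i 3 * aVar p k j 6 * aVar p k j 4 * aVar p k i 7 * aVar p k j 10 +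
      aVar p k i 3 * aVar p k j 6 * aVar p k j 4 * aVar p k j 2 * aVar p k i 7 * aVar p k i 5 +
      aVar p k i 3 * aVar p k j 6 * aVar p k j 4 * aVar p k i 7 * aVar p k j 10 * aVar p k j 2 +
      aVar p k i 3 * aVar p k j 6 * aVar p k j 4 * aVar p k i 7 * aVar p k j 10 * aVar p k j 2 *
      aVar p k i 5 + aVar p k i 3 * aVar p k j 6 * aVar p k j 4 * aVar p k i 7 * aVar p k j 10 *
      aVar p k j 2 * aVar p k i 5 * aVar p k j 8 +
      aVar p k i 3 * aVar p k j 6 * aVar p k j 4 * aVar p k i 7 * aVar p k j 10 * aVar p k j 2 *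
      aVar p k i 5 * aVar p k j 8 * aVar p k j 6 +
      aVar p k i 3 * aVar p k j 6 * aVar p k j 4 * aVar p k i 7 * aVar p k j 10 * aVar p k j 2 *
      aVar p k i 5 * aVar p k j 8 * aVar p k j 6 * aVar p k i 9, fun c => ?_, ?_⟩
  · rcases h.eq_or_eq c with hc | hc
    · have s0 := t0.mem₁ h.long_cast 0 0 (by simp) (by abel)
      have s1 := t3.mem₀ (r := r) (c := i) (by simp [yVar_apply_of_ne h.ne.symm])
      have s2 := t5.mem₁ h.long_cast (yVar p k j 1 - yVar p k j 5 - yVar p k j 7) 4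
        (by simp [yVar_apply_of_ne h.ne.symm]) (by abel)
      have s3 := t7.mem₂ h.long_cast (-yVar p k j 3 - yVar p k j 5 - yVar p k j 7) 2 4
        (by simp [yVar_apply_of_ne h.ne.symm]) (by abel)
      have s4 := t10.mem₀ (r := r) (c := i) (by simp [yVar_apply_of_ne h.ne.symm])
      have s5 := t12.mem₁ h.long_cast (-yVar p k j 3 - yVar p k j 11) 2
        (by simp [yVar_apply_of_ne h.ne.symm]) (by abel)
      have s6 := t16.mem₀ (r := r) (c := i) (by simp [yVar_apply_of_ne h.ne.symm])
      have s7 := t17.mem₁ h.long_cast (-yVar p k j 7 - yVar p k j 9 - yVar p k j 11) 6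
        (by simp [yVar_apply_of_ne h.ne.symm]) (by abel)
      refine mem_of_mem_of_eq hc (add_mem (add_mem (add_mem (add_mem (add_mem (add_mem
        (add_mem s0 s1) s2) s3) s4) s5) s6) s7) ?_
      simp only [Nat.cast_ofNat, Int.reduceAdd]
      ring
    · have s0 := t0.mem₀ (r := r) (c := j) (by simp [yVar_apply_of_ne h.ne])
      have s1 := t1.mem₃ h.short_cast (-yVar p k i 6) 1 3 5
        (by simp [yVar_apply_of_ne h.ne]) (by abel)
      have s2 := t2.mem₁ h.short_cast (yVar p k i 4 - yVar p k i 6) 1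
        (by simp [yVar_apply_of_ne h.ne]) (by abel)
      have s3 := t4.mem₁ h.short_cast (yVar p k i 2 - yVar p k i 6) 5
        (by simp [yVar_apply_of_ne h.ne]) (by abel)
      have s4 := t6.mem₂ h.short_cast (-yVar p k i 10) 1 9
        (by simp [yVar_apply_of_ne h.ne]) (by abel)
      have s5 := t8.mem₀ (r := r) (c := j) (by simp [yVar_apply_of_ne h.ne])
      have s6 := t11.mem₃ h.short_cast (-yVar p k i 8 - yVar p k i 10) 5 7 9
        (by simp [yVar_apply_of_ne h.ne]) (by abel)
      have s7 := t13.mem₁ h.short_cast (-yVar p k i 10) 5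
        (by simp [yVar_apply_of_ne h.ne]) (by abel)
      have s8 := t15.mem₁ h.short_cast (yVar p k i 6 - yVar p k i 8 - yVar p k i 10) 9
        (by simp [yVar_apply_of_ne h.ne]) (by abel)
      have s9 := t18.mem₀ (r := r) (c := j) (by simp [yVar_apply_of_ne h.ne])
      refine mem_of_mem_of_eq hc (add_mem (sub_mem (sub_mem (add_mem (add_mem (add_mem
        (sub_mem (sub_mem (add_mem s0 s1) s2) s3) s4) s5) s6) s7) s8) s9) ?_
      simp only [Nat.cast_one, Int.reduceAdd]
      ring
  · simp [← MvPolynomial.constantCoeff_eq]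

/-- Type `G_2`: an element with leading term `Y_{j,p}`, `j` the short node. -/
theorem hasTop_short_three (h : IsFiniteShape Q r i j 3 k) (p : ℤ) :
    HasTop Q r (yVar p k j 0) := by
  have t0 : IsTerm Q (yVar p k j 0) 1 (yVar p k j 0) := isTerm_one
  have t1 := h.mul_short t0 1 (u' := yVar p k i 1 - yVar p k j 2)
    (by norm_num; abel)
  have t2 := h.mul_long_three t1 4 (u' := yVar p k j 4 + yVar p k j 6 - yVar p k i 7)
    (by norm_num; abel)
  have t3 := h.mul_short t2 7 (u' := yVar p k j 4 - yVar p k j 8)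
    (by norm_num; abel)
  have t4 := h.mul_short t2 5 (u' := yVar p k i 5 - yVar p k i 7)
    (by norm_num; abel)
  have t5 := h.mul_short t4 7 (u' := yVar p k i 5 - yVar p k j 6 - yVar p k j 8)
    (by norm_num; abel)
  have t6 := h.mul_long_three t5 8 (u' := yVar p k j 10 - yVar p k i 11)
    (by norm_num; abel)
  have t7 := h.mul_short t6 11 (u' := -yVar p k j 12)
    (by norm_num; abel)
  refine ⟨1 + aVar p k j 1 + aVar p k j 1 * aVar p k i 4 +
      aVar p k j 1 * aVar p k i 4 * aVar p k j 7 +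
      aVar p k j 1 * aVar p k i 4 * aVar p k j 5 * aVar p k j 7 +
      aVar p k j 1 * aVar p k i 4 * aVar p k j 5 * aVar p k j 7 * aVar p k i 8 +
      aVar p k j 1 * aVar p k i 4 * aVar p k j 5 * aVar p k j 7 * aVar p k i 8 * aVar p k j 11,
      fun c => ?_, ?_⟩
  · rcases h.eq_or_eq c with hc | hc
    · have s0 := t0.mem₀ (r := r) (c := i) (by simp [yVar_apply_of_ne h.ne.symm])
      have s1 := t1.mem₁ h.long_cast (-yVar p k j 2) 1
        (by simp [yVar_apply_of_ne h.ne.symm]) (by abel)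
      have s2 := t3.mem₀ (r := r) (c := i) (by simp [yVar_apply_of_ne h.ne.symm])
      have s3 := t5.mem₁ h.long_cast (-yVar p k j 6 - yVar p k j 8) 5
        (by simp [yVar_apply_of_ne h.ne.symm]) (by abel)
      have s4 := t7.mem₀ (r := r) (c := i) (by simp [yVar_apply_of_ne h.ne.symm])
      refine mem_of_mem_of_eq hc (add_mem (add_mem (add_mem (add_mem s0 s1) s2) s3) s4) ?_
      simp only [Nat.cast_ofNat, Int.reduceAdd]
      ring
    · have s0 := t0.mem₁ h.short_cast 0 0 (by simp) (by abel)
      have s1 := t2.mem₂ h.short_cast (-yVar p k i 7) 4 6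
        (by simp [yVar_apply_of_ne h.ne]) (by abel)
      have s2 := t4.mem₀ (r := r) (c := j) (by simp [yVar_apply_of_ne h.ne])
      have s3 := t6.mem₁ h.short_cast (-yVar p k i 11) 10
        (by simp [yVar_apply_of_ne h.ne]) (by abel)
      refine mem_of_mem_of_eq hc (add_mem (sub_mem (add_mem s0 s1) s2) s3) ?_
      simp only [Nat.cast_one, Int.reduceAdd]
      ring
  · simp [← MvPolynomial.constantCoeff_eq]

end

/-! ### Strings of the deformed screening operators -/

section

variable {n : ℕ} {Q : Matrix (Fin n) (Fin n) ℤ[T;T⁻¹]} {r : Fin n → ℕ}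

variable (Q r) in
/-- The class of `x S̃_{c,l}` in `Ŷ_{c,t}`. -/
def screenClass (c : Fin n) (l : ℤ) : Yt Q r →ₗ[ℤ[T;T⁻¹]] (ℤ →₀ Yt Q r) ⧸ tRel Q r c :=
  ((tRel Q r c).mkQ.restrictScalars ℤ[T;T⁻¹]).comp (Finsupp.lsingle l)

/-- The defining relation of `Ŷ_{c,t}`, multiplied by `x` from the left. The monomial of `Ā` is
`t Ã⁻¹`, whence the power `t⁻²`. -/
theorem screenClass_eq (c : Fin n) (l : ℤ) (x : Yt Q r) : screenClass Q r c l x =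
    (T (-2) : ℤ[T;T⁻¹]) • screenClass Q r c (l + r c + r c)
      (x * Yt.mon Q r (monV c (l + r c))) := by
  rw [← map_smul, ← sub_eq_zero, screenClass, screenClass, LinearMap.comp_apply,
    LinearMap.comp_apply, LinearMap.restrictScalars_apply, LinearMap.restrictScalars_apply,
    ← map_sub, Submodule.mkQ_apply, Submodule.Quotient.mk_eq_zero]
  have h := Submodule.smul_mem (tRel Q r c) x
    (Submodule.subset_span (Set.mem_range_self (l + r c)))
  convert h using 1
  rw [smul_sub, Finsupp.smul_single, Finsupp.smul_single, smul_eq_mul, smul_eq_mul, mul_one,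
    add_sub_cancel_right, Yt.aInv, smul_smul, ← LaurentPolynomial.T_add, mul_smul_comm]
  rfl

theorem tScreen_mon_eq_zero {c : Fin n} {m : Mon n} (hm : ∀ l, uExp Q m (c, l) = 0) :
    tScreen Q r c (Yt.mon Q r m) = 0 := by
  rw [tScreen, Yt.lift_mon]
  have h : tScreenMon Q r c m = 0 := Finsupp.ext fun l => by
    rw [tScreenMon_apply, hm, screenInt_zero, zero_smul]
    rfl
  rw [h, map_zero]

theorem tScreen_mon_eq_single {c : Fin n} {m : Mon n} {a : ℤ} {ε : ℤ}
    (hm : ∀ l, uExp Q m (c, l) = if l = a then ε else 0) :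
    tScreen Q r c (Yt.mon Q r m) = screenInt ε • screenClass Q r c a (Yt.mon Q r m) := by
  rw [tScreen, Yt.lift_mon, ← map_smul, screenClass]
  refine congrArg (tRel Q r c).mkQ (Finsupp.ext fun l => ?_)
  rw [tScreenMon_apply, hm]
  by_cases h : l = a
  · simp [h]
  · simp [h]

theorem tScreen_mon_eq_pair {c : Fin n} {m : Mon n} {a b : ℤ} (hab : a ≠ b) {ε ε' : ℤ}
    (hm : ∀ l, uExp Q m (c, l) = (if l = a then ε else 0) + if l = b then ε' else 0) :
    tScreen Q r c (Yt.mon Q r m) = screenInt ε • screenClass Q r c a (Yt.mon Q r m) +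
      screenInt ε' • screenClass Q r c b (Yt.mon Q r m) := by
  rw [tScreen, Yt.lift_mon, ← map_smul, ← map_smul, screenClass, screenClass,
    LinearMap.comp_apply, LinearMap.comp_apply, ← map_add]
  refine congrArg (tRel Q r c).mkQ (Finsupp.ext fun l => ?_)
  rw [tScreenMon_apply, hm]
  by_cases h : l = a
  · subst h
    simp [hab]
  · by_cases h' : l = b
    · subst h'
      simp [h]
    · simp [h, h']

theorem screenInt_one : screenInt 1 = 1 := by
  simp [screenInt, quantumInt]

theorem screenInt_neg_one : screenInt (-1) = -T (-2) := by
  rw [screenInt, quantumInt_neg_one]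
  norm_num

/-- The element `x` is a power of `t` times a monomial `Y_{i,0} ∏ A^{-w}` with all second indices in
`w` nonnegative, and `u` is the exponent vector of that monomial. -/
def IsConeTerm (i : Fin n) (x : Yt Q r) (u : YMon n) : Prop :=
  ∃ (w : Fin n × ℤ →₀ ℕ) (e : ℤ), (∀ p ∈ w.support, 0 ≤ p.2) ∧
    x = (T e : ℤ[T;T⁻¹]) • Yt.mon Q r (monY i 0 + (0, w)) ∧ u = uExp Q (monY i 0 + (0, w))

variable (Q r) in
/-- The span of the monomials `Y_{i,0} ∏ A^{-w}` with `w ≠ 0`, all second indices in `w` being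
nonnegative. -/
def lowerCone (i : Fin n) : Submodule ℤ[T;T⁻¹] (Yt Q r) :=
  Submodule.span ℤ[T;T⁻¹] {x | ∃ w : Fin n × ℤ →₀ ℕ, w ≠ 0 ∧ (∀ p ∈ w.support, 0 ≤ p.2) ∧
    x = Yt.mon Q r (monY i 0 + (0, w))}

variable {i c : Fin n} {x : Yt Q r} {u v : YMon n}

theorem isConeTerm_monY : IsConeTerm (Q := Q) (r := r) i (Yt.mon Q r (monY i 0))
    (Finsupp.single (i, 0) 1) := by
  refine ⟨0, 0, by simp, ?_, ?_⟩
  · rw [LaurentPolynomial.T_zero, one_smul, Prod.mk_zero_zero, add_zero]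
  · rw [uExp_monY_add, below_zero]

/-- Basis monomials multiply to basis monomials up to a power of `t`. -/
theorem mul_monV_eq (w : Fin n × ℤ →₀ ℕ) (e : ℤ) (p : Fin n × ℤ) :
    ∃ e', ((T e : ℤ[T;T⁻¹]) • Yt.mon Q r (monY i 0 + (0, w))) * Yt.mon Q r (monV p.1 p.2) =
      (T e' : ℤ[T;T⁻¹]) • Yt.mon Q r (monY i 0 + (0, w + Finsupp.single p 1)) := by
  refine ⟨e + dExp Q r (monY i 0 + (0, w)) (monV p.1 p.2), ?_⟩
  rw [smul_mul_assoc, Yt.mon_mul_mon, smul_smul, ← LaurentPolynomial.T_add, add_assoc]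
  rfl

theorem support_add_single_nonneg {w : Fin n × ℤ →₀ ℕ} (hw : ∀ p ∈ w.support, 0 ≤ p.2)
    {p : Fin n × ℤ} (hp : 0 ≤ p.2) : ∀ p' ∈ (w + Finsupp.single p 1).support, 0 ≤ p'.2 := by
  classical
  intro p' hp'
  rcases Finset.mem_union.mp (Finsupp.support_add hp') with h | h
  · exact hw p' h
  · rw [Finset.mem_singleton.mp (Finsupp.support_single_subset h)]
    exact hp

theorem IsConeTerm.mul (h : IsConeTerm i x u) (p : Fin n × ℤ) (hp : 0 ≤ p.2) {u' : YMon n}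
    (hu : u = u' + aVec Q p) : IsConeTerm i (x * Yt.mon Q r (monV p.1 p.2)) u' := by
  obtain ⟨w, e, hw, rfl, hw'⟩ := h
  obtain ⟨e', he'⟩ := mul_monV_eq (Q := Q) (r := r) (i := i) w e p
  refine ⟨w + Finsupp.single p 1, e', support_add_single_nonneg hw hp, he', ?_⟩
  rw [uExp_monY_add] at hw' ⊢
  rw [← below_below, ← hw', hu, below, aSum_single, one_smul, add_sub_cancel_right]

theorem IsConeTerm.mul_mem (h : IsConeTerm i x u) (p : Fin n × ℤ) (hp : 0 ≤ p.2) :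
    x * Yt.mon Q r (monV p.1 p.2) ∈ lowerCone Q r i := by
  obtain ⟨w, e, hw, rfl, -⟩ := h
  obtain ⟨e', he'⟩ := mul_monV_eq (Q := Q) (r := r) (i := i) w e p
  rw [he']
  refine Submodule.smul_mem _ _ (Submodule.subset_span ⟨_, ?_, support_add_single_nonneg hw hp,
      rfl⟩)
  intro h0
  have := DFunLike.congr_fun h0 p
  simp at this

theorem IsConeTerm.tScreen_eq_zero (h : IsConeTerm i x u) (hu : ∀ l, u (c, l) = 0) :
    tScreen Q r c x = 0 := by
  obtain ⟨w, e, hw, rfl, rfl⟩ := h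
  rw [map_smul, tScreen_mon_eq_zero hu, smul_zero]

theorem IsConeTerm.tScreen_eq_single (h : IsConeTerm i x u) {a ε : ℤ}
    (hu : ∀ l, u (c, l) = if l = a then ε else 0) :
    tScreen Q r c x = screenInt ε • screenClass Q r c a x := by
  obtain ⟨w, e, hw, rfl, rfl⟩ := h
  rw [map_smul, tScreen_mon_eq_single hu, map_smul, smul_comm]

theorem IsConeTerm.tScreen_eq_pair (h : IsConeTerm i x u) {a b ε ε' : ℤ} (hab : a ≠ b)
    (hu : ∀ l, u (c, l) = (if l = a then ε else 0) + if l = b then ε' else 0) :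
    tScreen Q r c x = screenInt ε • screenClass Q r c a x +
      screenInt ε' • screenClass Q r c b x := by
  obtain ⟨w, e, hw, rfl, rfl⟩ := h
  rw [map_smul, tScreen_mon_eq_pair hab hu, map_smul, map_smul, smul_add, smul_comm,
    smul_comm (screenInt ε')]

/-- A string of length two: `x (1 + A_{c,l+r_c}⁻¹)` with `x` of exponent `Y_{c,l}` in colour `c`. -/
theorem IsConeTerm.tScreen_string_two (h : IsConeTerm i x u)
    (hQ : Q c c = T (r c : ℤ) + T (-(r c : ℤ))) (hr : 0 < r c) {l : ℤ} (hl : 0 ≤ l + r c)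
    (hv : ∀ l, v (c, l) = 0) (hu : u = v + Finsupp.single (c, l) 1) :
    tScreen Q r c (x + x * Yt.mon Q r (monV c (l + r c))) = 0 := by
  have hr' : (0 : ℤ) < r c := by exact_mod_cast hr
  have h1 := h.mul (c, l + r c) hl (u' := u - aVec Q (c, l + r c)) (by abel)
  rw [map_add, h.tScreen_eq_single (a := l) (ε := 1), h1.tScreen_eq_single (a := l + r c + r c)
    (ε := -1), screenInt_one, screenInt_neg_one, one_smul, screenClass_eq, neg_smul, add_neg_cancel]
  · intro l'
    rw [hu, Finsupp.sub_apply, Finsupp.add_apply, hv, Finsupp.single_apply, aVec_diag hQ]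
    simp only [Prod.mk.injEq, true_and]
    split_ifs <;> omega
  · intro l'
    rw [hu, Finsupp.add_apply, hv, Finsupp.single_apply]
    simp only [Prod.mk.injEq, true_and]
    split_ifs <;> omega

/-- `Ã_{c,l}⁻¹` and `Ã_{c,l+2r_c}⁻¹` commute up to the factor `t²`. -/
theorem monV_mul_monV (hQ : Q c c = T (r c : ℤ) + T (-(r c : ℤ))) (hr : 0 < r c) (l : ℤ) :
    Yt.mon Q r (monV c l) * Yt.mon Q r (monV c (l + r c + r c)) =
      (T 2 : ℤ[T;T⁻¹]) • (Yt.mon Q r (monV c (l + r c + r c)) * Yt.mon Q r (monV c l)) := by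
  have hr' : (0 : ℤ) < r c := by exact_mod_cast hr
  have hd : ∀ a b, dExp Q r (monV c a) (monV c b) =
      -(aVec Q (c, b) (c, a - r c)) - aVec Q (c, a) (c, b + r c) := fun a b => by
    simp [dExp, d1, d2, monV, uExp, sub_eq_add_neg]
  rw [Yt.mon_mul_mon, Yt.mon_mul_mon, smul_smul, ← LaurentPolynomial.T_add, add_comm (monV c l),
    hd, hd, aVec_diag hQ, aVec_diag hQ, aVec_diag hQ, aVec_diag hQ]
  congr 2
  split_ifs <;> omega

/-- A string of length three: `x (1 + A_{c,l+3r_c}⁻¹ + A_{c,l+3r_c}⁻¹ A_{c,l+r_c}⁻¹)` with `x` of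
exponent `Y_{c,l} Y_{c,l+2r_c}` in colour `c`. -/
theorem IsConeTerm.tScreen_string_three (h : IsConeTerm i x u)
    (hQ : Q c c = T (r c : ℤ) + T (-(r c : ℤ))) (hr : 0 < r c) {l : ℤ} (hl : 0 ≤ l + r c)
    (hv : ∀ l, v (c, l) = 0)
    (hu : u = v + (Finsupp.single (c, l) 1 + Finsupp.single (c, l + r c + r c) 1)) :
    tScreen Q r c (x + x * Yt.mon Q r (monV c (l + r c + r c + r c)) +
      x * Yt.mon Q r (monV c (l + r c + r c + r c)) * Yt.mon Q r (monV c (l + r c))) = 0 := by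
  have hr' : (0 : ℤ) < r c := by exact_mod_cast hr
  have h1 := h.mul (c, l + r c + r c + r c) (by simp only; omega)
    (u' := u - aVec Q (c, l + r c + r c + r c)) (by abel)
  have h2 := h1.mul (c, l + r c) hl
    (u' := u - aVec Q (c, l + r c + r c + r c) - aVec Q (c, l + r c)) (by abel)
  rw [map_add, map_add, h.tScreen_eq_pair (a := l) (b := l + r c + r c) (ε := 1) (ε' := 1)
    (by omega), h1.tScreen_eq_pair (a := l) (b := l + r c + r c + r c + r c) (ε := 1) (ε' := -1)
    (by omega), h2.tScreen_eq_pair (a := l + r c + r c) (b := l + r c + r c + r c + r c) (ε := -1)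
    (ε' := -1) (by omega), screenInt_one, screenInt_neg_one]
  · simp only [one_smul, neg_smul]
    rw [screenClass_eq c l, screenClass_eq c l, screenClass_eq c (l + r c + r c) x,
      screenClass_eq c (l + r c + r c) (x * Yt.mon Q r (monV c (l + r c))), mul_assoc x,
      monV_mul_monV hQ hr, mul_smul_comm, map_smul, smul_smul (T (-2)), ← LaurentPolynomial.T_add,
      mul_assoc x]
    rw [smul_smul _ (T 2), ← LaurentPolynomial.T_add]
    norm_num
    abel
  all_goals
    intro l'
    simp only [hu, Finsupp.sub_apply, Finsupp.add_apply, hv, Finsupp.single_apply, aVec_diag hQ,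
      Prod.mk.injEq, true_and]
    split_ifs <;> omega

theorem uExp_monY (i : Fin n) (l : ℤ) : uExp Q (monY i l) = Finsupp.single (i, l) 1 := by
  have := uExp_monY_add Q i l 0
  rwa [Prod.mk_zero_zero, add_zero, below_zero] at this

theorem isGreatest_zero_monY (i : Fin n) :
    IsGreatest {l : ℤ | ∀ k < l, ∀ j, uExp Q (monY i 0) (j, k) = 0} 0 := by
  refine ⟨fun k hk j => ?_, fun l hl => ?_⟩
  · rw [uExp_monY, Finsupp.single_apply, if_neg]
    intro h
    exact hk.ne (congrArg Prod.snd h).symm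
  · by_contra h
    have := hl 0 (not_le.mp h) i
    rw [uExp_monY, Finsupp.single_eq_same] at this
    exact one_ne_zero this

/-- The existence of an element `Y_{i,0} + ⋯` of `𝔎̂_t`, the dots standing for lower monomials
in the cone, makes the intersection nonzero. -/
theorem tKerInInf_inf_tildeC_ne_bot {g : Yt Q r} (hg : g ∈ lowerCone Q r i)
    (hker : ∀ c, tScreen Q r c (Yt.mon Q r (monY i 0) + g) = 0) :
    tKerInInf Q r ⊓ tildeC Q (monY i 0) ≠ ⊥ := by
  have hlow : ∀ m, Yt.coeff Q r g m ≠ 0 → ∃ w : Fin n × ℤ →₀ ℕ, w ≠ 0 ∧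
      (∀ p ∈ w.support, 0 ≤ p.2) ∧ m = monY i 0 + (0, w) := by
    intro m
    clear hker
    rw [lowerCone] at hg
    induction hg using Submodule.span_induction with
    | mem x hx =>
      obtain ⟨w, hw, hw', rfl⟩ := hx
      intro hm
      rw [Yt.coeff_mon] at hm
      exact ⟨w, hw, hw', (ite_ne_right_iff.mp hm).1.symm⟩
    | zero => simp
    | add x y _ _ hx hy =>
      intro hm
      by_cases h0 : Yt.coeff Q r x m = 0
      · exact hy fun h1 => hm (by rw [map_add, Pi.add_apply, h0, h1, add_zero])
      · exact hx h0
    | smul a x _ hx =>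
      intro hm
      exact hx fun h0 => hm (by rw [map_smul, Pi.smul_apply, h0, smul_zero])
  refine (Submodule.ne_bot_iff _).mpr ⟨Yt.coeff Q r (Yt.mon Q r (monY i 0) + g), ⟨⟨_, ?_, rfl⟩,
      ?_, ?_⟩, ?_⟩
  · exact (Submodule.mem_iInf _).mpr hker
  · exact fun k => (Yt.coeff_support_finite _).subset fun m hm => hm.2
  · intro m hm
    rw [map_add, Pi.add_apply, Yt.coeff_mon] at hm
    by_cases h0 : Yt.coeff Q r g m = 0
    · rw [h0, add_zero] at hm
      exact ⟨0, isGreatest_zero_monY i, 0, by simp, by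
        rw [← (ite_ne_right_iff.mp hm).1, Prod.mk_zero_zero, add_zero]⟩
    · obtain ⟨w, -, hw, rfl⟩ := hlow m h0
      exact ⟨0, isGreatest_zero_monY i, w, hw, rfl⟩
  · intro h0
    have h1 := congrFun h0 (monY i 0)
    have h2 : Yt.coeff Q r g (monY i 0) = 0 := by
      by_contra h
      obtain ⟨w, hw, -, he⟩ := hlow _ h
      have := congrArg Prod.snd he
      simp only [Prod.snd_add, monY, zero_add] at this
      exact hw this.symm
    rw [map_add, Pi.add_apply, Yt.coeff_mon, if_pos rfl, h2, add_zero] at h1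
    exact one_ne_zero h1

end

/-! ### Rank two elements of the deformed kernels -/

section

variable {n : ℕ} {Q : Matrix (Fin n) (Fin n) ℤ[T;T⁻¹]} {r : Fin n → ℕ}

theorem IsConeTerm.exists_mem_coneC {i : Fin n} {x : Yt Q r} {u : YMon n} (h : IsConeTerm i x u)
    (hu : Antidominant u) : ∃ m ∈ coneC Q (monY i 0), Antidominant (uExp Q m) := by
  obtain ⟨w, e, hw, -, rfl⟩ := h
  exact ⟨_, ⟨0, isGreatest_zero_monY i, w, hw, rfl⟩, hu⟩

end

section

variable {Q : Matrix (Fin 2) (Fin 2) ℤ[T;T⁻¹]} {r : Fin 2 → ℕ}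

variable (Q r) in
/-- The monomial proportional to `Ã_{c,nk}⁻¹`. -/
def aMon (k : ℕ) (c : Fin 2) (a : ℤ) : Yt Q r := Yt.mon Q r (monV c (a * k))

variable {i c : Fin 2} {x : Yt Q r} {u v : YMon 2} {k ρ : ℕ}

theorem yVar_nonneg (p : ℤ) (k : ℕ) (c : Fin 2) (a : ℤ) (q : Fin 2 × ℤ) :
    0 ≤ yVar p k c a q := by
  rw [yVar, Finsupp.single_apply]
  split <;> simp

theorem antidominant_neg_yVar (p : ℤ) (k : ℕ) (c : Fin 2) (a : ℤ) :
    Antidominant (-yVar p k c a) := fun q => neg_nonpos.mpr (yVar_nonneg p k c a q)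

theorem IsConeTerm.mul_aMon_mem (h : IsConeTerm i x u) (k : ℕ) (c : Fin 2) {a : ℤ} (ha : 0 ≤ a) :
    x * aMon Q r k c a ∈ lowerCone Q r i :=
  h.mul_mem (c, a * k) (mul_nonneg ha (Int.natCast_nonneg k))

/-- `tScreen_string_two` in multiples of `k`. -/
theorem IsConeTerm.tScreen_string_two' (h : IsConeTerm i x u)
    (hQ : Q c c = T (r c : ℤ) + T (-(r c : ℤ))) (hr : 0 < r c) (hc : (r c : ℤ) = ρ * k) (a : ℤ)
    (ha : 0 ≤ a + ρ) (hv : ∀ l, v (c, l) = 0) (hu : u = v + yVar 0 k c a) :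
    tScreen Q r c (x + x * aMon Q r k c (a + ρ)) = 0 := by
  have e : (a + ρ) * (k : ℤ) = a * k + r c := by rw [hc]; ring
  rw [aMon, e]
  refine h.tScreen_string_two hQ hr ?_ hv (by simpa [yVar] using hu)
  rw [← e]
  exact mul_nonneg ha (Int.natCast_nonneg k)

/-- `tScreen_string_three` in multiples of `k`. -/
theorem IsConeTerm.tScreen_string_three' (h : IsConeTerm i x u)
    (hQ : Q c c = T (r c : ℤ) + T (-(r c : ℤ))) (hr : 0 < r c) (hc : (r c : ℤ) = ρ * k) (a : ℤ)
    (ha : 0 ≤ a + ρ) (hv : ∀ l, v (c, l) = 0)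
    (hu : u = v + (yVar 0 k c a + yVar 0 k c (a + ρ + ρ))) :
    tScreen Q r c (x + x * aMon Q r k c (a + ρ + ρ + ρ) +
      x * aMon Q r k c (a + ρ + ρ + ρ) * aMon Q r k c (a + ρ)) = 0 := by
  have e : (a + ρ) * (k : ℤ) = a * k + r c := by rw [hc]; ring
  have e2 : (a + ρ + ρ) * (k : ℤ) = a * k + r c + r c := by rw [hc]; ring
  have e3 : (a + ρ + ρ + ρ) * (k : ℤ) = a * k + r c + r c + r c := by rw [hc]; ring
  rw [aMon, aMon, e, e3]
  refine h.tScreen_string_three hQ hr ?_ hv (by simpa [yVar, e2] using hu)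
  rw [← e]
  exact mul_nonneg ha (Int.natCast_nonneg k)

variable (Q r) in
/-- Some `𝔎̂_t ∩ C̃(Ỹ_{i,0})` is nonzero, and the cone `C(Y_{i,0})` has an antidominant monomial. -/
def HasDeformedElement (i : Fin 2) : Prop :=
  tKerInInf Q r ⊓ tildeC Q (monY i 0) ≠ ⊥ ∧
    ∃ m ∈ coneC Q (monY i 0), Antidominant (uExp Q m)

namespace IsFiniteShape

variable {i j : Fin 2} {q k : ℕ} {x : Yt Q r} {u u' : YMon 2} {d : Fin 2}

theorem r_pos (h : IsFiniteShape Q r i j q k) (hq : 0 < q) (c : Fin 2) : 0 < r c := by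
  rcases h.eq_or_eq c with rfl | rfl
  · rw [h.long]; exact Nat.mul_pos hq h.pos
  · rw [h.short]; exact h.pos

theorem isConeTerm_monY (_ : IsFiniteShape Q r i j q k) :
    IsConeTerm d (Yt.mon Q r (monY d 0)) (yVar 0 k d 0) := by
  have : yVar 0 k d 0 = Finsupp.single (d, 0) 1 := by simp [yVar]
  rw [this]
  exact QTChar.isConeTerm_monY

theorem cone_short (h : IsFiniteShape Q r i j q k) (ht : IsConeTerm d x u) (a : ℤ) (ha : 0 ≤ a)
    (hu : u = u' + (yVar 0 k j (a - 1) + yVar 0 k j (a + 1) - yVar 0 k i a)) :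
    IsConeTerm d (x * aMon Q r k j a) u' :=
  ht.mul (j, a * k) (mul_nonneg ha (Int.natCast_nonneg k)) (by
    have := h.aVec_short 0 a
    rw [zero_add] at this
    rw [this, hu])

theorem cone_long_one (h : IsFiniteShape Q r i j 1 k) (ht : IsConeTerm d x u) (a : ℤ) (ha : 0 ≤ a)
    (hu : u = u' + (yVar 0 k i (a - 1) + yVar 0 k i (a + 1) - yVar 0 k j a)) :
    IsConeTerm d (x * aMon Q r k i a) u' :=
  ht.mul (i, a * k) (mul_nonneg ha (Int.natCast_nonneg k)) (by
    have := h.aVec_long_one 0 a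
    rw [zero_add] at this
    rw [this, hu])

theorem cone_long_two (h : IsFiniteShape Q r i j 2 k) (ht : IsConeTerm d x u) (a : ℤ) (ha : 0 ≤ a)
    (hu : u = u' + (yVar 0 k i (a - 2) + yVar 0 k i (a + 2) - yVar 0 k j (a - 1) -
      yVar 0 k j (a + 1))) :
    IsConeTerm d (x * aMon Q r k i a) u' :=
  ht.mul (i, a * k) (mul_nonneg ha (Int.natCast_nonneg k)) (by
    have := h.aVec_long_two 0 a
    rw [zero_add] at this
    rw [this, hu])

theorem cone_long_three (h : IsFiniteShape Q r i j 3 k) (ht : IsConeTerm d x u) (a : ℤ)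
    (ha : 0 ≤ a) (hu : u = u' + (yVar 0 k i (a - 3) + yVar 0 k i (a + 3) - yVar 0 k j (a - 2) -
      yVar 0 k j a - yVar 0 k j (a + 2))) :
    IsConeTerm d (x * aMon Q r k i a) u' :=
  ht.mul (i, a * k) (mul_nonneg ha (Int.natCast_nonneg k)) (by
    have := h.aVec_long_three 0 a
    rw [zero_add] at this
    rw [this, hu])

/-- Type `A_2`: the deformed three-term element. -/
theorem hasDeformedElement_one (h : IsFiniteShape Q r i j 1 k) : HasDeformedElement Q r j := by
  have t0 := h.isConeTerm_monY (d := j)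
  have t1 := h.cone_short t0 1 (by norm_num) (u' := yVar 0 k i 1 - yVar 0 k j 2)
    (by norm_num)
  have t2 := h.cone_long_one t1 2 (by norm_num) (u' := -yVar 0 k i 3) (by norm_num; abel)
  refine ⟨tKerInInf_inf_tildeC_ne_bot (add_mem (t0.mul_aMon_mem k j (a := 1) (by norm_num))
    (t1.mul_aMon_mem k i (a := 2) (by norm_num))) fun c => ?_,
    t2.exists_mem_coneC (antidominant_neg_yVar _ _ _ _)⟩
  rcases h.eq_or_eq c with hc | hc
  · have s1 := t1.tScreen_string_two' (h.diag i) (h.r_pos (by norm_num) i) h.long_cast 1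
      (by norm_num) (v := -yVar 0 k j 2) (by simp [yVar_apply_of_ne h.ne.symm]) (by abel)
    simp only [Nat.cast_one, Int.reduceAdd] at s1
    rw [hc, map_add, s1, t0.tScreen_eq_zero (by simp [yVar_apply_of_ne h.ne.symm]), add_zero]
  · have s0 := t0.tScreen_string_two' (h.diag j) (h.r_pos (by norm_num) j) h.short_cast 0
      (by norm_num) (v := 0) (by simp) (by abel)
    simp only [Nat.cast_one, Int.reduceAdd] at s0
    rw [hc, ← add_assoc, map_add, s0, t2.tScreen_eq_zero (by simp [yVar_apply_of_ne h.ne]),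
      add_zero]

/-- Type `B_2`: the deformed four-term element. -/
theorem hasDeformedElement_two (h : IsFiniteShape Q r i j 2 k) : HasDeformedElement Q r j := by
  have t0 := h.isConeTerm_monY (d := j)
  have t1 := h.cone_short t0 1 (by norm_num) (u' := yVar 0 k i 1 - yVar 0 k j 2)
    (by norm_num)
  have t2 := h.cone_long_two t1 3 (by norm_num) (u' := yVar 0 k j 4 - yVar 0 k i 5)
    (by norm_num; abel)
  have t3 := h.cone_short t2 5 (by norm_num) (u' := -yVar 0 k j 6) (by norm_num; abel)
  refine ⟨tKerInInf_inf_tildeC_ne_bot (add_mem (t0.mul_aMon_mem k j (a := 1) (by norm_num))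
    (add_mem (t1.mul_aMon_mem k i (a := 3) (by norm_num))
      (t2.mul_aMon_mem k j (a := 5) (by norm_num)))) fun c => ?_,
    t3.exists_mem_coneC (antidominant_neg_yVar _ _ _ _)⟩
  rcases h.eq_or_eq c with hc | hc
  · have s1 := t1.tScreen_string_two' (h.diag i) (h.r_pos (by norm_num) i) h.long_cast 1
      (by norm_num) (v := -yVar 0 k j 2) (by simp [yVar_apply_of_ne h.ne.symm]) (by abel)
    simp only [Nat.cast_ofNat, Int.reduceAdd] at s1
    rw [hc, map_add, ← add_assoc, map_add, s1,
      t0.tScreen_eq_zero (by simp [yVar_apply_of_ne h.ne.symm]),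
      t3.tScreen_eq_zero (by simp [yVar_apply_of_ne h.ne.symm]), add_zero, add_zero]
  · have s0 := t0.tScreen_string_two' (h.diag j) (h.r_pos (by norm_num) j) h.short_cast 0
      (by norm_num) (v := 0) (by simp) (by abel)
    have s2 := t2.tScreen_string_two' (h.diag j) (h.r_pos (by norm_num) j) h.short_cast 4
      (by norm_num) (v := -yVar 0 k i 5) (by simp [yVar_apply_of_ne h.ne]) (by abel)
    simp only [Nat.cast_one, Int.reduceAdd] at s0 s2
    rw [hc, ← add_assoc, map_add, s0, s2, add_zero]

/-- Type `G_2`: the deformed seven-term element. -/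
theorem hasDeformedElement_three (h : IsFiniteShape Q r i j 3 k) : HasDeformedElement Q r j := by
  have t0 := h.isConeTerm_monY (d := j)
  have t1 := h.cone_short t0 1 (by norm_num) (u' := yVar 0 k i 1 - yVar 0 k j 2)
    (by norm_num)
  have t2 := h.cone_long_three t1 4 (by norm_num)
    (u' := yVar 0 k j 4 + yVar 0 k j 6 - yVar 0 k i 7) (by norm_num; abel)
  have t3 := h.cone_short t2 7 (by norm_num) (u' := yVar 0 k j 4 - yVar 0 k j 8)
    (by norm_num; abel)
  have t4 := h.cone_short t3 5 (by norm_num) (u' := yVar 0 k i 5 - yVar 0 k j 6 - yVar 0 k j 8)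
    (by norm_num; abel)
  have t5 := h.cone_long_three t4 8 (by norm_num) (u' := yVar 0 k j 10 - yVar 0 k i 11)
    (by norm_num; abel)
  have t6 := h.cone_short t5 11 (by norm_num) (u' := -yVar 0 k j 12) (by norm_num; abel)
  refine ⟨tKerInInf_inf_tildeC_ne_bot (add_mem (t0.mul_aMon_mem k j (a := 1) (by norm_num))
    (add_mem (t1.mul_aMon_mem k i (a := 4) (by norm_num))
    (add_mem (t2.mul_aMon_mem k j (a := 7) (by norm_num))
    (add_mem (t3.mul_aMon_mem k j (a := 5) (by norm_num))
    (add_mem (t4.mul_aMon_mem k i (a := 8) (by norm_num))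
      (t5.mul_aMon_mem k j (a := 11) (by norm_num))))))) fun c => ?_,
    t6.exists_mem_coneC (antidominant_neg_yVar _ _ _ _)⟩
  rcases h.eq_or_eq c with hc | hc
  · have s1 := t1.tScreen_string_two' (h.diag i) (h.r_pos (by norm_num) i) h.long_cast 1
      (by norm_num) (v := -yVar 0 k j 2) (by simp [yVar_apply_of_ne h.ne.symm]) (by abel)
    have s4 := t4.tScreen_string_two' (h.diag i) (h.r_pos (by norm_num) i) h.long_cast 5
      (by norm_num) (v := -yVar 0 k j 6 - yVar 0 k j 8)
      (by simp [yVar_apply_of_ne h.ne.symm]) (by abel)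
    have s0 := t0.tScreen_eq_zero (c := i) (by simp [yVar_apply_of_ne h.ne.symm])
    have s3 := t3.tScreen_eq_zero (c := i) (by simp [yVar_apply_of_ne h.ne.symm])
    have s6 := t6.tScreen_eq_zero (c := i) (by simp [yVar_apply_of_ne h.ne.symm])
    simp only [Nat.cast_ofNat, Int.reduceAdd, map_add] at s1 s4
    rw [hc]
    simp only [map_add]
    rw [s0, s3, s6, zero_add, zero_add, add_zero, s4, add_zero, s1]
  · have s0 := t0.tScreen_string_two' (h.diag j) (h.r_pos (by norm_num) j) h.short_cast 0
      (by norm_num) (v := 0) (by simp) (by abel)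
    have s2 := t2.tScreen_string_three' (h.diag j) (h.r_pos (by norm_num) j) h.short_cast 4
      (by norm_num) (v := -yVar 0 k i 7) (by simp [yVar_apply_of_ne h.ne])
      (by simp only [Nat.cast_one, Int.reduceAdd]; abel)
    have s5 := t5.tScreen_string_two' (h.diag j) (h.r_pos (by norm_num) j) h.short_cast 10
      (by norm_num) (v := -yVar 0 k i 11) (by simp [yVar_apply_of_ne h.ne]) (by abel)
    simp only [Nat.cast_one, Int.reduceAdd, map_add] at s0 s2 s5
    rw [hc]
    simp only [map_add]
    rw [← add_assoc, s0, zero_add, ← add_assoc, ← add_assoc, s2, zero_add, s5]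

end IsFiniteShape

/-! ### Type `A_1 × A_1` -/

/-- Type `A_1 × A_1`: the deformed two-term element `Y_{i,0} (1 + A_{i,r_i}⁻¹)`. -/
theorem hasDeformedElement_of_offDiag_eq_zero
    (hQ : ∀ c, Q c c = T (r c : ℤ) + T (-(r c : ℤ))) (hr : ∀ c, 0 < r c)
    (h0 : ∀ c d, c ≠ d → Q c d = 0) (i : Fin 2) : HasDeformedElement Q r i := by
  have ha : ∀ c, c ≠ i → ∀ a l : ℤ, aVec Q (i, a) (c, l) = 0 := fun c hc a l => by
    rw [aVec_apply, h0 c i hc]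
    rfl
  have hr' : (0 : ℤ) < r i := by exact_mod_cast hr i
  have t0 := isConeTerm_monY (Q := Q) (r := r) (i := i)
  have t1 := t0.mul (i, 0 + r i) (by simp) (u' := Finsupp.single (i, 0) 1 - aVec Q (i, 0 + r i))
    (by abel)
  refine ⟨tKerInInf_inf_tildeC_ne_bot (t0.mul_mem (i, 0 + r i) (by simp)) fun c => ?_,
    t1.exists_mem_coneC fun ⟨c, l⟩ => ?_⟩
  · by_cases hc : c = i
    · subst hc
      exact t0.tScreen_string_two (v := 0) (hQ c) (hr c) (by simp) (fun _ => rfl) (by simp)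
    · have hne : ∀ l, (Finsupp.single (i, (0 : ℤ)) (1 : ℤ) : YMon 2) (c, l) = 0 := fun l => by
        rw [Finsupp.single_apply, if_neg fun e => hc (congrArg Prod.fst e).symm]
      rw [map_add, t0.tScreen_eq_zero hne, t1.tScreen_eq_zero, add_zero]
      intro l
      rw [Finsupp.sub_apply, hne, ha c hc, sub_zero]
  · rw [Finsupp.sub_apply, Finsupp.single_apply]
    by_cases hc : c = i
    · subst hc
      rw [aVec_diag (hQ c)]
      simp only [Prod.mk.injEq, true_and]
      split_ifs <;> omega
    · rw [ha c hc, if_neg fun e => hc (congrArg Prod.fst e).symm, sub_zero]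

/-- Type `A_1 × A_1`: the element `Y_{i,l} (1 + A_{i,l+r_i}⁻¹)`. -/
theorem hasTop_of_offDiag_eq_zero (h0 : ∀ c d, c ≠ d → Q c d = 0) (p : Fin 2 × ℤ) :
    HasTop Q r (Finsupp.single p 1) := by
  obtain ⟨i, l⟩ := p
  have t0 : IsTerm Q (Finsupp.single (i, l) 1) 1 (Finsupp.single (i, l) 1) := isTerm_one
  have t1 := t0.mul_X (i, l + r i) (u' := Finsupp.single (i, l) 1 - aVec Q (i, l + r i))
    (by abel)
  refine ⟨1 + MvPolynomial.X (i, l + (r i : ℤ)), fun c => ?_, ?_⟩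
  · by_cases hc : c = i
    · subst hc
      simpa using t0.mem_of_list (r := r) [l] (v := 0) (fun _ => rfl) (by simp)
    · have hne : ∀ l', (Finsupp.single (i, l) (1 : ℤ) : YMon 2) (c, l') = 0 := fun l' => by
        rw [Finsupp.single_apply, if_neg fun e => hc (congrArg Prod.fst e).symm]
      have s1 := t1.mem₀ (r := r) (c := c) fun l' => by
        rw [Finsupp.sub_apply, hne, aVec_apply, h0 c i hc]
        rfl
      rw [one_mul] at s1
      exact add_mem (t0.mem₀ hne) s1
  · simp

end

/-! ### The finite types -/

section

variable {C : Matrix (Fin 2) (Fin 2) ℤ} {Q : Matrix (Fin 2) (Fin 2) ℤ[T;T⁻¹]} {r : Fin 2 → ℕ}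

/-- Fundamental elements suffice for the classical algorithm if there are nonnegative weights `a`
of the colours for which all `A_{d,l}` have positive height. -/
theorem classicalFMem_of_hasTop (hQ : ∀ c, Q c c = T (r c : ℤ) + T (-(r c : ℤ)))
    (hr : ∀ c, 0 < r c) (htop : ∀ p, HasTop Q r (Finsupp.single p 1)) (a : Fin 2 → ℕ)
    (ha : ∀ d, 0 < ∑ c, (a c : ℤ) * evalOne (Q c d)) {m : YMon 2} (hm : Dominant m) :
    ClassicalFMem Q r m := by
  obtain ⟨f, hf, hf0, hdom⟩ := exists_unique_dominant htop (∑ c, a c • wt c)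
    (fun m hm => by
      rw [AddMonoidHom.finsetSum_apply]
      exact Finset.sum_nonneg fun c _ => nsmul_nonneg (wt_nonneg fun l => hm _) _)
    (fun p => by
      rw [AddMonoidHom.finsetSum_apply]
      simpa [wt_aVec] using ha p.1) hm
  exact classicalFMem_of_formalKer hQ hr hf hf0 hdom

end

section

variable {C : Matrix (Fin 2) (Fin 2) ℤ} {Q : Matrix (Fin 2) (Fin 2) ℤ[T;T⁻¹]} {r : Fin 2 → ℕ}
variable {i j : Fin 2} {q k : ℕ}

theorem coeff_quantumInt_natCast (n : ℕ) (e : ℤ) : (quantumInt 1 (n : ℤ)).coeff e =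
    ∑ s ∈ Finset.range n, if 2 * (s : ℤ) + 1 - n = e then 1 else 0 := by
  rcases Nat.eq_zero_or_pos n with rfl | hn
  · simp [quantumInt]
  · have h1 : (n : ℤ).sign = 1 := Int.sign_eq_one_of_pos (by exact_mod_cast hn)
    rw [quantumInt, h1, one_smul, AddMonoidAlgebra.coeff_sum, Finsupp.finsetSum_apply,
      Int.natAbs_natCast]
    exact Finset.sum_congr rfl fun s _ => by simp [LaurentPolynomial.T_apply]

theorem coeff_quantumInt_natCast_top {n : ℕ} (hn : 0 < n) :
    (quantumInt 1 (n : ℤ)).coeff (n - 1) = 1 := by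
  rw [coeff_quantumInt_natCast, Finset.sum_eq_single (n - 1)]
  · rw [if_pos]
    push_cast [hn]
    ring
  · intro s _ hs
    rw [if_neg]
    omega
  · intro h
    exact absurd (Finset.mem_range.mpr (by omega)) h

theorem coeff_quantumInt_natCast_eq_zero {n : ℕ} {e : ℤ} (he : n ≤ e) :
    (quantumInt 1 (n : ℤ)).coeff e = 0 := by
  rw [coeff_quantumInt_natCast]
  refine Finset.sum_eq_zero fun s hs => if_neg ?_
  rw [Finset.mem_range] at hs
  omega

/-- If `[qk]_z = [q]_z [k]_z` with `2 ≤ q`, then `k = 1`, by comparison of the leading terms. -/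
theorem eq_one_of_quantumInt_mul (hq : q = 2 ∨ q = 3) (hk : 0 < k)
    (h : quantumInt 1 ((q * k : ℕ) : ℤ) * quantumInt 1 (-1) =
      quantumInt 1 (k : ℤ) * quantumInt 1 (-(q : ℤ))) : k = 1 := by
  by_contra hk1
  have h2 : 2 ≤ k := by omega
  have h1 := congrArg (fun x : ℤ[T;T⁻¹] => x.coeff ((q * k : ℕ) - 1)) h
  rw [quantumInt_neg_one, mul_neg_one] at h1
  simp only [AddMonoidAlgebra.coeff_neg, Finsupp.neg_apply] at h1
  have hcoeff : ∀ x : ℤ[T;T⁻¹], ∀ a e : ℤ, (x * T a).coeff e = x.coeff (e - a) := fun x a e => by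
    rw [LaurentPolynomial.T, AddMonoidAlgebra.coeff_mul_single_apply, mul_one, sub_eq_add_neg]
  rw [coeff_quantumInt_natCast_top (Nat.mul_pos (by omega) hk)] at h1
  rcases hq with rfl | rfl
  · rw [show -((2 : ℕ) : ℤ) = -2 from rfl, quantumInt_neg_two, mul_neg, mul_add] at h1
    simp only [AddMonoidAlgebra.coeff_neg, AddMonoidAlgebra.coeff_add, Finsupp.neg_apply,
      Finsupp.add_apply, hcoeff] at h1
    rw [coeff_quantumInt_natCast_eq_zero (by push_cast; omega),
      coeff_quantumInt_natCast_eq_zero (by push_cast; omega)] at h1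
    omega
  · rw [show -((3 : ℕ) : ℤ) = -3 from rfl, quantumInt_neg_three, mul_neg, mul_add, mul_add,
      mul_one] at h1
    simp only [AddMonoidAlgebra.coeff_neg, AddMonoidAlgebra.coeff_add, Finsupp.neg_apply,
      Finsupp.add_apply, hcoeff] at h1
    rw [coeff_quantumInt_natCast_eq_zero (by push_cast; omega),
      coeff_quantumInt_natCast_eq_zero (by push_cast; omega),
      coeff_quantumInt_natCast_eq_zero (by push_cast; omega)] at h1
    omega

/-- The deformed Cartan matrices of types `A_2`, `B_2` and `G_2`. -/
theorem isFiniteShape_defCartan (hC : IsGCM C) (hr : ∀ i, 0 < r i) (hB : IsSymmetrizedBy C r)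
    (hne : i ≠ j) (hq : q = 1 ∨ q = 2 ∨ q = 3) (hij : C i j = -1) (hji : C j i = -(q : ℤ)) :
    IsFiniteShape (defCartan C r) r i j q (r j) := by
  have hri : r i = q * r j := by
    have := symm_of_isSymmetrizedBy hB i j
    rw [hij, hji] at this
    zify
    linarith
  have key : defCartan C r i j = -1 ∧ defCartan C r j i = quantumInt (r j) (-(q : ℤ)) := by
    rw [defCartan]
    split
    -- `C(z)` has the entry `[-q]_z`, and `C'(z)` the entry `[-q]_{z^{r_j}}`
    · next hs =>
      simp only [cartanZ, Matrix.of_apply, if_neg hne, if_neg hne.symm, hij, hji]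
      refine ⟨quantumInt_neg_one 1, ?_⟩
      rcases hq with rfl | hq
      · rw [Nat.cast_one, quantumInt_neg_one, quantumInt_neg_one]
      · rw [eq_one_of_quantumInt_mul hq (hr j)]
        have := hs.apply j i
        simpa [symCartanZ, Matrix.diagonal_mul, cartanZ, hne, hne.symm, hij, hji, hri] using this
    · simp [cartanZ', hij, hji, quantumInt_neg_one]
  exact ⟨hne, hr j, hri, rfl, defCartan_diag hC r, key.1, key.2⟩

theorem defCartan_eq_zero (hne : i ≠ j) (h : C i j = 0) : defCartan C r i j = 0 := by
  rw [defCartan]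
  split <;> simp [cartanZ, cartanZ', hne, h, quantumInt_zero]

namespace IsFiniteShape

/-- In type `A_2` the two nodes play the same role. -/
theorem symm (h : IsFiniteShape Q r i j 1 k) : IsFiniteShape Q r j i 1 k where
  ne := h.ne.symm
  pos := h.pos
  long := by rw [h.short, one_mul]
  short := by rw [h.long, one_mul]
  diag := h.diag
  long_short := by rw [h.short_long, Nat.cast_one, quantumInt_neg_one]
  short_long := by rw [h.long_short, Nat.cast_one, quantumInt_neg_one]

theorem hasTop (h : IsFiniteShape Q r i j q k) (hq : q = 1 ∨ q = 2 ∨ q = 3) (p : Fin 2 × ℤ) :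
    HasTop Q r (Finsupp.single p 1) := by
  obtain ⟨c, l⟩ := p
  have e : ∀ c, Finsupp.single (c, l) 1 = yVar l k c 0 := fun c => by simp [yVar]
  rw [e]
  rcases h.eq_or_eq c with rfl | rfl <;> rcases hq with rfl | rfl | rfl
  · exact hasTop_long_one h l
  · exact hasTop_long_two h l
  · exact hasTop_long_three h l
  · exact hasTop_long_one h.symm l
  · exact hasTop_short_two h l
  · exact hasTop_short_three h l

theorem hasDeformedElement (h : IsFiniteShape Q r i j q k) (hq : q = 1 ∨ q = 2 ∨ q = 3) :
    HasDeformedElement Q r j := by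
  rcases hq with rfl | rfl | rfl
  · exact h.hasDeformedElement_one
  · exact h.hasDeformedElement_two
  · exact h.hasDeformedElement_three

/-- There are positive heights with respect to which every `A_{c,l}` has positive height. -/
theorem exists_height (h : IsFiniteShape Q r i j q k) (hq : q ≤ 3) :
    ∃ a : Fin 2 → ℕ, ∀ d, 0 < ∑ c, (a c : ℤ) * evalOne (Q c d) := by
  have hsum : ∀ f : Fin 2 → ℤ, ∑ c, f c = f i + f j := fun f => by
    have := h.ne
    rw [Fin.sum_univ_two]
    fin_cases i <;> fin_cases j <;> simp_all [add_comm]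
  -- `2 · 5 - 3 q > 0` for `q ≤ 3`, and `2 · 3 - 5 > 0`
  refine ⟨fun c => if c = i then 5 else 3, fun d => ?_⟩
  rw [hsum]
  rcases h.eq_or_eq d with rfl | rfl
  · rw [h.diag, h.short_long, map_add, evalOne_T, evalOne_T, evalOne_quantumInt]
    simp only [if_pos, if_neg h.ne.symm]
    push_cast
    omega
  · rw [h.diag, h.long_short, map_add, evalOne_T, evalOne_T, map_neg, map_one]
    simp [h.ne.symm]

end IsFiniteShape

theorem finite_cases (hC : IsGCM C) (h : C 0 1 * C 1 0 ≤ 3) :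
    (∀ c d, c ≠ d → C c d = 0) ∨ ∃ (i j : Fin 2) (q : ℕ), i ≠ j ∧ (q = 1 ∨ q = 2 ∨ q = 3) ∧
      C i j = -1 ∧ C j i = -(q : ℤ) := by
  have n01 := hC.nonpos 0 1 (by decide)
  have n10 := hC.nonpos 1 0 (by decide)
  by_cases h0 : C 0 1 = 0
  · left
    have h1 := (hC.zero_iff 0 1).mp h0
    intro c d hcd
    fin_cases c <;> fin_cases d <;> simp_all
  · right
    have h1 : C 1 0 ≠ 0 := fun e => h0 ((hC.zero_iff 0 1).mpr e)
    by_cases h2 : C 0 1 = -1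
    · rw [h2] at h
      exact ⟨0, 1, (C 1 0).natAbs, by decide, by omega, h2, by omega⟩
    · have h3 : C 1 0 = -1 := by
        by_contra h3
        have a : C 0 1 ≤ -2 := by omega
        have b : C 1 0 ≤ -2 := by omega
        nlinarith
      rw [h3] at h
      exact ⟨1, 0, (C 0 1).natAbs, by decide, by omega, h3, by omega⟩

theorem classicalFMem_and_exists_hasDeformedElement (hC : IsGCM C) (hr : ∀ i, 0 < r i)
    (hB : IsSymmetrizedBy C r) (h : C 0 1 * C 1 0 ≤ 3) :
    (∀ m, Dominant m → ClassicalFMem (defCartan C r) r m) ∧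
      ∃ i, HasDeformedElement (defCartan C r) r i := by
  have hQ := defCartan_diag hC r
  rcases finite_cases hC h with h0 | ⟨i, j, q, hne, hq, hij, hji⟩
  · have h0' : ∀ c d, c ≠ d → defCartan C r c d = 0 := fun c d hcd =>
      defCartan_eq_zero hcd (h0 c d hcd)
    refine ⟨fun m => classicalFMem_of_hasTop hQ hr (hasTop_of_offDiag_eq_zero h0') (fun _ => 1)
      fun d => ?_, 0, hasDeformedElement_of_offDiag_eq_zero hQ hr h0' 0⟩
    rw [Fin.sum_univ_two]
    fin_cases d <;> simp [hQ, h0']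
  · have hs := isFiniteShape_defCartan hC hr hB hne hq hij hji
    obtain ⟨a, ha⟩ := hs.exists_height (by omega)
    exact ⟨fun m => classicalFMem_of_hasTop hQ hr (hs.hasTop hq) a ha, j,
      hs.hasDeformedElement hq⟩

end

end QTChar

end

theorem mainTheorem8 (C : Matrix (Fin 2) (Fin 2) ℤ) (hC : QTChar.IsGCM C)
    (r : Fin 2 → ℕ) (hr : ∀ i, 0 < r i) (hB : QTChar.IsSymmetrizedBy C r)
    (hdet : (QTChar.cartanZ C r).det ≠ 0) :
    List.TFAE [
      ∀ m : QTChar.YMon 2, QTChar.Dominant m → QTChar.ClassicalFMem (QTChar.defCartan C r) r m,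
      QTChar.IsFiniteType C,
      C 0 1 * C 1 0 ≤ 3,
      ∃ i : Fin 2, QTChar.tKerInInf (QTChar.defCartan C r) r ⊓
        QTChar.tildeC (QTChar.defCartan C r) (QTChar.monY i 0) ≠ ⊥,
      ∃ i : Fin 2, ∃ m ∈ QTChar.coneC (QTChar.defCartan C r) (QTChar.monY i 0),
        QTChar.Antidominant (QTChar.uExp (QTChar.defCartan C r) m)] := by
  have hspec := QTChar.specializes_defCartan hC r
  have hQ := QTChar.defCartan_diag hC r
  tfae_have 2 ↔ 3 := QTChar.isFiniteType_iff hC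
  tfae_have 1 → 3 := fun h => by
    by_contra h4
    refine h4 (QTChar.offDiag_mul_le_three_of_classicalFMem hC hspec hQ hr
      (QTChar.det_defCartan_ne_zero hC hr hB hdet (by omega)) (h _ fun p => ?_))
    rw [Finsupp.single_apply]
    split <;> simp
  tfae_have 4 → 3 := fun ⟨_, h⟩ => QTChar.offDiag_mul_le_three_of_tKer hC hspec hQ hr h
  tfae_have 5 → 3 := fun ⟨_, _, hm, h⟩ => QTChar.offDiag_mul_le_three_of_coneC hC hspec hm h
  tfae_have 3 → 1 := fun h =>
    (QTChar.classicalFMem_and_exists_hasDeformedElement hC hr hB h).1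
  tfae_have 3 → 4 := fun h =>
    let ⟨i, hi⟩ := (QTChar.classicalFMem_and_exists_hasDeformedElement hC hr hB h).2
    ⟨i, hi.1⟩
  tfae_have 3 → 5 := fun h =>
    let ⟨i, hi⟩ := (QTChar.classicalFMem_and_exists_hasDeformedElement hC hr hB h).2
    ⟨i, hi.2⟩
  tfae_finish
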